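/- Let $(\Omega,\mathcal F,P)$ be a probability space with a Dirichlet structure on $L^2(\Omega;\mathbb R)$: a dense subspace $\widetilde{\mathbb D}\subseteq L^2(\Omega;\mathbb R)$ and a symmetric, bilinear map $\widetilde\Gamma:\widetilde{\mathbb D}\times\widetilde{\mathbb D}\to L^1(\Omega;\mathbb R)$ with $\widetilde\Gamma(f,f)\ge 0$, such that for all $m,n$, all Lipschitz $C^1$ functions $\varphi:\mathbb R^m\to\mathbb R$, $\psi:\mathbb R^n\to\mathbb R$ and all $f\in\widetilde{\mathbb D}^m$, $g\in\widetilde{\mathbb D}^n$ one has $\varphi(f),\psi(g)\in\widetilde{\mathbb D}$ and $\widetilde\Gamma(\varphi(f),\psi(g))=\sum_{i,j}\partial_i\varphi(f)\,\partial_j\psi(g)\,\widetilde\Gamma(f_i,g_j)$, and such that $\widetilde{\mathbb D}$ is complete for the norm $(\|f\|_{L^2}^2+\tfrac12 E\,\widetilde\Gamma(f,f))^{1/2}$. Let $\widetilde L$ be its generator: $f\in\operatorname{dom}\widetilde L$ and $\widetilde Lf=h\in L^2(\Omega;\mathbb R)$ if and only if $f\in\widetilde{\mathbb D}$ and $E\,\widetilde\Gamma(f,g)=-E(hg)$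 for all $g\in\widetilde{\mathbb D}$. Assume that $-\widetilde L$ is diagonalizable with eigenvalues among $0=\lambda_0<\lambda_1<\cdots$, i.e. the spaces $\ker(\widetilde L+\lambda_p\operatorname{Id})$, $p\ge 0$, span a dense subspace of $L^2(\Omega;\mathbb R)$, and that $\ker\widetilde L$ consists of the constants. Let $\widetilde\pi_p$ be the orthogonal projection onto $\ker(\widetilde L+\lambda_p\operatorname{Id})$ and $\widetilde L^{-1}=-\sum_{p\ge1}\lambda_p^{-1}\widetilde\pi_p$. Let $K$ be a real separable Hilbert space with orthonormal basis $(k_i)$, and for $F\in L^2(\Omega;K)$ write $F=\sum_i f_i\otimes k_i$ with $f_i=\langle F,k_i\rangle$. Put $\pi_pF=\sum_i(\widetilde\pi_pf_i)\otimes k_i$, $L^{-1}F=\sum_i(\widetilde L^{-1}f_i)\otimes k_i$ and $\mathbb D=\{F\in L^2(\Omega;K):\sum_p\lambda_p\|\pi_pF\|_{L^2(\Omega;K)}^2<\infty\}$; for $F=\sum_i f_i\otimes k_i$ and $G=\sum_j g_j\otimes k_j$ in $\mathbb D$ let $\Gamma(F,G)=\tfrac12\sum_{i,j}\widetilde\Gamma(f_i,g_j)\,(k_i\otimes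 k_j+k_j\otimes k_i)$, a random operator on $K$, where $(k\otimes k')u=\langle k,u\rangle k'$. Let $\|\cdot\|_{HS}$ be the Hilbert–Schmidt norm and $\|T\|_{L^2(\Omega;HS)}=(E\|T\|_{HS}^2)^{1/2}\in[0,\infty]$. For $K$-valued random variables $X,Y$ (possibly defined on different probability spaces) let $$d_2(X,Y)=\sup_h|E\,h(X)-E\,h(Y)|,$$ the supremum being over all twice Fréchet differentiable $h:K\to\mathbb R$ with $\sup_x\|\nabla h(x)\|\le1$ and $\sup_x\|\nabla^2h(x)\|_{HS}\le1$, and let $d_W(X,Y)$ be the Wasserstein distance, i.e. the same supremum over all $1$-Lipschitz $h:K\to\mathbb R$. **Theorem.** Let $Z$ be a centered, non-degenerate Gaussian random variable on $K$ (every non-zero continuous linear functional of $Z$ is Gaussian with mean zero and positive variance) with covariance operator $S$, $Su=E(\langle Z,u\rangle Z)$, and let $F\in\mathbb D$ with $E(F)=0$. Then $$d_2(F,Z)\le\tfrac12\,\|\Gamma(F,-L^{-1}F)-S\|_{L^2(\Omega;HS)}.$$ If $K$ has dimension $d<\infty$, then $$d_W(F,Z)\le C_{S,d}\,\|\Gamma(F,-L^{-1}F)-S\|_{L^2(\Omega;HS)},\qquad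 C_{S,d}=\sqrt{d\,\|S\|_{op}}\;\|S^{-1}\|_{op}.$$ -/

import Mathlib

open MeasureTheory ProbabilityTheory Filter Topology
open scoped ENNReal NNReal

noncomputable section

/-! ### Hilbert–Schmidt norm -/

section HilbertSchmidt

variable (K : Type*) [NormedAddCommGroup K] [InnerProductSpace ℝ K] [CompleteSpace K]

/-- Index set of the fixed orthonormal basis of `K`. -/
def OnbIndex : Set K := (exists_hilbertBasis ℝ K).choose

/-- A fixed orthonormal (Hilbert) basis of `K`. -/
def onb : HilbertBasis (OnbIndex K) ℝ K := (exists_hilbertBasis ℝ K).choose_spec.choose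

variable {K}

/-- The Hilbert–Schmidt norm `(∑ i, ‖T kᵢ‖²)^(1/2)` of a bounded operator, `∞` if `T` is not
Hilbert–Schmidt. For `E = K →L[ℝ] ℝ` this is the norm of the bilinear form `T` in `K ⊗ K`. -/
def hsNorm {E : Type*} [NormedAddCommGroup E] [NormedSpace ℝ E] (T : K →L[ℝ] E) : ℝ≥0∞ :=
  (∑' i, ‖T (onb K i)‖ₑ ^ 2) ^ (1 / 2 : ℝ)

lemma tsum_enorm_inner_sq {E ι : Type*} [NormedAddCommGroup E] [InnerProductSpace ℝ E]
    (c : HilbertBasis ι ℝ E) (x : E) : ∑' j, ‖inner ℝ (c j) x‖ₑ ^ 2 = ‖x‖ₑ ^ 2 := by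
  have h := (c.hasSum_inner_mul_inner x x)
  have h1 : ∀ j, inner ℝ x (c j) * inner ℝ (c j) x = ‖inner ℝ (c j) x‖ ^ 2 := by
    intro j
    rw [real_inner_comm x (c j), Real.norm_eq_abs, sq_abs, sq]
  simp only [h1, real_inner_self_eq_norm_sq] at h
  have h2 : ∀ y : E, ‖y‖ₑ ^ 2 = ENNReal.ofReal (‖y‖ ^ 2) := by
    intro y
    rw [ENNReal.ofReal_pow (norm_nonneg _), ofReal_norm]
  have h3 : ∀ y : ℝ, ‖y‖ₑ ^ 2 = ENNReal.ofReal (‖y‖ ^ 2) := by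
    intro y
    rw [ENNReal.ofReal_pow (norm_nonneg _), ofReal_norm]
  rw [h2 x]
  simp only [h3]
  rw [← h.tsum_eq, ENNReal.ofReal_tsum_of_nonneg (fun _ => by positivity) h.summable]

lemma tsum_enorm_sq_eq_adjoint {E ι κ : Type*} [NormedAddCommGroup E] [InnerProductSpace ℝ E]
    [CompleteSpace E] (b : HilbertBasis ι ℝ K) (c : HilbertBasis κ ℝ E) (T : K →L[ℝ] E) :
    ∑' i, ‖T (b i)‖ₑ ^ 2 = ∑' j, ‖ContinuousLinearMap.adjoint T (c j)‖ₑ ^ 2 := by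
  simp_rw [← tsum_enorm_inner_sq c (T _)]
  rw [ENNReal.tsum_comm]
  refine tsum_congr fun j => ?_
  rw [← tsum_enorm_inner_sq b]
  refine tsum_congr fun i => ?_
  rw [← ContinuousLinearMap.adjoint_inner_left, real_inner_comm]

/-- The Hilbert–Schmidt norm does not depend on the orthonormal basis. -/
lemma hsNorm_eq {E ι : Type*} [NormedAddCommGroup E] [InnerProductSpace ℝ E] [CompleteSpace E]
    (b : HilbertBasis ι ℝ K) (T : K →L[ℝ] E) :
    hsNorm T = (∑' i, ‖T (b i)‖ₑ ^ 2) ^ (1 / 2 : ℝ) := by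
  rw [hsNorm, tsum_enorm_sq_eq_adjoint (onb K) (onb E), tsum_enorm_sq_eq_adjoint b (onb E)]

end HilbertSchmidt

/-! ### Probability distances -/

section Distances

variable {K : Type*} [NormedAddCommGroup K] [InnerProductSpace ℝ K] [CompleteSpace K]

/-- `‖h‖_{C_b²} = sup_{j = 1, 2} sup_x ‖∇ʲ h(x)‖_{K^{⊗ j}}`, where `K ⊗ K` carries the Hilbert
(that is, Hilbert–Schmidt) norm. -/
def cb2Norm (h : K → ℝ) : ℝ≥0∞ :=
  max (⨆ x, ‖fderiv ℝ h x‖ₑ) (⨆ x, hsNorm (fderiv ℝ (fderiv ℝ h) x))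

/-- The unit ball of `C_b²(K)`: twice Fréchet differentiable `h` with `‖h‖_{C_b²} ≤ 1`. -/
def cb2Ball (K : Type*) [NormedAddCommGroup K] [InnerProductSpace ℝ K] [CompleteSpace K] :
    Set (K → ℝ) :=
  {h | Differentiable ℝ h ∧ Differentiable ℝ (fderiv ℝ h) ∧ cb2Norm h ≤ 1}

variable [MeasurableSpace K]

/-- The `d₂` distance between two laws on `K`. -/
def d2Dist (μ ν : Measure K) : ℝ≥0∞ :=
  ⨆ h ∈ cb2Ball K, ENNReal.ofReal |∫ x, h x ∂μ - ∫ x, h x ∂ν|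

/-- The (1-)Wasserstein distance between two laws on `K`: the supremum over 1-Lipschitz test
functions. -/
def wassersteinDist (μ ν : Measure K) : ℝ≥0∞ :=
  ⨆ h ∈ {h : K → ℝ | LipschitzWith 1 h}, ENNReal.ofReal |∫ x, h x ∂μ - ∫ x, h x ∂ν|

end Distances

/-! ### Real-valued Dirichlet structures -/

variable {Ω : Type*} [MeasurableSpace Ω]

/-- A Dirichlet structure on `L²(Ω; ℝ)` with carré du champ operator. -/
structure DirichletStructure (P : Measure Ω) where
  /-- the Dirichlet domain -/
  dom : Submodule ℝ (Lp ℝ 2 P)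
  /-- the carré du champ operator, bilinear on the domain -/
  cdc : dom →ₗ[ℝ] dom →ₗ[ℝ] Lp ℝ 1 P
  dense_dom : Dense (dom : Set (Lp ℝ 2 P))
  cdc_symm : ∀ f g, cdc f g = cdc g f
  cdc_nonneg : ∀ f, 0 ≤ᵐ[P] cdc f f
  /-- the diffusion property -/
  diffusion : ∀ (m n : ℕ) (φ : (Fin m → ℝ) → ℝ) (ψ : (Fin n → ℝ) → ℝ),
    ContDiff ℝ 1 φ → (∃ C, LipschitzWith C φ) → ContDiff ℝ 1 ψ → (∃ C, LipschitzWith C ψ) →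
    ∀ (f : Fin m → dom) (g : Fin n → dom), ∃ u v : dom,
      ((u : Lp ℝ 2 P) =ᵐ[P] fun ω => φ fun i => (f i : Lp ℝ 2 P) ω) ∧
      ((v : Lp ℝ 2 P) =ᵐ[P] fun ω => ψ fun j => (g j : Lp ℝ 2 P) ω) ∧
      cdc u v =ᵐ[P] fun ω => ∑ i, ∑ j,
        fderiv ℝ φ (fun k => (f k : Lp ℝ 2 P) ω) (Pi.single i 1) *
        fderiv ℝ ψ (fun k => (g k : Lp ℝ 2 P) ω) (Pi.single j 1) * cdc (f i) (g j) ω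
  /-- closedness: `dom` is complete for the norm `(‖f‖² + 𝓔(f, f))^(1/2)`,
  `𝓔(f, g) = 2⁻¹ E Γ(f, g)` -/
  complete : ∀ f : ℕ → dom,
    (∀ ε > 0, ∃ N, ∀ m ≥ N, ∀ n ≥ N,
      ‖f m - f n‖ ^ 2 + 2⁻¹ * ∫ ω, cdc (f m - f n) (f m - f n) ω ∂P < ε) →
    ∃ g : dom, Tendsto (fun n => ‖f n - g‖ ^ 2 + 2⁻¹ * ∫ ω, cdc (f n - g) (f n - g) ω ∂P)
      atTop (𝓝 0)

namespace DirichletStructure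

variable {P : Measure Ω} (D : DirichletStructure P)

/-- `D.IsGenerator f h` means that `f ∈ dom L` and `L f = h`, where `L` is the generator associated
with the form: `E Γ(f, g) = - E (h g)` for all `g` in the Dirichlet domain. -/
def IsGenerator (f h : Lp ℝ 2 P) : Prop :=
  ∃ hf : f ∈ D.dom, ∀ g : D.dom, ∫ ω, D.cdc ⟨f, hf⟩ g ω ∂P = - inner ℝ h (g : Lp ℝ 2 P)

lemma integral_cdc_add (f f' g : D.dom) : ∫ ω, D.cdc (f + f') g ω ∂P
    = ∫ ω, D.cdc f g ω ∂P + ∫ ω, D.cdc f' g ω ∂P := by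
  rw [map_add, LinearMap.add_apply,
    ← integral_add (L1.integrable_coeFn _) (L1.integrable_coeFn _)]
  exact integral_congr_ae (Lp.coeFn_add _ _)

lemma integral_cdc_smul (c : ℝ) (f g : D.dom) : ∫ ω, D.cdc (c • f) g ω ∂P
    = c * ∫ ω, D.cdc f g ω ∂P := by
  rw [map_smul, LinearMap.smul_apply, ← integral_const_mul]
  exact integral_congr_ae (Lp.coeFn_smul _ _)

/-- The eigenspace `ker (L + l Id) ⊆ L²(Ω; ℝ)`. -/
def eigenspace (l : ℝ) : Submodule ℝ (Lp ℝ 2 P) where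
  carrier := {f | D.IsGenerator f (-(l • f))}
  zero_mem' := by
    refine ⟨D.dom.zero_mem, fun g => ?_⟩
    have := D.integral_cdc_smul 0 0 g
    rw [zero_smul, zero_mul] at this
    refine this.trans ?_
    simp
  add_mem' := by
    rintro a b ⟨ha, ha'⟩ ⟨hb, hb'⟩
    refine ⟨D.dom.add_mem ha hb, fun g => ?_⟩
    have := D.integral_cdc_add ⟨a, ha⟩ ⟨b, hb⟩ g
    rw [ha', hb'] at this
    refine this.trans ?_
    simp only [inner_neg_left, smul_add, inner_add_left]
    ring
  smul_mem' := by
    rintro c a ⟨ha, ha'⟩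
    refine ⟨D.dom.smul_mem c ha, fun g => ?_⟩
    have := D.integral_cdc_smul c ⟨a, ha⟩ g
    rw [ha'] at this
    refine this.trans ?_
    simp only [inner_neg_left, real_inner_smul_left]
    ring

/-- `E Γ(·, ·)` as a bilinear form. -/
def form : LinearMap.BilinForm ℝ D.dom :=
  LinearMap.mk₂ ℝ (fun f g => ∫ ω, D.cdc f g ω ∂P) D.integral_cdc_add D.integral_cdc_smul
    (fun f g g' => by
      simp only [D.cdc_symm f]
      exact D.integral_cdc_add _ _ _)
    (fun c f g => by
      simp only [D.cdc_symm f]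
      exact D.integral_cdc_smul _ _ _)

lemma isClosed_eigenspace (l : ℝ) : IsClosed (D.eigenspace l : Set (Lp ℝ 2 P)) := by
  refine IsSeqClosed.isClosed fun f x hf hx => ?_
  choose hd hB using hf
  have hB' : ∀ n, ∀ g : D.dom, D.form ⟨f n, hd n⟩ g = l * inner ℝ (f n) (g : Lp ℝ 2 P) := by
    intro n g
    refine (hB n g).trans ?_
    rw [inner_neg_left, real_inner_smul_left, neg_neg]
  have hpos : ∀ g : D.dom, 0 ≤ D.form g g := fun g =>
    integral_nonneg_of_ae (D.cdc_nonneg g)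
  obtain ⟨g, hg⟩ := D.complete (fun n => ⟨f n, hd n⟩) (by
    intro ε hε
    have hc := hx.cauchySeq
    rw [Metric.cauchySeq_iff] at hc
    obtain ⟨N, hN⟩ := hc (√(ε / (1 + |l|))) (by positivity)
    refine ⟨N, fun m hm n hn => ?_⟩
    have h1 : ‖f m - f n‖ ^ 2 < ε / (1 + |l|) := by
      have := hN m hm n hn
      rw [dist_eq_norm] at this
      exact (Real.lt_sqrt (norm_nonneg _)).1 this
    have h2 : D.form (⟨f m, hd m⟩ - ⟨f n, hd n⟩) (⟨f m, hd m⟩ - ⟨f n, hd n⟩)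
        = l * ‖f m - f n‖ ^ 2 := by
      have h3 : ∀ g' : D.dom, D.form (⟨f m, hd m⟩ - ⟨f n, hd n⟩) g'
          = l * inner ℝ (f m - f n) (g' : Lp ℝ 2 P) := fun g' => by
        rw [map_sub D.form, LinearMap.sub_apply, hB', hB', ← mul_sub, ← inner_sub_left]
      rw [h3, ← real_inner_self_eq_norm_sq]
      rfl
    change ‖f m - f n‖ ^ 2 + 2⁻¹ * D.form _ _ < ε
    rw [h2]
    rw [lt_div_iff₀ (by positivity)] at h1
    nlinarith [le_abs_self l, abs_nonneg l, sq_nonneg ‖f m - f n‖,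
      mul_le_mul_of_nonneg_right (le_abs_self l) (sq_nonneg ‖f m - f n‖)])
  have hn1 : Tendsto (fun n => ‖f n - (g : Lp ℝ 2 P)‖ ^ 2) atTop (𝓝 0) := by
    refine squeeze_zero (fun n => by positivity) (fun n => ?_) hg
    have := hpos (⟨f n, hd n⟩ - g)
    change _ ≤ ‖f n - (g : Lp ℝ 2 P)‖ ^ 2 + 2⁻¹ * D.form _ _
    linarith
  have hn2 : Tendsto (fun n => D.form (⟨f n, hd n⟩ - g) (⟨f n, hd n⟩ - g)) atTop (𝓝 0) := by
    have h3 := hg.const_mul 2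
    rw [mul_zero] at h3
    refine squeeze_zero (fun n => hpos _) (fun n => ?_) h3
    change _ ≤ 2 * (‖f n - (g : Lp ℝ 2 P)‖ ^ 2 + 2⁻¹ * D.form _ _)
    nlinarith [sq_nonneg ‖f n - (g : Lp ℝ 2 P)‖]
  have hxg : x = g := by
    refine tendsto_nhds_unique hx ?_
    rw [tendsto_iff_norm_sub_tendsto_zero]
    have := hn1.sqrt
    simpa using this
  subst hxg
  refine ⟨g.2, fun g' => ?_⟩
  have hsymm : ∀ a b, D.form a b = D.form b a := fun a b => by
    change ∫ ω, D.cdc a b ω ∂P = ∫ ω, D.cdc b a ω ∂P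
    rw [D.cdc_symm]
  have hCS : Tendsto (fun n => D.form (⟨f n, hd n⟩ - g) g') atTop (𝓝 0) := by
    have h4 : Tendsto (fun n => (D.form (⟨f n, hd n⟩ - g) g') ^ 2) atTop (𝓝 0) := by
      have h5 := hn2.mul_const (D.form g' g')
      rw [zero_mul] at h5
      refine squeeze_zero (fun n => sq_nonneg _) (fun n => ?_) h5
      have := LinearMap.BilinForm.apply_mul_apply_le_of_forall_zero_le D.form hpos
        (⟨f n, hd n⟩ - g) g'
      rw [hsymm g'] at this
      rw [sq]
      exact this
    have h6 := h4.sqrt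
    simp only [Real.sqrt_sq_eq_abs, Real.sqrt_zero] at h6
    exact (tendsto_zero_iff_abs_tendsto_zero _).2 h6
  have hl : Tendsto (fun n => D.form (⟨f n, hd n⟩ - g) g') atTop
      (𝓝 (l * inner ℝ (g : Lp ℝ 2 P) (g' : Lp ℝ 2 P) - D.form g g')) := by
    simp only [map_sub, LinearMap.sub_apply, hB']
    exact ((hx.inner tendsto_const_nhds).const_mul l).sub_const _
  have h7 := tendsto_nhds_unique hCS hl
  rw [inner_neg_left, real_inner_smul_left, neg_neg]
  change D.form g g' = _
  linarith

instance (l : ℝ) : (D.eigenspace l).HasOrthogonalProjection :=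
  haveI := (D.isClosed_eigenspace l).completeSpace_coe
  inferInstance

/-- The generator `-L` is diagonalizable with eigenvalues among `0 = ev 0 < ev 1 < ⋯`: its
eigenspaces span a dense subspace of `L²(Ω; ℝ)`, and the kernel consists of the constants. -/
structure IsDiagonalizedBy (ev : ℕ → ℝ) : Prop where
  ev_zero : ev 0 = 0
  strictMono : StrictMono ev
  dense : (⨆ p, D.eigenspace (ev p)).topologicalClosure = ⊤
  ker_const : ∀ f ∈ D.eigenspace 0, ∃ c : ℝ, f =ᵐ[P] fun _ => c

/-- The pseudo-inverse `L⁻¹ f = - ∑_{p ≥ 1} (ev p)⁻¹ π_p f` on `L²(Ω; ℝ)`, with `π_p` the orthogonal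
projection onto `ker (L + ev p Id)`. -/
def pseudoInv (ev : ℕ → ℝ) (f : Lp ℝ 2 P) : Lp ℝ 2 P :=
  - ∑' p : ℕ, (ev (p + 1))⁻¹ • (D.eigenspace (ev (p + 1))).starProjection f

open Classical in
/-- The carré du champ, extended by `0` to arguments outside of the Dirichlet domain. -/
def cdcExt (f g : Lp ℝ 2 P) : Lp ℝ 1 P :=
  if h : f ∈ D.dom ∧ g ∈ D.dom then D.cdc ⟨f, h.1⟩ ⟨g, h.2⟩ else 0

end DirichletStructure

/-! ### Tensorization to `L²(Ω; K)` -/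

section Tensorization

variable {K : Type*} [NormedAddCommGroup K] [InnerProductSpace ℝ K] [CompleteSpace K]
  {P : Measure Ω}

/-- The random variable `⟨u, F⟩`. -/
def coord (u : K) (F : Lp K 2 P) : Lp ℝ 2 P := (innerSL ℝ u).compLp F

/-- The elementary tensor `f ⊗ k`. -/
def elemTensor (f : Lp ℝ 2 P) (k : K) : Lp K 2 P :=
  (ContinuousLinearMap.toSpanSingleton ℝ k).compLp f

/-- The extension `T ⊗ Id_K` to `L²(Ω; K)` of an operator `T` on `L²(Ω; ℝ)`:
`∑ i, fᵢ ⊗ kᵢ` is mapped to `∑ i, T fᵢ ⊗ kᵢ`. -/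
def tensorExt (T : Lp ℝ 2 P → Lp ℝ 2 P) (F : Lp K 2 P) : Lp K 2 P :=
  ∑' i, elemTensor (T (coord (onb K i) F)) (onb K i)

/-- The tensor `k ⊗ k'`, as the operator `u ↦ ⟨k, u⟩ k'`. -/
def rankOneOp (k k' : K) : K →L[ℝ] K := (innerSL ℝ k).smulRight k'

namespace DirichletStructure

variable (D : DirichletStructure P)

variable (K) in
/-- The Dirichlet domain `𝔻 ⊆ L²(Ω; K)`: those `F` with `∑_p ev p ‖π_p F‖² < ∞`. -/
def domK (ev : ℕ → ℝ) : Set (Lp K 2 P) :=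
  {F | Summable fun p => ev p * ‖tensorExt (D.eigenspace (ev p)).starProjection F‖ ^ 2}

/-- The pseudo-inverse `L⁻¹` on `L²(Ω; K)`. -/
def pseudoInvK (ev : ℕ → ℝ) (F : Lp K 2 P) : Lp K 2 P :=
  tensorExt (D.pseudoInv ev) F

/-- The carré du champ operator on `L²(Ω; K)`, a random operator on `K`: for
`F = ∑ i, fᵢ ⊗ kᵢ` and `G = ∑ j, gⱼ ⊗ kⱼ`,
`Γ(F, G) = 2⁻¹ ∑ i, ∑ j, Γ(fᵢ, gⱼ) ⊗ (kᵢ ⊗ kⱼ + kⱼ ⊗ kᵢ)`. -/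
def cdcK (F G : Lp K 2 P) (ω : Ω) : K →L[ℝ] K :=
  ∑' p : OnbIndex K × OnbIndex K,
    (2⁻¹ * D.cdcExt (coord (onb K p.1) F) (coord (onb K p.2) G) ω) •
      (rankOneOp (onb K p.1 : K) (onb K p.2) + rankOneOp (onb K p.2 : K) (onb K p.1))

end DirichletStructure

/-- The norm `‖T‖_{L²(Ω; HS)}` of a random operator. -/
def l2hsNorm (P : Measure Ω) (T : Ω → K →L[ℝ] K) : ℝ≥0∞ :=
  (∫⁻ ω, hsNorm (T ω) ^ 2 ∂P) ^ (1 / 2 : ℝ)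

end Tensorization

/-! ### Gaussian random variables -/

/-- `Z` is a centered, non-degenerate Gaussian random variable on `K`: every continuous linear
functional of `Z` has a Gaussian law with mean zero, and with positive variance unless the
functional vanishes. -/
structure IsCenteredNondegGaussian {Ω' K : Type*} [MeasurableSpace Ω'] [NormedAddCommGroup K]
    [InnerProductSpace ℝ K] [MeasurableSpace K] (Z : Ω' → K) (P : Measure Ω') : Prop where
  gaussian : HasGaussianLaw Z P
  centered : ∀ x : StrongDual ℝ K, ∫ ω, x (Z ω) ∂P = 0
  nondegenerate : ∀ x : StrongDual ℝ K, x ≠ 0 → 0 < Var[fun ω => x (Z ω); P]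

/-- `S` is the covariance operator of `Z`: `S u = E (⟨Z, u⟩ Z)`. -/
def IsCovarianceOp {Ω' K : Type*} [MeasurableSpace Ω'] [NormedAddCommGroup K]
    [InnerProductSpace ℝ K] (Z : Ω' → K) (P : Measure Ω') (S : K →L[ℝ] K) : Prop :=
  ∀ u, S u = ∫ ω, (inner ℝ (Z ω) u : ℝ) • Z ω ∂P

end

noncomputable section

/-! ### Integration by parts for Gaussian measures -/

section GaussianIntegrationByParts

/-! The proof is a smart path between F and Z in finitely many coordinates. Let X be a finite vector
of coordinates of F, let Z stand for the same coordinates of the Gaussian, taken independent of X,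
and put Ψ(θ) = E h(cos θ X + sin θ Z), so that Ψ(0) = E h(X) and Ψ(π/2) = E h(Z). The derivative
pairs ∇h with cos θ Z − sin θ X, and an integration by parts turns each term into a Hessian. The
Gaussian one (`integral_dual_mul_of_isGaussian`) gives sin θ times the covariance. The one for X
(`integral_mul_comp_eq`) rests on E Γ(−L⁻¹f, u) = E(f u), valid for centered f, and the chain rule
for Γ gives cos θ Γ(f, −L⁻¹f). Hence Ψ'(θ) = sin θ cos θ E⟨Hess h, S − Γ⟩
(`hasDerivAt_interpolation`), and by symmetry of the Hessian only the symmetrized Γ counts.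

If the Hessian has Hilbert–Schmidt norm at most 1, Cauchy–Schwarz and ∫ sin θ cos θ dθ = 1/2 over
[0, π/2] give the first bound. If h is only 1-Lipschitz, one more Gaussian integration by parts
(`abs_sin_mul_integral_hessian_le`) replaces sin θ Hess h by ∇h times a weight whose second moment
is governed by ‖S⁻¹‖; the remaining factor cos θ has integral 1. This gives the constant √‖S⁻¹‖,
which is at most C_{S,d} since ‖S‖ ‖S⁻¹‖ ≥ 1 and d ≥ 1.

Three supports are needed. Test functions are mollified in finite dimension without loss in their
bounds (`exists_smooth_approx`). Spectral theory places the coordinates of F and −L⁻¹F in the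
Dirichlet domain with summable energies, so that the series for Γ(F, −L⁻¹F) converges almost surely
in operator norm (`ae_inner_cdcK`). Finally, a finite block of Γ − S has Frobenius norm at most the
Hilbert–Schmidt norm, and the coordinate projections exhaust K by dominated convergence
(`tendsto_integral_synthesis_analysis`). -/

lemma hasDerivAt_gaussianPDFReal (m : ℝ) {v : ℝ≥0} (hv : v ≠ 0) (x : ℝ) :
    HasDerivAt (gaussianPDFReal m v) (-((x - m) / v) * gaussianPDFReal m v x) x := by
  have hv' : (v : ℝ) ≠ 0 := by exact_mod_cast hv
  rw [gaussianPDFReal_def]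
  have h1 : HasDerivAt (fun x : ℝ => -(x - m) ^ 2 / (2 * v)) (-((x - m) / v)) x := by
    have := ((((hasDerivAt_id x).sub_const m).pow 2).neg).div_const (2 * (v : ℝ))
    refine this.congr_deriv ?_
    simp
    field_simp
  refine (h1.exp.const_mul _).congr_deriv ?_
  ring

lemma integrable_gaussianReal_iff {v : ℝ≥0} (hv : v ≠ 0) (m : ℝ) (f : ℝ → ℝ) :
    Integrable f (gaussianReal m v) ↔ Integrable (fun x => gaussianPDFReal m v x * f x) := by
  rw [gaussianReal_of_var_ne_zero m hv, integrable_withDensity_iff_integrable_smul'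
    (measurable_gaussianPDF m v) (ae_of_all _ fun _ => gaussianPDF_lt_top)]
  simp only [toReal_gaussianPDF, smul_eq_mul]

/-- Integration by parts for centered real Gaussian measures. -/
lemma integral_id_mul_gaussianReal {v : ℝ≥0} (hv : v ≠ 0) {g g' : ℝ → ℝ}
    (hg : ∀ x, HasDerivAt g (g' x) x) (hgi : Integrable g (gaussianReal 0 v))
    (hxg : Integrable (fun x => x * g x) (gaussianReal 0 v))
    (hg' : Integrable g' (gaussianReal 0 v)) :
    ∫ x, x * g x ∂gaussianReal 0 v = v * ∫ x, g' x ∂gaussianReal 0 v := by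
  have hv' : (v : ℝ) ≠ 0 := by exact_mod_cast hv
  rw [integrable_gaussianReal_iff hv] at hgi hxg hg'
  rw [integral_gaussianReal_eq_integral_smul hv, integral_gaussianReal_eq_integral_smul hv]
  -- Integration by parts on the line against the density p, with p' = −(x/v) p; integrability of
  -- the three products takes care of the boundary terms.
  have key := integral_mul_deriv_eq_deriv_mul_of_integrable (u := g) (u' := g')
    (v := gaussianPDFReal 0 v) (v' := fun x => -((x - 0) / v) * gaussianPDFReal 0 v x)
    (fun x _ => hg x) (fun x _ => hasDerivAt_gaussianPDFReal 0 hv x) ?_ ?_ ?_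
  · simp only [smul_eq_mul]
    have h2 : ∀ x, gaussianPDFReal 0 v x * (x * g x)
        = -v * (g x * (-((x - 0) / v) * gaussianPDFReal 0 v x)) := by
      intro x; field_simp; ring
    simp only [h2]
    rw [integral_const_mul, key]
    simp only [mul_comm (gaussianPDFReal 0 v _)]
    ring
  · refine (hxg.const_mul (-(v : ℝ)⁻¹)).congr (ae_of_all _ fun x => ?_)
    simp only [Pi.mul_apply]; field_simp; ring
  · exact hg'.congr (ae_of_all _ fun x => by simp only [Pi.mul_apply]; ring)
  · exact hgi.congr (ae_of_all _ fun x => by simp only [Pi.mul_apply]; ring)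

lemma memLp_two_of_lipschitzWith {E : Type*} [NormedAddCommGroup E] [MeasurableSpace E]
    [SecondCountableTopology E] [BorelSpace E] {μ : Measure E} [IsFiniteMeasure μ]
    (hμ : MemLp id 2 μ)
    {F : Type*} [NormedAddCommGroup F] {g : E → F} {C : ℝ≥0} (hg : LipschitzWith C g) :
    MemLp g 2 μ := by
  have h0 : MemLp (fun z : E => ‖z‖) 2 μ := hμ.norm
  have h1 : MemLp (fun z : E => ‖g 0‖ + C * ‖z‖) 2 μ :=
    MemLp.add (memLp_const (‖g 0‖)) (h0.const_mul (C : ℝ))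
  refine h1.mono hg.continuous.aestronglyMeasurable (ae_of_all _ fun z => ?_)
  have h2 := hg.dist_le_mul z 0
  rw [dist_eq_norm, dist_zero_right] at h2
  rw [Real.norm_of_nonneg (by positivity)]
  have := norm_le_norm_add_norm_sub' (g z) (g 0)
  linarith

variable {E : Type*} [NormedAddCommGroup E] [NormedSpace ℝ E] [CompleteSpace E]
  [SecondCountableTopology E] [MeasurableSpace E] [BorelSpace E]

/-- Integration by parts for centered Gaussian measures on a separable Banach space. -/
theorem integral_dual_mul_of_isGaussian (μ : Measure E) [IsGaussian μ]
    (hμ : ∀ L : StrongDual ℝ E, ∫ z, L z ∂μ = 0) (L : StrongDual ℝ E) {g : E → ℝ}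
    {g' : E → E →L[ℝ] ℝ} (hg : ∀ z, HasFDerivAt g (g' z) z) (hgc : Continuous g') {C : ℝ≥0}
    (hC : ∀ z, ‖g' z‖₊ ≤ C) :
    ∫ z, L z * g z ∂μ = ∫ z, g' z (∫ y, L y • y ∂μ) ∂μ := by
  have hid : MemLp id 2 μ := IsGaussian.memLp_two_id
  have hL2 : MemLp L 2 μ := IsGaussian.memLp_dual μ L 2 (by norm_num)
  have hLz : Integrable (fun y => L y • y) μ :=
    memLp_one_iff_integrable.1 (MemLp.smul (r := 1) hid hL2)
  have hglip : LipschitzWith C g :=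
    lipschitzWith_of_nnnorm_fderiv_le (𝕜 := ℝ) (fun z => (hg z).differentiableAt)
      (fun z => by rw [(hg z).fderiv]; exact hC z)
  have hg2 : MemLp g 2 μ := memLp_two_of_lipschitzWith hid hglip
  set v := ∫ y, L y • y ∂μ with hv
  -- Since μ is centered, v represents the covariance with L; in particular L v is the variance of
  -- L.
  have hMv : ∀ M : StrongDual ℝ E, M v = ∫ y, L y * M y ∂μ := by
    intro M
    rw [hv, ← ContinuousLinearMap.integral_comp_comm M hLz]
    simp
  have hvar : Var[L; μ] = L v := by
    rw [variance_eq_sub hL2, hMv, hμ]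
    simp [sq]
  -- In the degenerate case L vanishes almost everywhere and both sides are 0.
  by_cases h0 : L v = 0
  · have hL0 : ∀ᵐ y ∂μ, L y = 0 := by
      have h1 : ∫ y, L y * L y ∂μ = 0 := by rw [← hMv, h0]
      rw [integral_eq_zero_iff_of_nonneg (fun y => mul_self_nonneg _) (hL2.integrable_mul hL2)]
        at h1
      filter_upwards [h1] with y hy using mul_self_eq_zero.1 hy
    have hv0 : v = 0 := by
      rw [hv]
      refine integral_eq_zero_of_ae ?_
      filter_upwards [hL0] with y hy
      simp [hy]
    rw [hv0]
    simp only [map_zero, integral_zero]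
    refine integral_eq_zero_of_ae ?_
    filter_upwards [hL0] with y hy
    simp [hy]
  have hpos : 0 < L v := by
    refine lt_of_le_of_ne ?_ (Ne.symm h0)
    rw [hMv]
    exact integral_nonneg fun y => mul_self_nonneg _
  set s : ℝ≥0 := (L v).toNNReal with hs
  have hsv : (s : ℝ) = L v := Real.coe_toNNReal _ hpos.le
  have hs0 : s ≠ 0 := by rw [hs]; simpa using hpos
  set w : E := (L v)⁻¹ • v with hw
  -- The splitting z = W z + L z • w satisfies W v = 0, so W and L are uncorrelated, hence
  -- independent by joint Gaussianity. The law of (W, L) is then a product, and the one-dimensional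
  -- formula applies in the second factor.
  let W : E →L[ℝ] E := ContinuousLinearMap.id ℝ E - L.smulRight w
  have hWz : ∀ z, W z + L z • w = z := fun z => by simp [W]
  have hlaw : μ.map L = gaussianReal 0 s := by
    rw [IsGaussian.map_eq_gaussianReal L, hμ, hvar]
  have hind : IndepFun W L μ := by
    refine HasGaussianLaw.indepFun_of_covariance_strongDual
      ((IsGaussian.hasGaussianLaw_id (μ := μ)).map_fun (W.prod L)) fun L₁ L₂ => ?_
    have h1 : MemLp (L₁ ∘ W) 2 μ :=
      IsGaussian.memLp_dual μ (L₁.comp W) 2 (by norm_num)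
    have h2 : MemLp (L₂ ∘ L) 2 μ :=
      IsGaussian.memLp_dual μ (L₂.comp L) 2 (by norm_num)
    rw [covariance_eq_sub h1 h2]
    have h3 : ∫ z, (L₁ ∘ W) z ∂μ = 0 := hμ (L₁.comp W)
    rw [h3, zero_mul, sub_zero]
    have h4 : ∀ z, ((L₁ ∘ W) * (L₂ ∘ L)) z = L₂ 1 * (L z * (L₁.comp W) z) := by
      intro z
      have : L₂ (L z) = L z * L₂ 1 := by
        rw [← smul_eq_mul, ← map_smul]; simp
      simp [this]; ring
    simp only [h4]
    rw [integral_const_mul, ← hMv]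
    have : W v = 0 := by
      simp only [W, hw]
      simp [smul_smul, mul_inv_cancel₀ h0]
    simp [this]
  have hpair : μ.map (fun z => (W z, L z)) = (μ.map W).prod (gaussianReal 0 s) := by
    rw [← hlaw]
    exact (indepFun_iff_map_prod_eq_prod_map_map W.continuous.aemeasurable
      L.continuous.aemeasurable).1 hind
  have hpm : AEMeasurable (fun z => (W z, L z)) μ :=
    (W.continuous.prodMk L.continuous).aemeasurable
  have : IsProbabilityMeasure (μ.map W) :=
    Measure.isProbabilityMeasure_map W.continuous.aemeasurable
  -- transfer to the product space
  have htr : ∀ G : E × ℝ → ℝ, Continuous G →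
      ∫ z, G (W z, L z) ∂μ = ∫ p, G p ∂((μ.map W).prod (gaussianReal 0 s)) := by
    intro G hG
    rw [← hpair, integral_map hpm hG.aestronglyMeasurable]
  have hti : ∀ G : E × ℝ → ℝ, Continuous G → Integrable (fun z => G (W z, L z)) μ →
      Integrable G ((μ.map W).prod (gaussianReal 0 s)) := by
    intro G hG hGi
    rw [← hpair, integrable_map_measure hG.aestronglyMeasurable hpm]
    exact hGi
  have hgcont : Continuous g := hglip.continuous
  let G₁ : E × ℝ → ℝ := fun p => p.2 * g (p.1 + p.2 • w)
  let G₂ : E × ℝ → ℝ := fun p => g' (p.1 + p.2 • w) v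
  have hG₁ : Continuous G₁ := by fun_prop
  have hG₂ : Continuous G₂ := by fun_prop
  have hgs : Continuous fun p : E × ℝ => g (p.1 + p.2 • w) := by fun_prop
  have e1 : ∀ z, G₁ (W z, L z) = L z * g z := fun z => by simp only [G₁, hWz]
  have e2 : ∀ z, G₂ (W z, L z) = g' z v := fun z => by simp only [G₂, hWz]
  have i1 := hti G₁ hG₁ (by simp only [e1]; exact hL2.integrable_mul hg2)
  have i2 := hti G₂ hG₂ (by
    simp only [e2]
    refine Integrable.of_bound (by fun_prop) (C * ‖v‖) (ae_of_all _ fun z => ?_)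
    refine ((g' z).le_opNorm v).trans ?_
    gcongr
    exact_mod_cast hC z)
  have i3 := hti _ hgs (by simp only [hWz]; exact hg2.integrable one_le_two)
  calc ∫ z, L z * g z ∂μ = ∫ z, G₁ (W z, L z) ∂μ := by simp only [e1]
    _ = ∫ a, ∫ x, G₁ (a, x) ∂gaussianReal 0 s ∂(μ.map W) := by
        rw [htr G₁ hG₁, integral_prod _ i1]
    _ = ∫ a, ∫ x, G₂ (a, x) ∂gaussianReal 0 s ∂(μ.map W) := by
        refine integral_congr_ae ?_
        filter_upwards [i1.prod_right_ae, i2.prod_right_ae, i3.prod_right_ae] with a h1 h2 h3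
        -- The direction is w = v / L v; the factor 1 / L v cancels the variance produced by the
        -- one-dimensional formula.
        have hd : ∀ x : ℝ, HasDerivAt (fun x : ℝ => g (a + x • w)) ((L v)⁻¹ * G₂ (a, x)) x := by
          intro x
          have h4 : HasDerivAt (fun x : ℝ => a + x • w) w x := by
            simpa using ((hasDerivAt_id x).smul_const w).const_add a
          refine ((hg (a + x • w)).comp_hasDerivAt x h4).congr_deriv ?_
          simp [G₂, hw]
        have h5 := integral_id_mul_gaussianReal hs0 hd h3 h1 (h2.const_mul _)
        simp only [G₁]
        rw [h5, integral_const_mul, ← mul_assoc, hsv, mul_inv_cancel₀ h0, one_mul]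
    _ = ∫ z, G₂ (W z, L z) ∂μ := by
        rw [htr G₂ hG₂, integral_prod _ i2]
    _ = ∫ z, g' z v ∂μ := by simp only [e2]

end GaussianIntegrationByParts

/-! ### Mollification -/

section Mollification

open scoped Convolution ContDiff

variable {E : Type*} [NormedAddCommGroup E] [NormedSpace ℝ E] [FiniteDimensional ℝ E]
  [MeasurableSpace E] [BorelSpace E] {μ : Measure E} [μ.IsAddHaarMeasure]
  {F : Type*} [NormedAddCommGroup F] [NormedSpace ℝ F]

/-- The Hessian of a test function need not be continuous; measurability of derivatives in general
is all that is available for mollifying it. -/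
lemma aestronglyMeasurable_fderiv {E : Type*} [NormedAddCommGroup E] [NormedSpace ℝ E]
    [FiniteDimensional ℝ E] [MeasurableSpace E] [BorelSpace E] {μ : Measure E} {F : Type*}
    [NormedAddCommGroup F] [NormedSpace ℝ F] [FiniteDimensional ℝ F] (h : E → F) :
    AEStronglyMeasurable (fderiv ℝ h) μ := by
  have : CompleteSpace F := FiniteDimensional.complete ℝ F
  borelize (E →L[ℝ] F)
  have : ProperSpace (E →L[ℝ] F) := FiniteDimensional.proper ℝ _
  exact (measurable_fderiv ℝ h).aestronglyMeasurable

variable (μ) in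
/-- The mollification `x ↦ ∫ φ(y) g(x - y) dy` of `g` by the normalized bump function `φ`. -/
def mollify (φ : ContDiffBump (0 : E)) (g : E → F) (x : E) : F :=
  ∫ y, φ.normed μ y • g (x - y) ∂μ

variable (φ : ContDiffBump (0 : E))

lemma integrable_normed_smul {g : E → F} (hg : AEStronglyMeasurable g μ) {C : ℝ}
    (hC : ∀ x, ‖g x‖ ≤ C) (x : E) : Integrable (fun y => φ.normed μ y • g (x - y)) μ := by
  refine Integrable.mono' (φ.integrable_normed.mul_const C)
    (φ.continuous_normed.aestronglyMeasurable.smul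
      (hg.comp_quasiMeasurePreserving (quasiMeasurePreserving_sub_left_of_right_invariant μ x)))
    (ae_of_all _ fun y => ?_)
  rw [norm_smul, Real.norm_of_nonneg (φ.nonneg_normed y)]
  exact mul_le_mul_of_nonneg_left (hC _) (φ.nonneg_normed y)

lemma integrable_normed_smul_of_continuous {g : E → F} (hg : Continuous g) (x : E) :
    Integrable (fun y => φ.normed μ y • g (x - y)) μ := by
  refine Continuous.integrable_of_hasCompactSupport ?_ φ.hasCompactSupport_normed.smul_right
  exact φ.continuous_normed.smul (hg.comp (continuous_const.sub continuous_id))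

/-- A mollification is an average of values of g, so it stays in every closed half-space containing
them. Applied to Hessians, this preserves the Hilbert–Schmidt bound. -/
lemma dual_mollify_le [CompleteSpace F] {g : E → F} {x : E}
    (hg : Integrable (fun y => φ.normed μ y • g (x - y)) μ)
    (T : F →L[ℝ] ℝ) {c : ℝ} (hT : ∀ y, T (g y) ≤ c) : T (mollify μ φ g x) ≤ c := by
  rw [mollify, ← ContinuousLinearMap.integral_comp_comm T hg]
  calc ∫ y, T (φ.normed μ y • g (x - y)) ∂μ ≤ ∫ y, φ.normed μ y * c ∂μ := by
        refine integral_mono (T.integrable_comp hg) (φ.integrable_normed.mul_const c) fun y => ?_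
        simp only [map_smul, smul_eq_mul]
        exact mul_le_mul_of_nonneg_left (hT _) (φ.nonneg_normed y)
    _ = c := by rw [integral_mul_const, φ.integral_normed, one_mul]

/-- Increments are controlled one direction u at a time, so that a Lipschitz bound for the Euclidean
length survives on `Fin n → ℝ`, which carries the sup norm. -/
lemma abs_mollify_add_sub_le {h : E → ℝ} (hh : Continuous h) {u : E} {c : ℝ}
    (hu : ∀ x, |h (x + u) - h x| ≤ c) (x : E) :
    |mollify μ φ h (x + u) - mollify μ φ h x| ≤ c := by
  have h1 := integrable_normed_smul_of_continuous (μ := μ) φ hh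
  rw [mollify, mollify, ← integral_sub (h1 _) (h1 _)]
  calc |∫ y, (φ.normed μ y • h (x + u - y) - φ.normed μ y • h (x - y)) ∂μ|
      ≤ ∫ y, φ.normed μ y * c ∂μ := by
        rw [← Real.norm_eq_abs]
        refine norm_integral_le_of_norm_le (φ.integrable_normed.mul_const c)
          (ae_of_all _ fun y => ?_)
        rw [← smul_sub, norm_smul, Real.norm_of_nonneg (φ.nonneg_normed y), Real.norm_eq_abs]
        have := hu (x - y)
        rw [show x - y + u = x + u - y by abel] at this
        exact mul_le_mul_of_nonneg_left this (φ.nonneg_normed y)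
    _ = c := by rw [integral_mul_const, φ.integral_normed, one_mul]

lemma hasFDerivAt_mollify [FiniteDimensional ℝ F] {h : E → F} (hh : Differentiable ℝ h) {C : ℝ}
    (hC : ∀ x, ‖fderiv ℝ h x‖ ≤ C) (x : E) :
    HasFDerivAt (mollify μ φ h) (mollify μ φ (fderiv ℝ h) x) x := by
  have hm := aestronglyMeasurable_fderiv (μ := μ) h
  refine hasFDerivAt_integral_of_dominated_of_fderiv_le (s := Set.univ)
    (F := fun x y => φ.normed μ y • h (x - y))
    (F' := fun x y => φ.normed μ y • fderiv ℝ h (x - y)) (bound := fun y => φ.normed μ y * C)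
    Filter.univ_mem
    (Eventually.of_forall fun x =>
      (integrable_normed_smul_of_continuous φ hh.continuous x).aestronglyMeasurable)
    (integrable_normed_smul_of_continuous φ hh.continuous x)
    (integrable_normed_smul φ hm hC x).aestronglyMeasurable
    (ae_of_all _ fun y x _ => ?_) (φ.integrable_normed.mul_const C)
    (ae_of_all _ fun y x _ => ?_)
  · rw [norm_smul, Real.norm_of_nonneg (φ.nonneg_normed y)]
    exact mul_le_mul_of_nonneg_left (hC _) (φ.nonneg_normed y)
  · have h1 : HasFDerivAt (fun x => h (x - y)) (fderiv ℝ h (x - y)) x := by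
      have := (hh (x - y)).hasFDerivAt.comp x ((hasFDerivAt_id x).sub_const y)
      simpa [Function.comp_def] using this
    exact h1.const_smul _

/-- The derivative falls on the bump function and the increment on h. This bounds the second
derivative of the mollification without any differentiability of h. -/
lemma lipschitzWith_fderiv_mollify {h : E → ℝ} {C : ℝ≥0} (hh : LipschitzWith C h) :
    LipschitzWith ((∫ y, ‖fderiv ℝ (φ.normed μ) y‖ ∂μ).toNNReal * C)
      (fderiv ℝ (mollify μ φ h)) := by
  set k := fderiv ℝ (φ.normed μ) with hk
  have hkc : Continuous k := (φ.contDiff_normed (n := 1)).continuous_fderiv one_ne_zero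
  have hks : HasCompactSupport k := φ.hasCompactSupport_normed.fderiv ℝ
  set L := (ContinuousLinearMap.lsmul ℝ ℝ : ℝ →L[ℝ] ℝ →L[ℝ] ℝ)
  have hd : ∀ x, fderiv ℝ (mollify μ φ h) x = ∫ y, L.precompL E (k y) (h (x - y)) ∂μ := by
    intro x
    have := HasCompactSupport.hasFDerivAt_convolution_left L (μ := μ)
      (φ.hasCompactSupport_normed (μ := μ)) (φ.contDiff_normed (n := 1))
      hh.continuous.locallyIntegrable x
    exact this.fderiv
  have hi : ∀ x, Integrable (fun y => L.precompL E (k y) (h (x - y))) μ := by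
    intro x
    refine Continuous.integrable_of_hasCompactSupport ?_ ?_
    · have : Continuous fun y => h (x - y) := hh.continuous.comp (by fun_prop)
      exact ((L.precompL E).continuous.comp hkc).clm_apply this
    · refine hks.mono' (Function.support_subset_iff'.2 fun y hy => ?_)
      have : k y = 0 := image_eq_zero_of_notMem_tsupport hy
      simp [this]
  refine LipschitzWith.of_dist_le_mul fun x x' => ?_
  rw [dist_eq_norm, dist_eq_norm, hd, hd, ← integral_sub (hi _) (hi _), NNReal.coe_mul,
    Real.coe_toNNReal _ (integral_nonneg fun _ => norm_nonneg _), mul_assoc,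
    ← integral_mul_const]
  refine norm_integral_le_of_norm_le ((hkc.norm.integrable_of_hasCompactSupport
    hks.norm).mul_const _) (ae_of_all _ fun y => ?_)
  rw [← map_sub]
  refine ContinuousLinearMap.opNorm_le_bound _ (by positivity) fun v => ?_
  rw [ContinuousLinearMap.precompL_apply]
  simp only [L, ContinuousLinearMap.lsmul_apply, smul_eq_mul, norm_mul]
  have h1 := hh.dist_le_mul (x - y) (x' - y)
  rw [dist_eq_norm, dist_eq_norm, sub_sub_sub_cancel_right] at h1
  calc ‖k y v‖ * ‖h (x - y) - h (x' - y)‖ ≤ (‖k y‖ * ‖v‖) * (C * ‖x - x'‖) := by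
        gcongr
        exact (k y).le_opNorm v
    _ = _ := by ring

/-- Lipschitz functions are uniformly approximated by smooth functions with bounded derivatives
of first and second order, preserving bounds on increments and on second derivatives. -/
theorem exists_smooth_approx {h : E → ℝ} {C : ℝ≥0} (hh : LipschitzWith C h) {ε : ℝ} (hε : 0 < ε) :
    ∃ k : E → ℝ, ContDiff ℝ 2 k ∧ (∃ C₁ : ℝ≥0, ∀ x, ‖fderiv ℝ k x‖₊ ≤ C₁) ∧
      (∃ C₂ : ℝ≥0, ∀ x, ‖fderiv ℝ (fderiv ℝ k) x‖₊ ≤ C₂) ∧ (∀ x, |k x - h x| ≤ ε) ∧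
      (∀ u c, (∀ x, |h (x + u) - h x| ≤ c) → ∀ x, |k (x + u) - k x| ≤ c) ∧
      (Differentiable ℝ h → Differentiable ℝ (fderiv ℝ h) →
        (∃ C₂ : ℝ, ∀ x, ‖fderiv ℝ (fderiv ℝ h) x‖ ≤ C₂) →
        ∀ (T : (E →L[ℝ] E →L[ℝ] ℝ) →L[ℝ] ℝ) (c : ℝ), (∀ x, T (fderiv ℝ (fderiv ℝ h) x) ≤ c) →
        ∀ x, T (fderiv ℝ (fderiv ℝ k) x) ≤ c) := by
  let μ : Measure E := Measure.addHaar
  -- Averaging over radius ε / (C + 1) changes h by at most C ε / (C + 1) ≤ ε; the + 1 covers C = 0.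
  let φ : ContDiffBump (0 : E) :=
    ⟨ε / (C + 1) / 2, ε / (C + 1), by positivity, half_lt_self (by positivity)⟩
  have hsm : ContDiff ℝ 2 (mollify μ φ h) := by
    change ContDiff ℝ 2 (φ.normed μ ⋆[ContinuousLinearMap.lsmul ℝ ℝ, μ] h)
    exact φ.hasCompactSupport_normed.contDiff_convolution_left _ φ.contDiff_normed
      hh.continuous.locallyIntegrable
  have hlip : LipschitzWith C (mollify μ φ h) := by
    refine LipschitzWith.of_dist_le_mul fun x y => ?_
    have := abs_mollify_add_sub_le (μ := μ) φ hh.continuous (u := x - y) (c := C * dist x y)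
      (fun z => by
        have := hh.dist_le_mul (z + (x - y)) z
        rwa [Real.dist_eq, dist_eq_norm (z + (x - y)), add_sub_cancel_left, ← dist_eq_norm] at this)
      y
    rwa [add_sub_cancel] at this
  refine ⟨mollify μ φ h, hsm, ⟨C, fun x => norm_fderiv_le_of_lipschitz ℝ hlip⟩,
    ⟨_, fun x => norm_fderiv_le_of_lipschitz ℝ (lipschitzWith_fderiv_mollify (μ := μ) φ hh)⟩,
    fun x => ?_, fun u c => abs_mollify_add_sub_le φ hh.continuous, ?_⟩
  · rw [← Real.dist_eq]
    refine φ.dist_normed_convolution_le hh.continuous.aestronglyMeasurable fun y hy => ?_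
    refine (hh.dist_le_mul y x).trans ?_
    have h1 : dist y x ≤ ε / (C + 1) := (Metric.mem_ball.1 hy).le
    calc (C : ℝ) * dist y x ≤ (C + 1) * (ε / (C + 1)) := by
          gcongr
          simp
      _ = ε := by field_simp
  -- For twice differentiable h both derivatives pass under the integral, so the Hessian of the
  -- mollification is an average of Hessians of h.
  · rintro h1 h2 ⟨C₂, hC₂⟩ T c hT x
    have e1 : fderiv ℝ (mollify μ φ h) = mollify μ φ (fderiv ℝ h) :=
      funext fun x => (hasFDerivAt_mollify φ h1
        (fun x => norm_fderiv_le_of_lipschitz ℝ hh) x).fderiv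
    rw [e1, (hasFDerivAt_mollify φ h2 hC₂ x).fderiv]
    refine dual_mollify_le φ (g := fderiv ℝ (fderiv ℝ h)) (integrable_normed_smul φ ?_ hC₂ x) T hT
    exact aestronglyMeasurable_fderiv (fderiv ℝ h)

end Mollification

/-! ### Integration by parts for Dirichlet structures -/

section DirichletIntegrationByParts

variable {Ω : Type*} [MeasurableSpace Ω] {P : Measure Ω} (D : DirichletStructure P)

namespace DirichletStructure

lemma form_apply (f g : D.dom) : D.form f g = ∫ ω, D.cdc f g ω ∂P := rfl

/-- If `g` is the image of `f 0` under `-L⁻¹`, tested against functions of `f`. -/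
lemma integral_mul_comp_eq {n : ℕ} (f : Fin n → D.dom) (g : D.dom) (f₀ : Lp ℝ 2 P)
    (hfg : ∀ u : D.dom, D.form g u = inner ℝ f₀ (u : Lp ℝ 2 P)) {φ : (Fin n → ℝ) → ℝ}
    (hφ : ContDiff ℝ 1 φ) {C : ℝ≥0} (hC : ∀ x, ‖fderiv ℝ φ x‖₊ ≤ C) :
    ∫ ω, f₀ ω * φ (fun i => (f i : Lp ℝ 2 P) ω) ∂P
      = ∫ ω, ∑ j, fderiv ℝ φ (fun i => (f i : Lp ℝ 2 P) ω) (Pi.single j 1)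
          * D.cdc (f j) g ω ∂P := by
  have hlip : LipschitzWith C φ :=
    lipschitzWith_of_nnnorm_fderiv_le (𝕜 := ℝ) (hφ.differentiable one_ne_zero) hC
  -- Taking ψ to be the coordinate on ℝ¹ leaves g unchanged, so the diffusion property becomes a
  -- chain rule in the other slot only.
  let ev0 : (Fin 1 → ℝ) →L[ℝ] ℝ := ContinuousLinearMap.proj 0
  obtain ⟨u, v, hu, hv, huv⟩ := D.diffusion n 1 φ ev0 hφ ⟨C, hlip⟩ ev0.contDiff
    ⟨_, ev0.lipschitz⟩ f (fun _ => g)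
  have hvg : v = g := Subtype.ext (Lp.ext hv)
  subst hvg
  have h1 := hfg u
  rw [form_apply, D.cdc_symm, L2.inner_def, integral_congr_ae huv] at h1
  refine Eq.trans ?_ (h1.symm.trans ?_)
  · refine integral_congr_ae ?_
    filter_upwards [hu] with ω hω
    rw [← hω]
    simp [mul_comm]
  · refine integral_congr_ae (ae_of_all _ fun ω => ?_)
    have : ev0 (Pi.single 0 1) = 1 := by simp [ev0]
    simp [this]

/-- The random vector with components `f i`. -/
def vec {n : ℕ} (f : Fin n → D.dom) (ω : Ω) : Fin n → ℝ := fun i => (f i : Lp ℝ 2 P) ω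

lemma measurable_vec {n : ℕ} (f : Fin n → D.dom) : Measurable (D.vec f) :=
  measurable_pi_iff.2 fun i => (Lp.stronglyMeasurable (f i : Lp ℝ 2 P)).measurable

end DirichletStructure

end DirichletIntegrationByParts

/-! ### Interpolation between a functional and a Gaussian vector -/

section Interpolation

variable {Ω : Type*} [MeasurableSpace Ω] {P : Measure Ω} [IsProbabilityMeasure P] {n : ℕ}

/-- The rotation `cos θ X + sin θ z`. -/
def rotatePair (X : Ω → Fin n → ℝ) (θ : ℝ) (p : Ω × (Fin n → ℝ)) : Fin n → ℝ :=
  Real.cos θ • X p.1 + Real.sin θ • p.2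

lemma measurable_rotatePair {X : Ω → Fin n → ℝ} (hX : Measurable X) (θ : ℝ) :
    Measurable (rotatePair X θ) := by
  unfold rotatePair
  fun_prop

lemma aestronglyMeasurable_comp_rotatePair {Ω : Type*} [MeasurableSpace Ω] {P : Measure Ω} {n : ℕ}
    {μ : Measure (Fin n → ℝ)} {X : Ω → Fin n → ℝ} (hX : Measurable X) (θ : ℝ)
    {φ : (Fin n → ℝ) → ℝ} (hφ : Continuous φ) :
    AEStronglyMeasurable (fun p => φ (rotatePair X θ p)) (P.prod μ) :=
  (hφ.measurable.comp (measurable_rotatePair hX θ)).aestronglyMeasurable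

lemma apply_eq_sum_single (T : (Fin n → ℝ) →L[ℝ] ℝ) (x : Fin n → ℝ) :
    T x = ∑ i, x i * T (Pi.single i 1) := by
  conv_lhs => rw [pi_eq_sum_univ' x]
  simp only [map_sum, map_smul, smul_eq_mul]

variable {μ : Measure (Fin n → ℝ)} [IsGaussian μ]

/-- Since |cos θ| and |sin θ| are at most 1, the θ-derivative is dominated by C (‖X‖ + ‖z‖),
uniformly in θ. -/
lemma hasDerivAt_integral_rotatePair {X : Ω → Fin n → ℝ} (hX : Measurable X)
    (hXi : Integrable X P) {h : (Fin n → ℝ) → ℝ} (hh : ContDiff ℝ 1 h) {C : ℝ≥0}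
    (hC : ∀ x, ‖fderiv ℝ h x‖₊ ≤ C) (θ : ℝ) :
    HasDerivAt (fun θ => ∫ p, h (rotatePair X θ p) ∂(P.prod μ))
      (∫ p, fderiv ℝ h (rotatePair X θ p) (Real.cos θ • p.2 - Real.sin θ • X p.1)
        ∂(P.prod μ)) θ := by
  have hlip : LipschitzWith C h :=
    lipschitzWith_of_nnnorm_fderiv_le (𝕜 := ℝ) (hh.differentiable one_ne_zero) hC
  have hfc : Continuous (fderiv ℝ h) := hh.continuous_fderiv one_ne_zero
  have i1 : Integrable (fun p : Ω × (Fin n → ℝ) => X p.1) (P.prod μ) := hXi.comp_fst μ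
  have i2 : Integrable (fun p : Ω × (Fin n → ℝ) => p.2) (P.prod μ) :=
    IsGaussian.integrable_id.comp_snd P
  have hm : ∀ θ, AEStronglyMeasurable (fun p => h (rotatePair X θ p)) (P.prod μ) := fun θ =>
    (hlip.continuous.measurable.comp (measurable_rotatePair hX θ)).aestronglyMeasurable
  have hdm : Measurable fun p : Ω × (Fin n → ℝ) =>
      Real.cos θ • p.2 - Real.sin θ • X p.1 := by fun_prop
  have hrot : ∀ p θ, HasDerivAt (fun θ => rotatePair X θ p)
      (Real.cos θ • p.2 - Real.sin θ • X p.1) θ := fun p θ => by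
    have := ((Real.hasDerivAt_cos θ).smul_const (X p.1)).add
      ((Real.hasDerivAt_sin θ).smul_const p.2)
    refine this.congr_deriv ?_
    rw [neg_smul, neg_add_eq_sub]
  have hbound : ∀ (p : Ω × (Fin n → ℝ)) θ,
      ‖fderiv ℝ h (rotatePair X θ p) (Real.cos θ • p.2 - Real.sin θ • X p.1)‖
        ≤ C * (‖X p.1‖ + ‖p.2‖) := fun p θ => by
    refine ((fderiv ℝ h _).le_opNorm _).trans ?_
    gcongr
    · exact_mod_cast hC _
    · refine (norm_sub_le _ _).trans ?_
      rw [norm_smul, norm_smul, Real.norm_eq_abs, Real.norm_eq_abs]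
      nlinarith [Real.abs_cos_le_one θ, Real.abs_sin_le_one θ, norm_nonneg p.2,
        norm_nonneg (X p.1)]
  have hint : Integrable (fun p => h (rotatePair X θ p)) (P.prod μ) := by
    refine Integrable.mono' (((i1.norm.add i2.norm).const_mul (C : ℝ)).add
      (integrable_const |h 0|)) (hm θ) (ae_of_all _ fun p => ?_)
    have h1 := hlip.dist_le_mul (rotatePair X θ p) 0
    rw [dist_eq_norm, dist_zero_right] at h1
    have h2 : ‖rotatePair X θ p‖ ≤ ‖X p.1‖ + ‖p.2‖ := by
      refine (norm_add_le _ _).trans ?_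
      rw [norm_smul, norm_smul, Real.norm_eq_abs, Real.norm_eq_abs]
      nlinarith [Real.abs_cos_le_one θ, Real.abs_sin_le_one θ, norm_nonneg p.2,
        norm_nonneg (X p.1)]
    have h3 := norm_le_norm_add_norm_sub' (h (rotatePair X θ p)) (h 0)
    have h4 := mul_le_mul_of_nonneg_left h2 C.coe_nonneg
    simp only [Pi.add_apply]
    rw [Real.norm_eq_abs (h 0)] at h3
    change _ ≤ (C : ℝ) * (_ + _) + _
    exact h3.trans (by linarith [h1.trans h4])
  refine (hasDerivAt_integral_of_dominated_loc_of_deriv_le (s := Set.univ)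
    (F := fun θ p => h (rotatePair X θ p))
    (F' := fun θ p => fderiv ℝ h (rotatePair X θ p) (Real.cos θ • p.2 - Real.sin θ • X p.1))
    (bound := fun p => C * (‖X p.1‖ + ‖p.2‖)) Filter.univ_mem
    (Eventually.of_forall hm) hint ?_ (ae_of_all _ fun p θ _ => hbound p θ)
    ((i1.norm.add i2.norm).const_mul (C : ℝ)) (ae_of_all _ fun p θ _ => ?_)).2
  · have hc : Continuous fun q : (Fin n → ℝ) × (Fin n → ℝ) => fderiv ℝ h q.1 q.2 := by fun_prop
    exact (hc.measurable.comp ((measurable_rotatePair hX θ).prodMk hdm)).aestronglyMeasurable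
  · exact ((hh.differentiable one_ne_zero _).hasFDerivAt).comp_hasDerivAt θ (hrot p θ)

end Interpolation

/-! ### Integration by parts along the interpolation -/

section InterpolationDerivative

variable {n : ℕ} {μ : Measure (Fin n → ℝ)} [IsGaussian μ]

/-- Gaussian integration by parts with ω frozen; sin θ is the inner derivative in z. -/
lemma integral_dual_snd_mul_rotatePair (hμ : ∀ L : StrongDual ℝ (Fin n → ℝ), ∫ z, L z ∂μ = 0)
    {Ω : Type*} (X : Ω → Fin n → ℝ) (L : StrongDual ℝ (Fin n → ℝ))
    {ψ : (Fin n → ℝ) → ℝ} (hψ : ContDiff ℝ 1 ψ) {C : ℝ≥0}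
    (hC : ∀ x, ‖fderiv ℝ ψ x‖₊ ≤ C) (θ : ℝ) (ω : Ω) :
    ∫ z, L z * ψ (rotatePair X θ (ω, z)) ∂μ
      = ∫ z, Real.sin θ * fderiv ℝ ψ (rotatePair X θ (ω, z)) (∫ y, L y • y ∂μ) ∂μ := by
  have hd : ∀ z, HasFDerivAt (fun z => ψ (rotatePair X θ (ω, z)))
      (Real.sin θ • fderiv ℝ ψ (rotatePair X θ (ω, z))) z := fun z => by
    have h1 : HasFDerivAt (fun z => rotatePair X θ (ω, z))
        (Real.sin θ • ContinuousLinearMap.id ℝ (Fin n → ℝ)) z :=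
      ((hasFDerivAt_id z).const_smul (Real.sin θ)).const_add (Real.cos θ • X ω)
    refine (((hψ.differentiable one_ne_zero _).hasFDerivAt).comp z h1).congr_fderiv ?_
    ext v
    simp
  have hc : Continuous fun z => Real.sin θ • fderiv ℝ ψ (rotatePair X θ (ω, z)) := by
    have := hψ.continuous_fderiv one_ne_zero
    unfold rotatePair
    fun_prop
  have := integral_dual_mul_of_isGaussian μ hμ L hd hc (C := C) (fun z => by
    rw [nnnorm_smul]
    calc ‖Real.sin θ‖₊ * ‖fderiv ℝ ψ (rotatePair X θ (ω, z))‖₊ ≤ 1 * C := by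
          gcongr
          · exact Real.abs_sin_le_one θ
          · exact hC _
      _ = C := one_mul C)
  simpa using this

lemma norm_apply_single_le {F : Type*} [NormedAddCommGroup F] [NormedSpace ℝ F]
    (T : (Fin n → ℝ) →L[ℝ] F) (i : Fin n) : ‖T (Pi.single i 1)‖ ≤ ‖T‖ := by
  refine (T.le_opNorm _).trans ?_
  rw [Pi.norm_single, norm_one, mul_one]

lemma norm_hessian_single_le {h : (Fin n → ℝ) → ℝ} {C₂ : ℝ≥0}
    (hC₂ : ∀ x, ‖fderiv ℝ (fderiv ℝ h) x‖₊ ≤ C₂) (x : Fin n → ℝ) (i j : Fin n) :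
    ‖fderiv ℝ (fderiv ℝ h) x (Pi.single i 1) (Pi.single j 1)‖ ≤ C₂ :=
  (norm_apply_single_le _ j).trans ((norm_apply_single_le _ i).trans (by exact_mod_cast hC₂ x))

lemma fderiv_fderiv_single {h : (Fin n → ℝ) → ℝ} (hh : ContDiff ℝ 2 h) (i : Fin n)
    (x v : Fin n → ℝ) : fderiv ℝ (fun x => fderiv ℝ h x (Pi.single i 1)) x v
      = fderiv ℝ (fderiv ℝ h) x v (Pi.single i 1) := by
  have hfd : ContDiff ℝ 1 (fderiv ℝ h) := hh.fderiv_right (by norm_num)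
  have h1 := (hfd.differentiable one_ne_zero x).hasFDerivAt.clm_apply
    (hasFDerivAt_const (Pi.single i (1 : ℝ) : Fin n → ℝ) x)
  rw [h1.fderiv]
  simp

lemma nnnorm_fderiv_fderiv_single_le {h : (Fin n → ℝ) → ℝ} (hh : ContDiff ℝ 2 h) {C₂ : ℝ≥0}
    (hC₂ : ∀ x, ‖fderiv ℝ (fderiv ℝ h) x‖₊ ≤ C₂) (i : Fin n) (x : Fin n → ℝ) :
    ‖fderiv ℝ (fun x => fderiv ℝ h x (Pi.single i 1)) x‖₊ ≤ C₂ := by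
  refine ContinuousLinearMap.opNNNorm_le_bound _ _ fun v => ?_
  rw [fderiv_fderiv_single hh]
  calc ‖fderiv ℝ (fderiv ℝ h) x v (Pi.single i 1)‖₊ ≤ ‖fderiv ℝ (fderiv ℝ h) x v‖₊ :=
        norm_apply_single_le _ i
    _ ≤ C₂ * ‖v‖₊ := by
        refine ((fderiv ℝ (fderiv ℝ h) x).le_opNNNorm v).trans ?_
        gcongr
        exact hC₂ x

namespace DirichletStructure

variable {Ω : Type*} [MeasurableSpace Ω] {P : Measure Ω} (D : DirichletStructure P)

lemma integrable_vec [IsProbabilityMeasure P] (f : Fin n → D.dom) : Integrable (D.vec f) P :=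
  Integrable.of_eval fun i => (Lp.memLp (f i : Lp ℝ 2 P)).integrable one_le_two

/-- The counterpart for the functional, with z frozen; cos θ is the inner derivative. -/
lemma integral_mul_rotatePair (f : Fin n → D.dom) (g : D.dom) (f₀ : Lp ℝ 2 P)
    (hfg : ∀ u : D.dom, D.form g u = inner ℝ f₀ (u : Lp ℝ 2 P))
    {ψ : (Fin n → ℝ) → ℝ} (hψ : ContDiff ℝ 1 ψ) {C : ℝ≥0}
    (hC : ∀ x, ‖fderiv ℝ ψ x‖₊ ≤ C) (θ : ℝ) (z : Fin n → ℝ) :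
    ∫ ω, f₀ ω * ψ (rotatePair (D.vec f) θ (ω, z)) ∂P
      = ∫ ω, Real.cos θ * ∑ j, fderiv ℝ ψ (rotatePair (D.vec f) θ (ω, z)) (Pi.single j 1)
          * D.cdc (f j) g ω ∂P := by
  let φ : (Fin n → ℝ) → ℝ := fun x => ψ (Real.cos θ • x + Real.sin θ • z)
  have hd : ∀ x, fderiv ℝ φ x = Real.cos θ • fderiv ℝ ψ (Real.cos θ • x + Real.sin θ • z) :=
    fun x => by
    have h1 : HasFDerivAt (fun x => Real.cos θ • x + Real.sin θ • z)
        (Real.cos θ • ContinuousLinearMap.id ℝ (Fin n → ℝ)) x :=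
      ((hasFDerivAt_id x).const_smul (Real.cos θ)).add_const _
    have h2 := ((hψ.differentiable one_ne_zero _).hasFDerivAt).comp x h1
    refine h2.fderiv.trans ?_
    ext v
    simp
  have := D.integral_mul_comp_eq f g f₀ hfg (φ := φ) (by fun_prop) (C := C) (fun x => by
    rw [hd, nnnorm_smul]
    calc ‖Real.cos θ‖₊ * ‖fderiv ℝ ψ (Real.cos θ • x + Real.sin θ • z)‖₊ ≤ 1 * C := by
          gcongr
          · exact Real.abs_cos_le_one θ
          · exact hC _
      _ = C := one_mul C)
  refine this.trans (integral_congr_ae (ae_of_all _ fun ω => ?_))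
  simp only [hd, Finset.mul_sum]
  refine Finset.sum_congr rfl fun j _ => ?_
  exact mul_assoc _ _ _

/-- The derivative of the interpolation between the law of `f` and a centered Gaussian law, for
`g = -L⁻¹ f`. -/
theorem hasDerivAt_interpolation [IsProbabilityMeasure P] (f g : Fin n → D.dom)
    (hfg : ∀ i (u : D.dom), D.form (g i) u = inner ℝ (f i : Lp ℝ 2 P) (u : Lp ℝ 2 P))
    (hμ : ∀ L : StrongDual ℝ (Fin n → ℝ), ∫ z, L z ∂μ = 0)
    {h : (Fin n → ℝ) → ℝ} (hh : ContDiff ℝ 2 h) {C₁ C₂ : ℝ≥0}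
    (hC₁ : ∀ x, ‖fderiv ℝ h x‖₊ ≤ C₁) (hC₂ : ∀ x, ‖fderiv ℝ (fderiv ℝ h) x‖₊ ≤ C₂) (θ : ℝ) :
    HasDerivAt (fun θ => ∫ p, h (rotatePair (D.vec f) θ p) ∂(P.prod μ))
      (Real.sin θ * Real.cos θ * ∫ p, ∑ i, ∑ j,
        fderiv ℝ (fderiv ℝ h) (rotatePair (D.vec f) θ p) (Pi.single j 1) (Pi.single i 1) *
          ((∫ z, z i * z j ∂μ) - D.cdc (f j) (g i) p.1) ∂(P.prod μ)) θ := by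
  refine (hasDerivAt_integral_rotatePair (D.measurable_vec f) (D.integrable_vec f)
    (hh.of_le one_le_two) hC₁ θ).congr_deriv ?_
  set X := D.vec f with hXdef
  have hX : Measurable X := D.measurable_vec f
  have hfd : ContDiff ℝ 1 (fderiv ℝ h) := hh.fderiv_right (by norm_num)
  let ψ : Fin n → (Fin n → ℝ) → ℝ := fun i x => fderiv ℝ h x (Pi.single i 1)
  have hψ : ∀ i, ContDiff ℝ 1 (ψ i) := fun i => hfd.clm_apply contDiff_const
  have hψd : ∀ i x v, fderiv ℝ (ψ i) x v = fderiv ℝ (fderiv ℝ h) x v (Pi.single i 1) :=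
    fun i x v => fderiv_fderiv_single hh i x v
  have hψC : ∀ i x, ‖fderiv ℝ (ψ i) x‖₊ ≤ C₂ := fun i x =>
    nnnorm_fderiv_fderiv_single_le hh hC₂ i x
  let H : Fin n → Fin n → Ω × (Fin n → ℝ) → ℝ := fun i j p =>
    fderiv ℝ (fderiv ℝ h) (rotatePair X θ p) (Pi.single j 1) (Pi.single i 1)
  have hHψ : ∀ i j p, fderiv ℝ (ψ i) (rotatePair X θ p) (Pi.single j 1) = H i j p :=
    fun i j p => hψd i _ _
  have hHm : ∀ i j, AEStronglyMeasurable (H i j) (P.prod μ) := fun i j => by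
    rw [show H i j = fun p => fderiv ℝ (ψ i) (rotatePair X θ p) (Pi.single j 1) from
      funext fun p => (hHψ i j p).symm]
    exact aestronglyMeasurable_comp_rotatePair hX θ
      (((hψ i).continuous_fderiv one_ne_zero).clm_apply continuous_const)
  have hHb : ∀ i j p, ‖H i j p‖ ≤ C₂ := fun i j p => by
    exact norm_hessian_single_le hC₂ _ j i
  have hΓ : ∀ i j, Integrable (fun p : Ω × (Fin n → ℝ) => D.cdc (f j) (g i) p.1) (P.prod μ) :=
    fun i j => (L1.integrable_coeFn _).comp_fst μ
  have hHΓ : ∀ i j, Integrable (fun p => H i j p * D.cdc (f j) (g i) p.1) (P.prod μ) :=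
    fun i j => (hΓ i j).bdd_mul (hHm i j) (ae_of_all _ (hHb i j))
  have hHS : ∀ i j, Integrable (fun p => H i j p * ∫ z, z i * z j ∂μ) (P.prod μ) :=
    fun i j => (Integrable.of_bound (hHm i j) _ (ae_of_all _ (hHb i j))).mul_const _
  have hψm : ∀ i, AEStronglyMeasurable (fun p => ψ i (rotatePair X θ p)) (P.prod μ) := fun i =>
    aestronglyMeasurable_comp_rotatePair hX θ (hψ i).continuous
  have hψb : ∀ i p, ‖ψ i (rotatePair X θ p)‖ ≤ C₁ := fun i p =>
    (norm_apply_single_le _ i).trans (by exact_mod_cast hC₁ _)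
  have i1 : ∀ i, Integrable (fun p : Ω × (Fin n → ℝ) => X p.1 i * ψ i (rotatePair X θ p))
      (P.prod μ) := fun i =>
    (((D.integrable_vec f).eval i).comp_fst μ).mul_bdd (hψm i) (ae_of_all _ (hψb i))
  have i2 : ∀ i, Integrable (fun p : Ω × (Fin n → ℝ) => p.2 i * ψ i (rotatePair X θ p))
      (P.prod μ) := fun i =>
    (((IsGaussian.integrable_id (μ := μ)).eval i).comp_snd P).mul_bdd (hψm i)
      (ae_of_all _ (hψb i))
  have i3 : ∀ i, Integrable (fun p : Ω × (Fin n → ℝ) => Real.cos θ *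
      (p.2 i * ψ i (rotatePair X θ p)) - Real.sin θ * (X p.1 i * ψ i (rotatePair X θ p)))
      (P.prod μ) := fun i => ((i2 i).const_mul _).sub ((i1 i).const_mul _)
  have hHD : ∀ i j, Integrable (fun p =>
      H i j p * ((∫ z, z i * z j ∂μ) - D.cdc (f j) (g i) p.1)) (P.prod μ) := fun i j =>
    ((hHS i j).sub (hHΓ i j)).congr (ae_of_all _ fun p => (mul_sub _ _ _).symm)
  -- integration by parts with respect to the functional
  have e1 : ∀ i, ∫ p, X p.1 i * ψ i (rotatePair X θ p) ∂(P.prod μ)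
      = Real.cos θ * ∫ p, ∑ j, H i j p * D.cdc (f j) (g i) p.1 ∂(P.prod μ) := fun i => by
    rw [← integral_const_mul, integral_prod_symm _ (i1 i), integral_prod_symm _
      ((integrable_finsetSum _ fun j _ => hHΓ i j).const_mul _)]
    refine integral_congr_ae (ae_of_all _ fun z => ?_)
    have := D.integral_mul_rotatePair f (g i) (f i) (hfg i) (hψ i) (hψC i) θ z
    simp only [← hHψ]
    exact this
  -- integration by parts with respect to the Gaussian vector
  have e2 : ∀ i, ∫ p : Ω × (Fin n → ℝ), p.2 i * ψ i (rotatePair X θ p) ∂(P.prod μ)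
      = Real.sin θ * ∫ p, ∑ j, H i j p * ∫ z, z i * z j ∂μ ∂(P.prod μ) := fun i => by
    rw [← integral_const_mul, integral_prod _ (i2 i), integral_prod _
      ((integrable_finsetSum _ fun j _ => hHS i j).const_mul _)]
    refine integral_congr_ae (ae_of_all _ fun ω => ?_)
    have := integral_dual_snd_mul_rotatePair hμ X (ContinuousLinearMap.proj i) (hψ i)
      (hψC i) θ ω
    refine this.trans (integral_congr_ae (ae_of_all _ fun z => ?_))
    simp only [← hHψ]
    rw [apply_eq_sum_single]
    congr 1
    refine Finset.sum_congr rfl fun j _ => ?_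
    rw [mul_comm]
    congr 1
    have hint : Integrable (fun y : Fin n → ℝ => y i • y) μ :=
      memLp_one_iff_integrable.1 (MemLp.smul (r := 1) (IsGaussian.memLp_two_id (μ := μ))
        (IsGaussian.memLp_dual μ (ContinuousLinearMap.proj i) 2 (by norm_num)))
    have := ContinuousLinearMap.integral_comp_comm
      (ContinuousLinearMap.proj j : (Fin n → ℝ) →L[ℝ] ℝ) hint
    refine Eq.trans ?_ (this.symm.trans ?_)
    · rfl
    · rfl
  calc ∫ p, fderiv ℝ h (rotatePair X θ p) (Real.cos θ • p.2 - Real.sin θ • X p.1) ∂(P.prod μ)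
      = ∫ p, ∑ i, (Real.cos θ * (p.2 i * ψ i (rotatePair X θ p))
          - Real.sin θ * (X p.1 i * ψ i (rotatePair X θ p))) ∂(P.prod μ) := by
        refine integral_congr_ae (ae_of_all _ fun p => ?_)
        simp only
        rw [apply_eq_sum_single]
        refine Finset.sum_congr rfl fun i _ => ?_
        simp only [Pi.sub_apply, Pi.smul_apply, smul_eq_mul, ψ]
        ring
    -- Each integration by parts supplies the trigonometric factor that the other term already
    -- carries, so sin θ cos θ is common to both.
    _ = ∑ i, (Real.cos θ * (Real.sin θ * ∫ p, ∑ j, H i j p * ∫ z, z i * z j ∂μ ∂(P.prod μ))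
          - Real.sin θ * (Real.cos θ *
            ∫ p, ∑ j, H i j p * D.cdc (f j) (g i) p.1 ∂(P.prod μ))) := by
        rw [integral_finsetSum _ fun i _ => i3 i]
        refine Finset.sum_congr rfl fun i _ => ?_
        rw [integral_sub ((i2 i).const_mul _) ((i1 i).const_mul _), integral_const_mul,
          integral_const_mul, e1, e2]
    _ = _ := by
        rw [integral_finsetSum _ fun i _ => integrable_finsetSum _ fun j _ => hHD i j,
          Finset.mul_sum]
        refine Finset.sum_congr rfl fun i _ => ?_
        have : ∫ p, ∑ j, H i j p * ((∫ z, z i * z j ∂μ) - D.cdc (f j) (g i) p.1) ∂(P.prod μ)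
            = ∫ p, ∑ j, H i j p * ∫ z, z i * z j ∂μ ∂(P.prod μ)
              - ∫ p, ∑ j, H i j p * D.cdc (f j) (g i) p.1 ∂(P.prod μ) := by
          rw [← integral_sub (integrable_finsetSum _ fun j _ => hHS i j)
            (integrable_finsetSum _ fun j _ => hHΓ i j)]
          simp only [mul_sub, Finset.sum_sub_distrib]
        rw [this]
        ring

end DirichletStructure

end InterpolationDerivative

/-! ### Frobenius norms and bounds on the interpolation derivative -/

section InterpolationBounds

lemma abs_integral_le_of_abs_le {α : Type*} [MeasurableSpace α] {ν : Measure α} {f g : α → ℝ}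
    (hg : Integrable g ν) (h : ∀ x, |f x| ≤ g x) : |∫ x, f x ∂ν| ≤ ∫ x, g x ∂ν :=
  (Real.norm_eq_abs _).symm.trans_le (norm_integral_le_of_norm_le hg (ae_of_all _ h))

/-- Jensen's inequality for the square root, read off from the nonnegative variance of √q. -/
lemma integral_sqrt_le {α : Type*} [MeasurableSpace α] {ν : Measure α} [IsProbabilityMeasure ν]
    {q : α → ℝ} (hq : ∀ x, 0 ≤ q x) (hqi : Integrable q ν) :
    ∫ x, √(q x) ∂ν ≤ √(∫ x, q x ∂ν) := by
  have hm : MemLp (fun x => √(q x)) 2 ν := by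
    rw [memLp_two_iff_integrable_sq (Real.continuous_sqrt.comp_aestronglyMeasurable hqi.1)]
    simpa only [Real.sq_sqrt (hq _)] using hqi
  refine Real.le_sqrt_of_sq_le ?_
  have h1 := variance_nonneg (fun x => √(q x)) ν
  rw [variance_eq_sub hm] at h1
  simp only [Pi.pow_apply, Real.sq_sqrt (hq _)] at h1
  linarith

variable {Ω : Type*} [MeasurableSpace Ω] {P : Measure Ω} {n : ℕ} {μ : Measure (Fin n → ℝ)}

/-- The Frobenius norm of a matrix. -/
def frob (A : Fin n → Fin n → ℝ) : ℝ := √(∑ i, ∑ j, A i j ^ 2)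

lemma frob_nonneg (A : Fin n → Fin n → ℝ) : 0 ≤ frob A := Real.sqrt_nonneg _

lemma frob_neg (A : Fin n → Fin n → ℝ) : frob (-A) = frob A := by simp [frob]

/-- A crude bound, serving only to make the Frobenius norm of a matrix with integrable entries
integrable. -/
lemma frob_le (A : Fin n → Fin n → ℝ) : frob A ≤ ∑ i, ∑ j, |A i j| := by
  rw [frob, Real.sqrt_le_left (Finset.sum_nonneg fun i _ => Finset.sum_nonneg fun j _ =>
    abs_nonneg _)]
  simp only [← sq_abs (A _ _)]
  calc ∑ i, ∑ j, |A i j| ^ 2 ≤ ∑ i, (∑ j, |A i j|) ^ 2 :=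
        Finset.sum_le_sum fun i _ => Finset.sum_sq_le_sq_sum_of_nonneg fun j _ => abs_nonneg _
    _ ≤ _ := Finset.sum_sq_le_sq_sum_of_nonneg fun i _ => Finset.sum_nonneg fun j _ =>
        abs_nonneg _

lemma continuous_frob : Continuous (frob : (Fin n → Fin n → ℝ) → ℝ) := by
  unfold frob
  fun_prop

/-- Integration by parts trades one derivative of the test function for a factor `(sin θ)⁻¹`. -/
lemma abs_sin_mul_integral_hessian_le [IsGaussian μ] {Ω : Type*} (X : Ω → Fin n → ℝ)
    (hμ : ∀ L : StrongDual ℝ (Fin n → ℝ), ∫ z, L z ∂μ = 0)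
    (l : Fin n → StrongDual ℝ (Fin n → ℝ)) (hl : ∀ i, ∫ z, l i z • z ∂μ = Pi.single i 1)
    {κ : ℝ} (hκ : ∀ a : Fin n → ℝ, ∫ z, (∑ i, a i * l i z) ^ 2 ∂μ ≤ κ * ∑ i, a i ^ 2)
    {h : (Fin n → ℝ) → ℝ} (hh : ContDiff ℝ 2 h) {C₁ C₂ : ℝ≥0}
    (hC₁ : ∀ x, ‖fderiv ℝ h x‖₊ ≤ C₁) (hC₂ : ∀ x, ‖fderiv ℝ (fderiv ℝ h) x‖₊ ≤ C₂)
    (hG : ∀ x u, fderiv ℝ h x u ≤ √(∑ i, u i ^ 2)) (θ : ℝ) (ω : Ω) (A : Fin n → Fin n → ℝ) :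
    |Real.sin θ * ∫ z, ∑ i, ∑ j, A i j *
      fderiv ℝ (fderiv ℝ h) (rotatePair X θ (ω, z)) (Pi.single i 1) (Pi.single j 1) ∂μ|
        ≤ √κ * frob A := by
  have hfd : ContDiff ℝ 1 (fderiv ℝ h) := hh.fderiv_right (by norm_num)
  have habs : ∀ x u, |fderiv ℝ h x u| ≤ √(∑ i, u i ^ 2) := fun x u => by
    refine abs_le'.2 ⟨hG x u, ?_⟩
    have := hG x (-u)
    simpa using this
  let ψ : Fin n → (Fin n → ℝ) → ℝ := fun i x => fderiv ℝ h x (Pi.single i 1)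
  have hψ : ∀ i, ContDiff ℝ 1 (ψ i) := fun i => hfd.clm_apply contDiff_const
  have hψd : ∀ i x v, fderiv ℝ (ψ i) x v = fderiv ℝ (fderiv ℝ h) x v (Pi.single i 1) :=
    fun i x v => fderiv_fderiv_single hh i x v
  have hψC : ∀ i x, ‖fderiv ℝ (ψ i) x‖₊ ≤ C₂ := fun i x =>
    nnnorm_fderiv_fderiv_single_le hh hC₂ i x
  have hl2 : ∀ i, MemLp (l i) 2 μ := fun i => IsGaussian.memLp_dual μ (l i) 2 (by norm_num)
  have hψi : ∀ i j, Integrable (fun z => l i z * ψ j (rotatePair X θ (ω, z))) μ := fun i j => by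
    have hc : Continuous fun z => ψ j (rotatePair X θ (ω, z)) := by
      have := (hψ j).continuous
      unfold rotatePair
      fun_prop
    exact ((hl2 i).integrable one_le_two).mul_bdd (c := C₁) hc.aestronglyMeasurable
      (ae_of_all _ fun z => (norm_apply_single_le _ j).trans (by exact_mod_cast hC₁ _))
  have hHi : ∀ i j, Integrable (fun z => fderiv ℝ (fderiv ℝ h) (rotatePair X θ (ω, z))
      (Pi.single i 1) (Pi.single j 1)) μ := fun i j => by
    have hc : Continuous fun z => fderiv ℝ (fderiv ℝ h) (rotatePair X θ (ω, z))
        (Pi.single i 1) (Pi.single j 1) := by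
      have := hfd.continuous_fderiv one_ne_zero
      unfold rotatePair
      fun_prop
    exact Integrable.of_bound hc.aestronglyMeasurable C₂ (ae_of_all _ fun z =>
      norm_hessian_single_le hC₂ _ i j)
  -- By `hl`, integrating `l i` against ∂ⱼh yields sin θ ∂ᵢ∂ⱼh. Collecting these weights with the
  -- coefficients of A turns sin θ ⟨A, Hess h⟩ into ∇h · w.
  let w : (Fin n → ℝ) → Fin n → ℝ := fun z j => ∑ i, A i j * l i z
  have e1 : Real.sin θ * ∫ z, ∑ i, ∑ j, A i j *
      fderiv ℝ (fderiv ℝ h) (rotatePair X θ (ω, z)) (Pi.single i 1) (Pi.single j 1) ∂μ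
      = ∫ z, fderiv ℝ h (rotatePair X θ (ω, z)) (w z) ∂μ := by
    have e2 : ∀ z, fderiv ℝ h (rotatePair X θ (ω, z)) (w z)
        = ∑ i, ∑ j, A i j * (l i z * ψ j (rotatePair X θ (ω, z))) := fun z => by
      rw [apply_eq_sum_single, Finset.sum_comm]
      refine Finset.sum_congr rfl fun j _ => ?_
      simp only [w, Finset.sum_mul]
      exact Finset.sum_congr rfl fun i _ => by ring
    simp only [e2]
    rw [integral_finsetSum _ fun i _ => integrable_finsetSum _ fun j _ =>
        (hψi i j).const_mul _, integral_finsetSum _ fun i _ => integrable_finsetSum _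
        fun j _ => (hHi i j).const_mul _, Finset.mul_sum]
    refine Finset.sum_congr rfl fun i _ => ?_
    rw [integral_finsetSum _ fun j _ => (hψi i j).const_mul _, integral_finsetSum _
        fun j _ => (hHi i j).const_mul _, Finset.mul_sum]
    refine Finset.sum_congr rfl fun j _ => ?_
    rw [integral_const_mul, integral_const_mul,
      integral_dual_snd_mul_rotatePair hμ X (l i) (hψ j) (hψC j) θ ω, hl, integral_const_mul]
    simp only [hψd]
    ring
  have hw2 : ∀ j, MemLp (fun z => w z j) 2 μ := fun j =>
    memLp_finsetSum _ fun i _ => (hl2 i).const_mul _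
  have hq : Integrable (fun z => ∑ j, w z j ^ 2) μ :=
    integrable_finsetSum _ fun j _ => (hw2 j).integrable_sq
  have hsqrt : Integrable (fun z => √(∑ j, w z j ^ 2)) μ := by
    refine MemLp.integrable (q := 2) one_le_two ?_
    rw [memLp_two_iff_integrable_sq (Real.continuous_sqrt.comp_aestronglyMeasurable hq.1)]
    simpa only [Real.sq_sqrt (Finset.sum_nonneg fun j _ => sq_nonneg (w _ j))] using hq
  rw [e1]
  calc |∫ z, fderiv ℝ h (rotatePair X θ (ω, z)) (w z) ∂μ|
      ≤ ∫ z, √(∑ j, w z j ^ 2) ∂μ :=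
        abs_integral_le_of_abs_le hsqrt fun z => habs _ _
    _ ≤ √(∫ z, ∑ j, w z j ^ 2 ∂μ) :=
        integral_sqrt_le (fun z => Finset.sum_nonneg fun j _ => sq_nonneg _) hq
    -- The second moment of w is bounded by applying `hκ` to each column of A.
    _ ≤ √(κ * ∑ i, ∑ j, A i j ^ 2) := by
        refine Real.sqrt_le_sqrt ?_
        rw [integral_finsetSum _ fun j _ => (hw2 j).integrable_sq, Finset.sum_comm,
          Finset.mul_sum]
        exact Finset.sum_le_sum fun j _ => hκ fun i => A i j
    _ = √κ * frob A := by
        rw [frob, Real.sqrt_mul' _ (Finset.sum_nonneg fun i _ => Finset.sum_nonneg fun j _ =>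
          sq_nonneg _)]

namespace DirichletStructure

variable (D : DirichletStructure P) (f g : Fin n → D.dom)

variable (μ) in
/-- The covariance matrix of `μ` minus the symmetrized matrix of the carré du champ of `f`
and `g`. -/
def covSubCdc (ω : Ω) (i j : Fin n) : ℝ :=
  (∫ z, z i * z j ∂μ) - 2⁻¹ * (D.cdc (f i) (g j) ω + D.cdc (f j) (g i) ω)

lemma integrable_covSubCdc [IsFiniteMeasure P] (i j : Fin n) :
    Integrable (fun ω => D.covSubCdc μ f g ω i j) P :=
  (integrable_const _).sub (((L1.integrable_coeFn _).add (L1.integrable_coeFn _)).const_mul _)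

lemma integrable_frob_covSubCdc [IsFiniteMeasure P] :
    Integrable (fun ω => frob (D.covSubCdc μ f g ω)) P := by
  have hm : AEStronglyMeasurable (D.covSubCdc μ f g) P := by
    refine AEMeasurable.aestronglyMeasurable ?_
    exact aemeasurable_pi_lambda _ fun i => aemeasurable_pi_lambda _ fun j =>
      (D.integrable_covSubCdc f g i j).aemeasurable
  refine Integrable.mono' (integrable_finsetSum Finset.univ fun i _ =>
    integrable_finsetSum Finset.univ fun j _ => (D.integrable_covSubCdc (μ := μ) f g i j).abs)
    (continuous_frob.comp_aestronglyMeasurable hm) (ae_of_all _ fun ω => ?_)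
  rw [Real.norm_of_nonneg (frob_nonneg _)]
  exact frob_le _

variable {f g}

/-- A symmetric matrix pairs only with the symmetric part of the other one; this is where the
symmetrization in the definition of Γ enters. -/
lemma sum_sum_snd_deriv_mul {H : Fin n → Fin n → ℝ} (hH : ∀ i j, H i j = H j i) (ω : Ω) :
    ∑ i, ∑ j, H j i * ((∫ z, z i * z j ∂μ) - D.cdc (f j) (g i) ω)
      = ∑ i, ∑ j, D.covSubCdc μ f g ω i j * H i j := by
  have hs : ∀ i j, ∫ z, z i * z j ∂μ = ∫ z, z j * z i ∂μ := fun i j => by simp only [mul_comm]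
  have h1 : ∑ i, ∑ j, H j i * ((∫ z, z i * z j ∂μ) - D.cdc (f j) (g i) ω)
      = ∑ i, ∑ j, H i j * ((∫ z, z i * z j ∂μ) - D.cdc (f i) (g j) ω) := by
    rw [Finset.sum_comm]
    refine Finset.sum_congr rfl fun i _ => Finset.sum_congr rfl fun j _ => ?_
    rw [hs]
  have h2 : ∑ i, ∑ j, D.covSubCdc μ f g ω i j * H i j
      = 2⁻¹ * (∑ i, ∑ j, H j i * ((∫ z, z i * z j ∂μ) - D.cdc (f j) (g i) ω))
        + 2⁻¹ * (∑ i, ∑ j, H i j * ((∫ z, z i * z j ∂μ) - D.cdc (f i) (g j) ω)) := by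
    simp only [Finset.mul_sum, ← Finset.sum_add_distrib]
    refine Finset.sum_congr rfl fun i _ => Finset.sum_congr rfl fun j _ => ?_
    rw [covSubCdc, hH j i]
    ring
  rw [h2, ← h1]
  ring

variable [IsProbabilityMeasure P] [IsGaussian μ]

/-- The derivative of the interpolation, as a function of the matrix `covSubCdc`. -/
lemma hasDerivAt_interpolation_covSubCdc
    (hfg : ∀ i (u : D.dom), D.form (g i) u = inner ℝ (f i : Lp ℝ 2 P) (u : Lp ℝ 2 P))
    (hμ : ∀ L : StrongDual ℝ (Fin n → ℝ), ∫ z, L z ∂μ = 0)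
    {h : (Fin n → ℝ) → ℝ} (hh : ContDiff ℝ 2 h) {C₁ C₂ : ℝ≥0}
    (hC₁ : ∀ x, ‖fderiv ℝ h x‖₊ ≤ C₁) (hC₂ : ∀ x, ‖fderiv ℝ (fderiv ℝ h) x‖₊ ≤ C₂) (θ : ℝ) :
    HasDerivAt (fun θ => ∫ p, h (rotatePair (D.vec f) θ p) ∂(P.prod μ))
      (Real.sin θ * Real.cos θ * ∫ p, ∑ i, ∑ j, D.covSubCdc μ f g p.1 i j *
        fderiv ℝ (fderiv ℝ h) (rotatePair (D.vec f) θ p) (Pi.single i 1) (Pi.single j 1)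
          ∂(P.prod μ)) θ := by
  refine (D.hasDerivAt_interpolation f g hfg hμ hh hC₁ hC₂ θ).congr_deriv ?_
  congr 1
  refine integral_congr_ae (ae_of_all _ fun p => ?_)
  refine D.sum_sum_snd_deriv_mul (H := fun i j => fderiv ℝ (fderiv ℝ h)
    (rotatePair (D.vec f) θ p) (Pi.single i 1) (Pi.single j 1)) (fun i j => ?_) p.1
  exact (hh.contDiffAt.isSymmSndFDerivAt (by simp)).eq _ _

/-- The path runs over [0, π/2], where sine and cosine are nonnegative. Comparing with a majorant B
by the mean value inequality avoids integrating Ψ', whose regularity in θ is then irrelevant. -/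
lemma abs_integral_sub_integral_le {h : (Fin n → ℝ) → ℝ} {C₁ : ℝ≥0} (hh : ContDiff ℝ 1 h)
    (hC₁ : ∀ x, ‖fderiv ℝ h x‖₊ ≤ C₁)
    {Ψ' : ℝ → ℝ} (hΨ : ∀ θ, HasDerivAt (fun θ => ∫ p, h (rotatePair (D.vec f) θ p) ∂(P.prod μ))
      (Ψ' θ) θ) {B B' : ℝ → ℝ} (hB0 : B 0 = 0) (hB : ∀ θ, HasDerivAt B (B' θ) θ)
    (hle : ∀ θ, 0 ≤ Real.sin θ → 0 ≤ Real.cos θ → |Ψ' θ| ≤ B' θ) :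
    |∫ ω, h (D.vec f ω) ∂P - ∫ z, h z ∂μ| ≤ B (Real.pi / 2) := by
  have hlip : LipschitzWith C₁ h :=
    lipschitzWith_of_nnnorm_fderiv_le (𝕜 := ℝ) (hh.differentiable one_ne_zero) hC₁
  set Ψ := fun θ => ∫ p, h (rotatePair (D.vec f) θ p) ∂(P.prod μ) with hΨdef
  have h0 : Ψ 0 = ∫ ω, h (D.vec f ω) ∂P := by
    have := integral_fun_fst (μ := P) (ν := μ) (fun ω => h (D.vec f ω))
    simp only [probReal_univ, one_smul] at this
    rw [← this]
    simp [hΨdef, rotatePair]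
  have h1 : Ψ (Real.pi / 2) = ∫ z, h z ∂μ := by
    have := integral_fun_snd (μ := P) (ν := μ) h
    simp only [probReal_univ, one_smul] at this
    rw [← this]
    simp [hΨdef, rotatePair]
  have := image_norm_le_of_norm_deriv_right_le_deriv_boundary (f := fun θ => Ψ θ - Ψ 0)
    (f' := Ψ') (a := 0) (b := Real.pi / 2) (B := B) (B' := B')
    (fun θ _ => ((hΨ θ).sub_const _).continuousAt.continuousWithinAt)
    (fun θ _ => ((hΨ θ).sub_const _).hasDerivWithinAt) (by simp [hB0]) hB
    (fun θ hθ => hle θ (Real.sin_nonneg_of_nonneg_of_le_pi hθ.1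
      (by linarith [hθ.2, Real.pi_pos])) (Real.cos_nonneg_of_mem_Icc
        ⟨by linarith [hθ.1, Real.pi_pos], hθ.2.le⟩))
    (Set.right_mem_Icc.2 (by positivity))
  rw [← h0, ← h1, abs_sub_comm]
  exact this

/-- Distance to a centered Gaussian law on `ℝⁿ`, for test functions with Hessian of
Hilbert–Schmidt norm at most `1`. -/
theorem abs_integral_sub_le_of_hessian
    (hfg : ∀ i (u : D.dom), D.form (g i) u = inner ℝ (f i : Lp ℝ 2 P) (u : Lp ℝ 2 P))
    (hμ : ∀ L : StrongDual ℝ (Fin n → ℝ), ∫ z, L z ∂μ = 0)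
    {h : (Fin n → ℝ) → ℝ} (hh : ContDiff ℝ 2 h) {C₁ C₂ : ℝ≥0}
    (hC₁ : ∀ x, ‖fderiv ℝ h x‖₊ ≤ C₁) (hC₂ : ∀ x, ‖fderiv ℝ (fderiv ℝ h) x‖₊ ≤ C₂)
    (hH : ∀ x (A : Fin n → Fin n → ℝ), ∑ i, ∑ j, A i j *
      fderiv ℝ (fderiv ℝ h) x (Pi.single i 1) (Pi.single j 1) ≤ frob A) :
    |∫ ω, h (D.vec f ω) ∂P - ∫ z, h z ∂μ| ≤ 2⁻¹ * ∫ ω, frob (D.covSubCdc μ f g ω) ∂P := by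
  set M := ∫ ω, frob (D.covSubCdc μ f g ω) ∂P
  have habs : ∀ x (A : Fin n → Fin n → ℝ), |∑ i, ∑ j, A i j *
      fderiv ℝ (fderiv ℝ h) x (Pi.single i 1) (Pi.single j 1)| ≤ frob A := fun x A => by
    refine abs_le'.2 ⟨hH x A, ?_⟩
    have := hH x (-A)
    rw [frob_neg] at this
    refine le_trans (le_of_eq ?_) this
    simp
  have := D.abs_integral_sub_integral_le (hh.of_le one_le_two) hC₁
    (D.hasDerivAt_interpolation_covSubCdc hfg hμ hh hC₁ hC₂)
    -- B is the primitive of sin θ cos θ M, and B(π/2) = M / 2 is the source of the factor 1/2.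
    (B := fun θ => 2⁻¹ * M * Real.sin θ ^ 2) (B' := fun θ => Real.sin θ * Real.cos θ * M)
    (by simp) (fun θ => by
      refine (((Real.hasDerivAt_sin θ).pow 2).const_mul (2⁻¹ * M)).congr_deriv ?_
      simp; ring) (fun θ hs hc => by
      rw [abs_mul, abs_of_nonneg (mul_nonneg hs hc)]
      refine mul_le_mul_of_nonneg_left ?_ (mul_nonneg hs hc)
      have hi := (D.integrable_frob_covSubCdc (μ := μ) f g).comp_fst μ
      have e : ∫ p : Ω × (Fin n → ℝ), frob (D.covSubCdc μ f g p.1) ∂(P.prod μ) = M := by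
        have := integral_fun_fst (μ := P) (ν := μ) (fun ω => frob (D.covSubCdc μ f g ω))
        simpa only [probReal_univ, one_smul] using this
      rw [← e]
      exact abs_integral_le_of_abs_le hi fun p => habs _ _)
  simpa using this

/-- Distance to a non-degenerate centered Gaussian law on `ℝⁿ`, for test functions with gradient
of Euclidean norm at most `1`. -/
theorem abs_integral_sub_le_of_gradient
    (hfg : ∀ i (u : D.dom), D.form (g i) u = inner ℝ (f i : Lp ℝ 2 P) (u : Lp ℝ 2 P))
    (hμ : ∀ L : StrongDual ℝ (Fin n → ℝ), ∫ z, L z ∂μ = 0)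
    (l : Fin n → StrongDual ℝ (Fin n → ℝ)) (hl : ∀ i, ∫ z, l i z • z ∂μ = Pi.single i 1)
    {κ : ℝ} (hκ : ∀ a : Fin n → ℝ, ∫ z, (∑ i, a i * l i z) ^ 2 ∂μ ≤ κ * ∑ i, a i ^ 2)
    {h : (Fin n → ℝ) → ℝ} (hh : ContDiff ℝ 2 h) {C₁ C₂ : ℝ≥0}
    (hC₁ : ∀ x, ‖fderiv ℝ h x‖₊ ≤ C₁) (hC₂ : ∀ x, ‖fderiv ℝ (fderiv ℝ h) x‖₊ ≤ C₂)
    (hG : ∀ x u, fderiv ℝ h x u ≤ √(∑ i, u i ^ 2)) :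
    |∫ ω, h (D.vec f ω) ∂P - ∫ z, h z ∂μ| ≤ √κ * ∫ ω, frob (D.covSubCdc μ f g ω) ∂P := by
  set M := ∫ ω, frob (D.covSubCdc μ f g ω) ∂P
  set X := D.vec f with hXdef
  have hX : Measurable X := D.measurable_vec f
  have hfd : ContDiff ℝ 1 (fderiv ℝ h) := hh.fderiv_right (by norm_num)
  have hHint : ∀ θ, Integrable (fun p : Ω × (Fin n → ℝ) => ∑ i, ∑ j, D.covSubCdc μ f g p.1 i j *
      fderiv ℝ (fderiv ℝ h) (rotatePair X θ p) (Pi.single i 1) (Pi.single j 1)) (P.prod μ) :=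
    fun θ => by
    refine integrable_finsetSum _ fun i _ => integrable_finsetSum _ fun j _ => ?_
    refine ((D.integrable_covSubCdc f g i j).comp_fst μ).mul_bdd (c := C₂) ?_
      (ae_of_all _ fun p => norm_hessian_single_le hC₂ _ i j)
    exact aestronglyMeasurable_comp_rotatePair hX θ (by
      have := hfd.continuous_fderiv one_ne_zero
      fun_prop : Continuous fun x => fderiv ℝ (fderiv ℝ h) x (Pi.single i 1) (Pi.single j 1))
  have hle : ∀ θ, |Real.sin θ * ∫ p, ∑ i, ∑ j, D.covSubCdc μ f g p.1 i j *
      fderiv ℝ (fderiv ℝ h) (rotatePair X θ p) (Pi.single i 1) (Pi.single j 1) ∂(P.prod μ)|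
        ≤ √κ * M := fun θ => by
    rw [integral_prod _ (hHint θ), ← integral_const_mul, ← integral_const_mul]
    exact abs_integral_le_of_abs_le ((D.integrable_frob_covSubCdc f g).const_mul _) fun ω =>
      abs_sin_mul_integral_hessian_le X hμ l hl hκ hh hC₁ hC₂ hG θ ω (D.covSubCdc μ f g ω)
  have := D.abs_integral_sub_integral_le (hh.of_le one_le_two) hC₁
    (D.hasDerivAt_interpolation_covSubCdc hfg hμ hh hC₁ hC₂)
    -- The factor sin θ has been spent on the extra integration by parts; only cos θ remains, so
    -- B(π/2) = √κ M.
    (B := fun θ => √κ * M * Real.sin θ) (B' := fun θ => √κ * M * Real.cos θ)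
    (by simp) (fun θ => (Real.hasDerivAt_sin θ).const_mul _) (fun θ hs hc => by
      rw [mul_comm (Real.sin θ), mul_assoc, abs_mul, abs_of_nonneg hc, mul_comm]
      exact mul_le_mul_of_nonneg_right (hle θ) hc)
  simpa using this

end DirichletStructure

end InterpolationBounds

/-! ### Orthogonal series -/

section OrthogonalSeries

variable {H ι : Type*} [NormedAddCommGroup H] [InnerProductSpace ℝ H] {a : ι → H} {x : H}

lemma inner_eq_norm_sq_of_hasSum (ha : Pairwise fun i j => inner ℝ (a i) (a j) = 0)
    (hx : HasSum a x) (i : ι) : inner ℝ (a i) x = ‖a i‖ ^ 2 := by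
  classical
  have h1 := (innerSL ℝ (a i)).hasSum hx
  simp only [innerSL_apply_apply] at h1
  rw [← real_inner_self_eq_norm_sq]
  exact h1.unique (hasSum_single i fun j hj => ha hj.symm)

lemma hasSum_norm_sq_of_hasSum (ha : Pairwise fun i j => inner ℝ (a i) (a j) = 0)
    (hx : HasSum a x) : HasSum (fun i => ‖a i‖ ^ 2) (‖x‖ ^ 2) := by
  have h1 := (innerSL ℝ x).hasSum hx
  simp only [innerSL_apply_apply, real_inner_self_eq_norm_sq] at h1
  have h2 : ∀ i, inner ℝ x (a i) = ‖a i‖ ^ 2 := fun i => by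
    rw [real_inner_comm, inner_eq_norm_sq_of_hasSum ha hx]
  simpa only [h2] using h1

end OrthogonalSeries

/-! ### Spectral theory of Dirichlet structures -/

section Spectral

variable {Ω : Type*} [MeasurableSpace Ω] {P : Measure Ω}

namespace DirichletStructure

variable (D : DirichletStructure P)

lemma form_nonneg (f : D.dom) : 0 ≤ D.form f f := integral_nonneg_of_ae (D.cdc_nonneg f)

lemma form_comm (f g : D.dom) : D.form f g = D.form g f := by
  rw [form_apply, form_apply, D.cdc_symm]

lemma sq_form_le (f g : D.dom) : D.form f g ^ 2 ≤ D.form f f * D.form g g := by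
  have := LinearMap.BilinForm.apply_mul_apply_le_of_forall_zero_le D.form D.form_nonneg f g
  rwa [D.form_comm g f, ← sq] at this

lemma exists_mem_dom_of_mem_eigenspace {l : ℝ} {f : Lp ℝ 2 P} (hf : f ∈ D.eigenspace l) :
    ∃ hd : f ∈ D.dom, ∀ g : D.dom, D.form ⟨f, hd⟩ g = l * inner ℝ f (g : Lp ℝ 2 P) := by
  obtain ⟨hd, h⟩ := hf
  refine ⟨hd, fun g => (h g).trans ?_⟩
  rw [inner_neg_left, real_inner_smul_left, neg_neg]

lemma inner_eq_zero_of_mem_eigenspace {l m : ℝ} (hlm : l ≠ m) {f g : Lp ℝ 2 P}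
    (hf : f ∈ D.eigenspace l) (hg : g ∈ D.eigenspace m) : inner ℝ f g = 0 := by
  obtain ⟨hfd, hf⟩ := D.exists_mem_dom_of_mem_eigenspace hf
  obtain ⟨hgd, hg⟩ := D.exists_mem_dom_of_mem_eigenspace hg
  have h1 := hf ⟨g, hgd⟩
  have h2 := hg ⟨f, hfd⟩
  rw [D.form_comm, h1, real_inner_comm] at h2
  have h3 : (l - m) * inner ℝ f g = 0 := by rw [sub_mul, real_inner_comm, h2, sub_self]
  exact (mul_eq_zero.1 h3).resolve_left (sub_ne_zero.2 hlm)

/-- A series of eigenvectors with finite energy lies in the Dirichlet domain. -/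
theorem exists_mem_dom_of_hasSum {ev : ℕ → ℝ} (hev : Function.Injective ev)
    {a : ℕ → Lp ℝ 2 P} (ha : ∀ p, a p ∈ D.eigenspace (ev p)) {x : Lp ℝ 2 P} (hx : HasSum a x)
    (hs : Summable fun p => ev p * ‖a p‖ ^ 2) :
    ∃ hd : x ∈ D.dom,
      (∀ u : D.dom, Tendsto (fun N => ∑ p ∈ Finset.range N, ev p * inner ℝ (a p) (u : Lp ℝ 2 P))
        atTop (𝓝 (D.form ⟨x, hd⟩ u))) ∧
      HasSum (fun p => ev p * ‖a p‖ ^ 2) (D.form ⟨x, hd⟩ ⟨x, hd⟩) := by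
  choose hd hform using fun p => D.exists_mem_dom_of_mem_eigenspace (ha p)
  have horth : Pairwise fun i j => inner ℝ (a i) (a j) = 0 := fun i j hij =>
    D.inner_eq_zero_of_mem_eigenspace (hev.ne hij) (ha i) (ha j)
  let s : ℕ → D.dom := fun N => ∑ p ∈ Finset.range N, ⟨a p, hd p⟩
  have hsc : ∀ N, ((s N : D.dom) : Lp ℝ 2 P) = ∑ p ∈ Finset.range N, a p := fun N => by
    simp [s]
  have hsform : ∀ N u, D.form (s N) u
      = ∑ p ∈ Finset.range N, ev p * inner ℝ (a p) (u : Lp ℝ 2 P) := fun N u => by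
    simp only [s, map_sum, LinearMap.sum_apply, hform]
  have hinner : ∀ p N, inner ℝ (a p) ((s N : D.dom) : Lp ℝ 2 P)
      = if p < N then ‖a p‖ ^ 2 else 0 := fun p N => by
    rw [hsc, inner_sum]
    split_ifs with h
    · rw [Finset.sum_eq_single_of_mem p (Finset.mem_range.2 h) fun q _ hq => horth hq.symm,
        real_inner_self_eq_norm_sq]
    · exact Finset.sum_eq_zero fun q hq => horth fun hpq => h (hpq ▸ Finset.mem_range.1 hq)
  let S : ℕ → ℝ := fun N => ∑ p ∈ Finset.range N, ev p * ‖a p‖ ^ 2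
  have hss : ∀ M N, N ≤ M → D.form (s M) (s N) = S N := fun M N hNM => by
    rw [hsform]
    simp only [hinner, mul_ite, mul_zero]
    rw [← Finset.sum_filter]
    refine Finset.sum_congr (Finset.ext fun p => ?_) fun _ _ => rfl
    simp only [Finset.mem_filter, Finset.mem_range]
    omega
  -- By orthogonality the form of two partial sums sees only the shorter one, so the energy of a
  -- difference is a difference of partial energies. The partial sums are thus Cauchy for the form
  -- norm.
  have hdiff : ∀ M N, D.form (s M - s N) (s M - s N) ≤ |S M - S N| := fun M N => by
    have h1 : D.form (s M - s N) (s M - s N)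
        = D.form (s M) (s M) - 2 * D.form (s M) (s N) + D.form (s N) (s N) := by
      simp only [map_sub, LinearMap.sub_apply, D.form_comm (s N) (s M)]
      ring
    rw [h1, hss M M le_rfl, hss N N le_rfl]
    rcases le_total N M with h | h
    · rw [hss M N h]
      exact le_trans (by linarith) (le_abs_self _)
    · rw [D.form_comm, hss N M h]
      exact le_trans (by linarith) (neg_le_abs _)
  have hSc : CauchySeq S := hs.hasSum.tendsto_sum_nat.cauchySeq
  have hst : Tendsto (fun N => ((s N : D.dom) : Lp ℝ 2 P)) atTop (𝓝 x) := by
    simp only [hsc]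
    exact hx.tendsto_sum_nat
  obtain ⟨g, hg⟩ := D.complete s (by
    intro ε hε
    obtain ⟨N₁, hN₁⟩ := Metric.cauchySeq_iff.1 hSc (ε / 2) (by positivity)
    obtain ⟨N₂, hN₂⟩ := Metric.cauchySeq_iff.1 hst.cauchySeq (√(ε / 2)) (by positivity)
    refine ⟨max N₁ N₂, fun m hm n hn => ?_⟩
    have h1 := hN₁ m (le_of_max_le_left hm) n (le_of_max_le_left hn)
    have h2 := hN₂ m (le_of_max_le_right hm) n (le_of_max_le_right hn)
    rw [Real.dist_eq] at h1
    rw [dist_eq_norm] at h2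
    have h3 := (Real.lt_sqrt (norm_nonneg _)).1 h2
    have h4 := hdiff m n
    change ‖((s m : D.dom) : Lp ℝ 2 P) - s n‖ ^ 2 + 2⁻¹ * D.form _ _ < ε
    linarith [D.form_nonneg (s m - s n)])
  have hn1 : Tendsto (fun n => ‖(s n : Lp ℝ 2 P) - (g : Lp ℝ 2 P)‖ ^ 2) atTop (𝓝 0) := by
    refine squeeze_zero (fun n => by positivity) (fun n => ?_) hg
    have := D.form_nonneg (s n - g)
    change _ ≤ ‖(s n : Lp ℝ 2 P) - (g : Lp ℝ 2 P)‖ ^ 2 + 2⁻¹ * D.form _ _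
    linarith
  have hn2 : Tendsto (fun n => D.form (s n - g) (s n - g)) atTop (𝓝 0) := by
    have h3 := hg.const_mul 2
    rw [mul_zero] at h3
    refine squeeze_zero (fun n => D.form_nonneg _) (fun n => ?_) h3
    change _ ≤ 2 * (‖(s n : Lp ℝ 2 P) - (g : Lp ℝ 2 P)‖ ^ 2 + 2⁻¹ * D.form _ _)
    nlinarith [sq_nonneg ‖(s n : Lp ℝ 2 P) - (g : Lp ℝ 2 P)‖]
  have hxg : x = g := by
    refine tendsto_nhds_unique hst ?_
    rw [tendsto_iff_norm_sub_tendsto_zero]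
    simpa using hn1.sqrt
  subst hxg
  -- Convergence in energy gives convergence of the form against a fixed u by Cauchy–Schwarz.
  have hlim : ∀ u : D.dom, Tendsto (fun N => ∑ p ∈ Finset.range N,
      ev p * inner ℝ (a p) (u : Lp ℝ 2 P)) atTop (𝓝 (D.form g u)) := fun u => by
    have h4 : Tendsto (fun n => (D.form (s n - g) u) ^ 2) atTop (𝓝 0) := by
      have h5 := hn2.mul_const (D.form u u)
      rw [zero_mul] at h5
      exact squeeze_zero (fun n => sq_nonneg _) (fun n => D.sq_form_le _ _) h5
    have h6 := h4.sqrt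
    simp only [Real.sqrt_sq_eq_abs, Real.sqrt_zero] at h6
    have h7 := ((tendsto_zero_iff_abs_tendsto_zero _).2 h6).add_const (D.form g u)
    simp only [map_sub, LinearMap.sub_apply, sub_add_cancel, zero_add, hsform] at h7
    exact h7
  refine ⟨g.2, hlim, ?_⟩
  have h8 := hlim g
  simp only [inner_eq_norm_sq_of_hasSum horth hx] at h8
  have := tendsto_nhds_unique h8 hs.hasSum.tendsto_sum_nat
  rw [show D.form ⟨g, g.2⟩ ⟨g, g.2⟩ = D.form g g from rfl, this]
  exact hs.hasSum

variable {D} {ev : ℕ → ℝ}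

lemma IsDiagonalizedBy.ev_nonneg (hD : D.IsDiagonalizedBy ev) (p : ℕ) : 0 ≤ ev p :=
  hD.ev_zero ▸ hD.strictMono.monotone (Nat.zero_le p)

lemma IsDiagonalizedBy.ev_one_pos (hD : D.IsDiagonalizedBy ev) : 0 < ev 1 :=
  hD.ev_zero ▸ hD.strictMono zero_lt_one

/-- For p ≥ 1 this is the spectral gap; for p = 0 it uses the convention 0⁻¹ = 0. -/
lemma IsDiagonalizedBy.inv_ev_le (hD : D.IsDiagonalizedBy ev) (p : ℕ) :
    (ev p)⁻¹ ≤ (ev 1)⁻¹ := by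
  rcases Nat.eq_zero_or_pos p with rfl | hp
  · rw [hD.ev_zero, inv_zero]
    exact inv_nonneg.2 hD.ev_one_pos.le
  · exact inv_anti₀ hD.ev_one_pos (hD.strictMono.monotone hp)

lemma IsDiagonalizedBy.norm_sq_inv_smul_le (hD : D.IsDiagonalizedBy ev) (p : ℕ)
    (x : Lp ℝ 2 P) : ‖(ev p)⁻¹ • x‖ ^ 2 ≤ (ev 1)⁻¹ ^ 2 * ‖x‖ ^ 2 := by
  have h0 : 0 ≤ (ev p)⁻¹ := inv_nonneg.2 (hD.ev_nonneg p)
  rw [norm_smul, mul_pow, Real.norm_of_nonneg h0]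
  exact mul_le_mul_of_nonneg_right (pow_le_pow_left₀ h0 (hD.inv_ev_le p) 2) (sq_nonneg _)

lemma IsDiagonalizedBy.orthogonalFamily (hD : D.IsDiagonalizedBy ev) :
    OrthogonalFamily ℝ (fun p => D.eigenspace (ev p))
      fun p => (D.eigenspace (ev p)).subtypeₗᵢ := fun _ _ hpq v w =>
  D.inner_eq_zero_of_mem_eigenspace (hD.strictMono.injective.ne hpq) v.2 w.2

lemma IsDiagonalizedBy.pairwise_inner_eq_zero (hD : D.IsDiagonalizedBy ev) {a : ℕ → Lp ℝ 2 P}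
    (ha : ∀ p, a p ∈ D.eigenspace (ev p)) : Pairwise fun p q => inner ℝ (a p) (a q) = 0 :=
  fun _ _ hpq => D.inner_eq_zero_of_mem_eigenspace (hD.strictMono.injective.ne hpq) (ha _) (ha _)

/-- The spectral decomposition `f = ∑ p, π_p f`. -/
lemma IsDiagonalizedBy.hasSum_starProjection (hD : D.IsDiagonalizedBy ev) (f : Lp ℝ 2 P) :
    HasSum (fun p => (D.eigenspace (ev p)).starProjection f) f := by
  have : ∀ p, CompleteSpace (D.eigenspace (ev p)) := fun p =>
    (D.isClosed_eigenspace (ev p)).completeSpace_coe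
  have hV := IsHilbertSum.mkInternal (F := fun p => D.eigenspace (ev p)) hD.orthogonalFamily
    hD.dense.ge
  have h1 := hV.hasSum_linearIsometryEquiv_symm (hV.linearIsometryEquiv f)
  rw [LinearIsometryEquiv.symm_apply_apply] at h1
  set w := hV.linearIsometryEquiv f
  -- π_p annihilates the components in all other eigenspaces, so the components of the Hilbert sum
  -- are the projections.
  have h2 : ∀ p, (D.eigenspace (ev p)).starProjection f = (w p : Lp ℝ 2 P) := fun p => by
    have h3 := ((D.eigenspace (ev p)).starProjection).hasSum h1
    have h4 : HasSum (fun q => (D.eigenspace (ev p)).starProjection (w q : Lp ℝ 2 P))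
        ((D.eigenspace (ev p)).starProjection (w p : Lp ℝ 2 P)) := by
      refine hasSum_single p fun q hq => ?_
      rw [Submodule.starProjection_apply_eq_zero_iff, Submodule.mem_orthogonal]
      intro v hv
      exact D.inner_eq_zero_of_mem_eigenspace (hD.strictMono.injective.ne hq.symm) hv (w q).2
    rw [h3.unique h4]
    exact Submodule.starProjection_eq_self_iff.2 (w p).2
  simp only [h2]
  exact h1

lemma IsDiagonalizedBy.hasSum_norm_sq_starProjection (hD : D.IsDiagonalizedBy ev)
    (f : Lp ℝ 2 P) :
    HasSum (fun p => ‖(D.eigenspace (ev p)).starProjection f‖ ^ 2) (‖f‖ ^ 2) :=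
  hasSum_norm_sq_of_hasSum (hD.pairwise_inner_eq_zero fun _ =>
    Submodule.starProjection_apply_mem _ _) (hD.hasSum_starProjection f)

/-- Functions of finite energy belong to the Dirichlet domain. -/
theorem IsDiagonalizedBy.exists_mem_dom (hD : D.IsDiagonalizedBy ev) {f : Lp ℝ 2 P}
    (hf : Summable fun p => ev p * ‖(D.eigenspace (ev p)).starProjection f‖ ^ 2) :
    ∃ hd : f ∈ D.dom, HasSum (fun p => ev p * ‖(D.eigenspace (ev p)).starProjection f‖ ^ 2)
      (D.form ⟨f, hd⟩ ⟨f, hd⟩) :=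
  (D.exists_mem_dom_of_hasSum hD.strictMono.injective
    (fun _ => Submodule.starProjection_apply_mem _ _) (hD.hasSum_starProjection f) hf).imp
    fun _ h => h.2

/-- The series defining `-L⁻¹ f` converges. -/
lemma IsDiagonalizedBy.hasSum_neg_pseudoInv (hD : D.IsDiagonalizedBy ev) (f : Lp ℝ 2 P) :
    HasSum (fun p => (ev p)⁻¹ • (D.eigenspace (ev p)).starProjection f) (-D.pseudoInv ev f) := by
  let w : ∀ p, D.eigenspace (ev p) := fun p =>
    (ev p)⁻¹ • ⟨(D.eigenspace (ev p)).starProjection f, Submodule.starProjection_apply_mem _ _⟩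
  have hw : Summable fun p => (w p : Lp ℝ 2 P) := by
    refine (hD.orthogonalFamily.summable_iff_norm_sq_summable w).2 ?_
    refine Summable.of_nonneg_of_le (fun p => by positivity) (fun p => ?_)
      ((hD.hasSum_norm_sq_starProjection f).summable.mul_left ((ev 1)⁻¹ ^ 2))
    exact hD.norm_sq_inv_smul_le p _
  -- The term p = 0 vanishes because 0⁻¹ = 0, so the sum over all p is the shifted series of
  -- `pseudoInv`.
  have h1 : ∑' p, (w p : Lp ℝ 2 P) = -D.pseudoInv ev f := by
    rw [hw.tsum_eq_zero_add, pseudoInv, neg_neg]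
    simp [w, hD.ev_zero]
  rw [← h1]
  exact hw.hasSum

lemma IsDiagonalizedBy.norm_pseudoInv_le (hD : D.IsDiagonalizedBy ev) (f : Lp ℝ 2 P) :
    ‖D.pseudoInv ev f‖ ≤ (ev 1)⁻¹ * ‖f‖ := by
  have h1 := hasSum_norm_sq_of_hasSum (hD.pairwise_inner_eq_zero fun p =>
    Submodule.smul_mem _ _ (Submodule.starProjection_apply_mem _ _)) (hD.hasSum_neg_pseudoInv f)
  have h2 := (hD.hasSum_norm_sq_starProjection f).mul_left ((ev 1)⁻¹ ^ 2)
  have h3 := hasSum_le (fun p => hD.norm_sq_inv_smul_le p _) h1 h2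
  rw [norm_neg, ← mul_pow] at h3
  exact (sq_le_sq₀ (norm_nonneg _)
    (mul_nonneg (inv_nonneg.2 hD.ev_one_pos.le) (norm_nonneg _))).1 h3

/-- The eigenspace for 0 consists of constants, and centered functions are orthogonal to those. -/
lemma IsDiagonalizedBy.starProjection_zero_eq_zero [IsProbabilityMeasure P]
    (hD : D.IsDiagonalizedBy ev) {f : Lp ℝ 2 P} (hf : ∫ ω, f ω ∂P = 0) :
    (D.eigenspace (ev 0)).starProjection f = 0 := by
  rw [Submodule.starProjection_apply_eq_zero_iff, Submodule.mem_orthogonal]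
  intro v hv
  rw [hD.ev_zero] at hv
  obtain ⟨c, hc⟩ := hD.ker_const v hv
  rw [L2.inner_def]
  calc ∫ ω, inner ℝ (v ω) (f ω) ∂P = ∫ ω, c * f ω ∂P := by
        refine integral_congr_ae ?_
        filter_upwards [hc] with ω hω
        rw [hω]
        simp [mul_comm]
    _ = 0 := by rw [integral_const_mul, hf, mul_zero]

/-- `-L⁻¹ f` belongs to the Dirichlet domain, with an energy controlled by the norm of `f`, and
inverts `-L` on centered functions. -/
theorem IsDiagonalizedBy.exists_neg_pseudoInv_mem_dom [IsProbabilityMeasure P]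
    (hD : D.IsDiagonalizedBy ev) (f : Lp ℝ 2 P) :
    ∃ hd : -D.pseudoInv ev f ∈ D.dom, D.form ⟨_, hd⟩ ⟨_, hd⟩ ≤ (ev 1)⁻¹ * ‖f‖ ^ 2 ∧
      (∫ ω, f ω ∂P = 0 → ∀ u : D.dom, D.form ⟨_, hd⟩ u = inner ℝ f (u : Lp ℝ 2 P)) := by
  have hle : ∀ p, ev p * ‖(ev p)⁻¹ • (D.eigenspace (ev p)).starProjection f‖ ^ 2
      ≤ (ev 1)⁻¹ * ‖(D.eigenspace (ev p)).starProjection f‖ ^ 2 := fun p => by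
    rw [norm_smul, mul_pow, Real.norm_of_nonneg (inv_nonneg.2 (hD.ev_nonneg p)), ← mul_assoc]
    refine mul_le_mul_of_nonneg_right ?_ (sq_nonneg _)
    refine le_trans (le_of_eq ?_) (hD.inv_ev_le p)
    by_cases h : ev p = 0
    · simp [h]
    · field_simp
  have h2 := (hD.hasSum_norm_sq_starProjection f).mul_left (ev 1)⁻¹
  obtain ⟨hd, hlim, hsum⟩ := D.exists_mem_dom_of_hasSum hD.strictMono.injective
    (fun p => Submodule.smul_mem _ _ (Submodule.starProjection_apply_mem _ _))
    (hD.hasSum_neg_pseudoInv f) (Summable.of_nonneg_of_le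
      (fun p => mul_nonneg (hD.ev_nonneg p) (sq_nonneg _)) hle h2.summable)
  refine ⟨hd, hasSum_le hle hsum h2, fun hf u => ?_⟩
  refine tendsto_nhds_unique (hlim u) ?_
  have h3 := ((innerSL ℝ (u : Lp ℝ 2 P)).hasSum (hD.hasSum_starProjection f)).tendsto_sum_nat
  simp only [innerSL_apply_apply] at h3
  rw [real_inner_comm] at h3
  refine h3.congr fun N => Finset.sum_congr rfl fun p _ => ?_
  rw [real_inner_comm, real_inner_smul_left, ← mul_assoc]
  -- The product `ev p * (ev p)⁻¹` is 1 except at p = 0, where centering removes the term.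
  by_cases h : ev p = 0
  · have hp : p = 0 := hD.strictMono.injective (h.trans hD.ev_zero.symm)
    subst hp
    rw [hD.starProjection_zero_eq_zero hf]
    simp
  · rw [mul_inv_cancel₀ h, one_mul]

end DirichletStructure

end Spectral

/-! ### Coordinates and elementary tensors -/

section Tensor

variable {K : Type*} [NormedAddCommGroup K] [InnerProductSpace ℝ K]

/-- Distinct basis vectors are at distance √2, so the balls of radius 1/2 around them are disjoint
and open. Countability is what allows almost sure statements for all coordinates at once. -/
lemma countable_of_hilbertBasis [TopologicalSpace.SeparableSpace K] {ι : Type*}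
    (b : HilbertBasis ι ℝ K) : Countable ι := by
  have hd : Pairwise fun i j => 1 ≤ dist (b i) (b j) := fun i j hij => by
    have h1 : ‖b i - b j‖ ^ 2 = 2 := by
      rw [norm_sub_sq_real, b.orthonormal.1, b.orthonormal.1, b.orthonormal.2 hij]
      norm_num
    simp only [dist_eq_norm]
    nlinarith [norm_nonneg (b i - b j)]
  have hdisj : Pairwise (Function.onFun Disjoint fun i => Metric.ball (b i) (1 / 2)) :=
    fun i j hij => Metric.ball_disjoint_ball (by linarith [hd hij])
  exact Pairwise.countable_of_isOpen_disjoint hdisj (fun _ => Metric.isOpen_ball)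
    (fun i => ⟨b i, Metric.mem_ball_self (by norm_num)⟩)

instance countable_onbIndex [CompleteSpace K] [TopologicalSpace.SeparableSpace K] :
    Countable (OnbIndex K) :=
  countable_of_hilbertBasis (onb K)

variable {Ω : Type*} [MeasurableSpace Ω] {P : Measure Ω}

lemma coeFn_coord (u : K) (F : Lp K 2 P) : coord u F =ᵐ[P] fun ω => inner ℝ u (F ω) :=
  ContinuousLinearMap.coeFn_compLp' _ F

lemma coeFn_elemTensor (f : Lp ℝ 2 P) (k : K) : elemTensor f k =ᵐ[P] fun ω => f ω • k :=
  ContinuousLinearMap.coeFn_compLp' _ f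

lemma coord_neg (u : K) (F : Lp K 2 P) : coord u (-F) = -coord u F :=
  map_neg ((innerSL ℝ u).compLpₗ 2 P) F

lemma inner_elemTensor (f g : Lp ℝ 2 P) (k k' : K) :
    inner ℝ (elemTensor f k) (elemTensor g k') = inner ℝ k k' * inner ℝ f g := by
  rw [L2.inner_def, L2.inner_def, ← integral_const_mul]
  refine integral_congr_ae ?_
  filter_upwards [coeFn_elemTensor f k, coeFn_elemTensor g k'] with ω h1 h2
  rw [h1, h2, real_inner_smul_left, real_inner_smul_right]
  simp
  ring

lemma coord_elemTensor (f : Lp ℝ 2 P) (k u : K) :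
    coord u (elemTensor f k) = (inner ℝ u k : ℝ) • f := by
  refine Lp.ext ?_
  filter_upwards [coeFn_elemTensor f k, coeFn_coord u (elemTensor f k),
    Lp.coeFn_smul (inner ℝ u k : ℝ) f] with ω h1 h2 h3
  rw [h2, h1, h3, real_inner_smul_right, Pi.smul_apply, smul_eq_mul, mul_comm]

/-- `f ↦ f ⊗ k` as a linear isometry, for a unit vector `k`. -/
def elemTensorₗᵢ (P : Measure Ω) {k : K} (hk : ‖k‖ = 1) : Lp ℝ 2 P →ₗᵢ[ℝ] Lp K 2 P where
  toLinearMap := (ContinuousLinearMap.toSpanSingleton ℝ k).compLpₗ 2 P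
  norm_map' f := by
    have h1 := inner_elemTensor f f k k
    rw [real_inner_self_eq_norm_sq, real_inner_self_eq_norm_sq, real_inner_self_eq_norm_sq, hk,
      one_pow, one_mul] at h1
    exact (sq_eq_sq₀ (norm_nonneg _) (norm_nonneg _)).1 h1

variable {ι : Type*}

lemma orthogonalFamily_elemTensor {b : ι → K} (hb : Orthonormal ℝ b) :
    OrthogonalFamily ℝ (fun _ : ι => Lp ℝ 2 P) fun i => elemTensorₗᵢ P (hb.1 i) :=
  fun i j hij f g => by
    change inner ℝ (elemTensor f (b i)) (elemTensor g (b j)) = 0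
    rw [inner_elemTensor, hb.2 hij, zero_mul]

/-- Bessel's inequality at each ω, integrated. -/
lemma summable_norm_sq_coord {b : ι → K} (hb : Orthonormal ℝ b) (F : Lp K 2 P) :
    Summable fun i => ‖coord (b i) F‖ ^ 2 := by
  have hcoord : ∀ u : K, ‖coord u F‖ ^ 2 = ∫ ω, inner ℝ u (F ω) ^ 2 ∂P := fun u => by
    rw [← real_inner_self_eq_norm_sq, L2.inner_def]
    refine integral_congr_ae ?_
    filter_upwards [coeFn_coord u F] with ω h1
    rw [h1]
    simp [sq]
  have hi : ∀ u : K, Integrable (fun ω => inner ℝ u (F ω) ^ 2) P := fun u =>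
    ((Lp.memLp (coord u F)).integrable_sq).congr (by
      filter_upwards [coeFn_coord u F] with ω h1
      rw [h1])
  refine summable_of_sum_le (c := ∫ ω, ‖F ω‖ ^ 2 ∂P) (fun i => sq_nonneg _) fun s => ?_
  simp only [hcoord]
  rw [← integral_finsetSum _ fun i _ => hi _]
  refine integral_mono (integrable_finsetSum _ fun i _ => hi _)
    ((memLp_two_iff_integrable_sq_norm (Lp.memLp F).1).1 (Lp.memLp F)) fun ω => ?_
  have := hb.sum_inner_products_le (s := s) (F ω)
  simpa using this

variable [CompleteSpace K]

/-- The summands are orthogonal, so square summability makes the series converge and `tsum` does not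
take its default value 0. -/
lemma hasSum_tensorExt {T : Lp ℝ 2 P → Lp ℝ 2 P} {F : Lp K 2 P}
    (hT : Summable fun i => ‖T (coord (onb K i) F)‖ ^ 2) :
    HasSum (fun i => elemTensor (T (coord (onb K i) F)) (onb K i)) (tensorExt T F) :=
  (((orthogonalFamily_elemTensor (P := P) (onb K).orthonormal).summable_iff_norm_sq_summable
    fun i => T (coord (onb K i) F)).2 hT).hasSum

lemma hasSum_norm_sq_tensorExt {T : Lp ℝ 2 P → Lp ℝ 2 P} {F : Lp K 2 P}
    (hT : Summable fun i => ‖T (coord (onb K i) F)‖ ^ 2) :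
    HasSum (fun i => ‖T (coord (onb K i) F)‖ ^ 2) (‖tensorExt T F‖ ^ 2) := by
  have h1 := hasSum_norm_sq_of_hasSum (fun i j hij =>
    orthogonalFamily_elemTensor (P := P) (onb K).orthonormal hij _ _) (hasSum_tensorExt hT)
  have h2 : ∀ i, ‖elemTensor (T (coord (onb K i) F)) (onb K i)‖ = ‖T (coord (onb K i) F)‖ :=
    fun i => (elemTensorₗᵢ P ((onb K).orthonormal.1 i)).norm_map _
  have h3 : (fun i => ‖elemTensor (T (coord (onb K i) F)) (onb K i : K)‖ ^ 2)
      = fun i => ‖T (coord (onb K i) F)‖ ^ 2 := funext fun i => by rw [h2]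
  rw [← h3]
  exact h1

lemma coord_tensorExt {T : Lp ℝ 2 P → Lp ℝ 2 P} {F : Lp K 2 P}
    (hT : Summable fun i => ‖T (coord (onb K i) F)‖ ^ 2) (j : OnbIndex K) :
    coord (onb K j) (tensorExt T F) = T (coord (onb K j) F) := by
  have h1 := ((innerSL ℝ (onb K j)).compLpL 2 P).hasSum (hasSum_tensorExt hT)
  have h2 : HasSum (fun i => coord (onb K j) (elemTensor (T (coord (onb K i) F)) (onb K i)))
      (T (coord (onb K j) F)) := by
    have h3 : coord (onb K j) (elemTensor (T (coord (onb K j) F)) (onb K j))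
        = T (coord (onb K j) F) := by
      rw [coord_elemTensor, real_inner_self_eq_norm_sq, (onb K).orthonormal.1, one_pow, one_smul]
    have h4 := hasSum_single (f := fun i => coord (onb K j)
      (elemTensor (T (coord (onb K i) F)) (onb K i))) j fun i hij => by
        rw [coord_elemTensor, (onb K).orthonormal.2 hij.symm, zero_smul]
    rwa [h3] at h4
  exact h1.unique h2

end Tensor

/-! ### The carré du champ operator on vector-valued functionals -/

section VectorCdc

variable {K : Type*} [NormedAddCommGroup K] [InnerProductSpace ℝ K]

/-- The operator norm is at most the Hilbert–Schmidt norm; on finite sums this is the Cauchy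
criterion behind `summable_smul_rankOneOp`. -/
lemma norm_sum_smul_rankOneOp_sq_le {ι : Type*} {b : ι → K} (hb : Orthonormal ℝ b)
    (c : ι × ι → ℝ) (t : Finset (ι × ι)) :
    ‖∑ p ∈ t, c p • rankOneOp (b p.1) (b p.2)‖ ^ 2 ≤ ∑ p ∈ t, c p ^ 2 := by
  classical
  set T := ∑ p ∈ t, c p • rankOneOp (b p.1) (b p.2)
  have hTi : ∀ u v, inner ℝ v (T u) = ∑ p ∈ t, c p * (inner ℝ (b p.1) u * inner ℝ v (b p.2)) := by
    intro u v
    simp only [T, sum_apply, inner_sum]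
    refine Finset.sum_congr rfl fun p _ => ?_
    simp [rankOneOp, real_inner_smul_right]
  have hbes : ∀ u v, ∑ p ∈ t, (inner ℝ (b p.1) u * inner ℝ v (b p.2)) ^ 2
      ≤ ‖u‖ ^ 2 * ‖v‖ ^ 2 := fun u v => by
    calc ∑ p ∈ t, (inner ℝ (b p.1) u * inner ℝ v (b p.2)) ^ 2
        ≤ ∑ p ∈ t.image Prod.fst ×ˢ t.image Prod.snd,
          (inner ℝ (b p.1) u * inner ℝ v (b p.2)) ^ 2 := by
          refine Finset.sum_le_sum_of_subset_of_nonneg ?_ fun _ _ _ => sq_nonneg _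
          exact Finset.subset_product
      _ = (∑ i ∈ t.image Prod.fst, inner ℝ (b i) u ^ 2)
          * ∑ j ∈ t.image Prod.snd, inner ℝ (b j) v ^ 2 := by
          rw [Finset.sum_product, Finset.sum_mul_sum]
          simp only [mul_pow, real_inner_comm v]
      _ ≤ _ := by
          have h1 := hb.sum_inner_products_le (s := t.image Prod.fst) u
          have h2 := hb.sum_inner_products_le (s := t.image Prod.snd) v
          simp only [Real.norm_eq_abs, sq_abs] at h1 h2
          exact mul_le_mul h1 h2 (Finset.sum_nonneg fun _ _ => sq_nonneg _) (sq_nonneg _)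
  have hC : 0 ≤ ∑ p ∈ t, c p ^ 2 := Finset.sum_nonneg fun _ _ => sq_nonneg _
  have hle : ‖T‖ ≤ √(∑ p ∈ t, c p ^ 2) := by
    refine T.opNorm_le_bound (Real.sqrt_nonneg _) fun u => ?_
    -- T u is paired with itself: Cauchy–Schwarz separates the coefficients from the inner products,
    -- to which Bessel applies, and ‖T u‖² is divided out afterwards.
    have h1 : (‖T u‖ ^ 2) ^ 2 ≤ (∑ p ∈ t, c p ^ 2) * (‖u‖ ^ 2 * ‖T u‖ ^ 2) := by
      have h0 : ‖T u‖ ^ 2 = ∑ p ∈ t, c p * (inner ℝ (b p.1) u * inner ℝ (T u) (b p.2)) := by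
        rw [← real_inner_self_eq_norm_sq, hTi]
      calc (‖T u‖ ^ 2) ^ 2 = (∑ p ∈ t, c p * (inner ℝ (b p.1) u * inner ℝ (T u) (b p.2))) ^ 2 := by
            rw [← h0]
        _ ≤ _ := (Finset.sum_mul_sq_le_sq_mul_sq _ _ _).trans
          (mul_le_mul_of_nonneg_left (hbes _ _) hC)
    have h2 : ‖T u‖ ^ 2 ≤ (∑ p ∈ t, c p ^ 2) * ‖u‖ ^ 2 := by
      rcases eq_or_ne (‖T u‖ ^ 2) 0 with h0 | h0
      · rw [h0]; positivity
      · have h3 : 0 < ‖T u‖ ^ 2 := lt_of_le_of_ne (sq_nonneg _) h0.symm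
        refine le_of_mul_le_mul_right ?_ h3
        nlinarith
    rw [← Real.sqrt_sq (norm_nonneg (T u)), ← Real.sqrt_sq (norm_nonneg u), ← Real.sqrt_mul hC]
    exact Real.sqrt_le_sqrt h2
  calc ‖T‖ ^ 2 ≤ √(∑ p ∈ t, c p ^ 2) ^ 2 := pow_le_pow_left₀ (norm_nonneg _) hle 2
    _ = _ := Real.sq_sqrt hC

/-- A square-summable family of coefficients defines a bounded operator. -/
lemma summable_smul_rankOneOp [CompleteSpace K] {ι : Type*} {b : ι → K} (hb : Orthonormal ℝ b)
    {c : ι × ι → ℝ} (hc : Summable fun p => c p ^ 2) :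
    Summable fun p : ι × ι => c p • rankOneOp (b p.1) (b p.2) := by
  rw [summable_iff_vanishing_norm] at hc ⊢
  intro ε hε
  obtain ⟨s, hs⟩ := hc (ε ^ 2) (by positivity)
  refine ⟨s, fun t ht => ?_⟩
  have h1 := (le_abs_self _).trans_lt (hs t ht)
  exact lt_of_pow_lt_pow_left₀ 2 hε.le ((norm_sum_smul_rankOneOp_sq_le hb c t).trans_lt h1)

/-- A matrix coefficient is continuous in operator norm, so it passes through the convergent sum,
and orthonormality leaves one index from each of the two tensor orders. -/
lemma inner_tsum_smul_rankOneOp_add [CompleteSpace K] {ι : Type*} {b : ι → K} (hb : Orthonormal ℝ b)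
    {c : ι × ι → ℝ} (hc : Summable fun p => c p ^ 2) (l m : ι) :
    inner ℝ (b l) ((∑' p : ι × ι, c p • (rankOneOp (b p.1) (b p.2) + rankOneOp (b p.2) (b p.1)))
      (b m)) = c (m, l) + c (l, m) := by
  have h1 := summable_smul_rankOneOp hb hc
  have h2 : Summable fun p : ι × ι => c p • rankOneOp (b p.2) (b p.1) := by
    have h3 : Summable fun p : ι × ι => c p.swap ^ 2 :=
      (Equiv.prodComm ι ι).summable_iff.2 hc
    exact (Equiv.prodComm ι ι).summable_iff.1 (summable_smul_rankOneOp hb h3)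
  have h4 := (h1.add h2).hasSum
  simp only [← smul_add] at h4
  have h5 := ((innerSL ℝ (b l)).comp (ContinuousLinearMap.apply ℝ K (b m))).hasSum h4
  have h6 : ∀ p : ι × ι, ((innerSL ℝ (b l)).comp (ContinuousLinearMap.apply ℝ K (b m)))
      (c p • (rankOneOp (b p.1) (b p.2) + rankOneOp (b p.2) (b p.1)))
      = c p * (inner ℝ (b p.1) (b m) * inner ℝ (b l) (b p.2))
        + c p * (inner ℝ (b p.2) (b m) * inner ℝ (b l) (b p.1)) := fun p => by
    simp [rankOneOp, real_inner_smul_right, inner_add_right]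
  have h7 : HasSum (fun p : ι × ι => c p * (inner ℝ (b p.1) (b m) * inner ℝ (b l) (b p.2)))
      (c (m, l)) := by
    have := hasSum_single (f := fun p : ι × ι =>
      c p * (inner ℝ (b p.1) (b m) * inner ℝ (b l) (b p.2))) (m, l) fun p hp => by
        by_cases h : p.1 = m
        · rw [hb.2 (show l ≠ p.2 from fun h' => hp (Prod.ext h h'.symm))]; simp
        · rw [hb.2 h]; simp
    simpa [hb.1] using this
  have h8 : HasSum (fun p : ι × ι => c p * (inner ℝ (b p.2) (b m) * inner ℝ (b l) (b p.1)))
      (c (l, m)) := by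
    have := hasSum_single (f := fun p : ι × ι =>
      c p * (inner ℝ (b p.2) (b m) * inner ℝ (b l) (b p.1))) (l, m) fun p hp => by
        by_cases h : p.2 = m
        · rw [hb.2 (show l ≠ p.1 from fun h' => hp (Prod.ext h'.symm h))]; simp
        · rw [hb.2 h]; simp
    simpa [hb.1] using this
  simp only [h6] at h5
  exact h5.unique (h7.add h8)

end VectorCdc

/-! ### Pointwise carré du champ matrices and coordinates in the Dirichlet domain -/

section VectorDirichlet

variable {Ω : Type*} [MeasurableSpace Ω] {P : Measure Ω}

namespace DirichletStructure

variable (D : DirichletStructure P)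

/-- The pointwise Cauchy–Schwarz inequality for the carré du champ. -/
lemma sq_cdc_le_ae (f g : D.dom) :
    ∀ᵐ ω ∂P, D.cdc f g ω ^ 2 ≤ D.cdc f f ω * D.cdc g g ω := by
  -- Rational parameters keep the exceptional set null; density extends the inequality to real ones,
  -- and the discriminant gives the claim.
  have h1 : ∀ q : ℚ, ∀ᵐ ω ∂P,
      0 ≤ D.cdc g g ω * ((q : ℝ) * q) + 2 * D.cdc f g ω * q + D.cdc f f ω := fun q => by
    have h2 : D.cdc (f + (q : ℝ) • g) (f + (q : ℝ) • g)
        = D.cdc f f + ((2 * (q : ℝ)) • D.cdc f g + ((q : ℝ) * q) • D.cdc g g) := by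
      simp only [map_add, map_smul, LinearMap.add_apply, LinearMap.smul_apply, smul_add,
        smul_smul, D.cdc_symm g f, two_mul, add_smul]
      abel
    have h3 := D.cdc_nonneg (f + (q : ℝ) • g)
    rw [h2] at h3
    filter_upwards [h3, Lp.coeFn_add (D.cdc f f)
      ((2 * (q : ℝ)) • D.cdc f g + ((q : ℝ) * q) • D.cdc g g),
      Lp.coeFn_add ((2 * (q : ℝ)) • D.cdc f g) (((q : ℝ) * q) • D.cdc g g),
      Lp.coeFn_smul (2 * (q : ℝ)) (D.cdc f g), Lp.coeFn_smul ((q : ℝ) * q) (D.cdc g g)]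
      with ω e1 e2 e3 e4 e5
    rw [e2, Pi.add_apply, e3, Pi.add_apply, e4, e5] at e1
    simp only [Pi.smul_apply, smul_eq_mul, Pi.zero_apply] at e1
    linarith
  filter_upwards [ae_all_iff.2 h1] with ω hω
  have h4 : ∀ x : ℝ, 0 ≤ D.cdc g g ω * (x * x) + 2 * D.cdc f g ω * x + D.cdc f f ω := fun x => by
    refine Rat.denseRange_cast.induction_on x ?_ hω
    exact isClosed_le continuous_const (by fun_prop)
  have h5 := discrim_le_zero h4
  rw [discrim] at h5
  nlinarith

/-- By Tonelli the sum of the nonnegative Γ(fᵢ, fᵢ) has finite expectation, hence is finite almost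
surely. -/
lemma ae_summable_cdc {ι : Type*} [Countable ι] {f : ι → D.dom}
    (hf : Summable fun i => D.form (f i) (f i)) :
    ∀ᵐ ω ∂P, Summable fun i => D.cdc (f i) (f i) ω := by
  have hm : ∀ i, AEMeasurable (fun ω => ENNReal.ofReal (D.cdc (f i) (f i) ω)) P := fun i =>
    (Lp.aestronglyMeasurable _).aemeasurable.ennreal_ofReal
  have h1 : ∫⁻ ω, ∑' i, ENNReal.ofReal (D.cdc (f i) (f i) ω) ∂P ≠ ∞ := by
    rw [lintegral_tsum hm]
    have h2 : ∀ i, ∫⁻ ω, ENNReal.ofReal (D.cdc (f i) (f i) ω) ∂P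
        = ENNReal.ofReal (D.form (f i) (f i)) := fun i =>
      (ofReal_integral_eq_lintegral_ofReal (L1.integrable_coeFn _) (D.cdc_nonneg _)).symm
    simp only [h2]
    exact hf.tsum_ofReal_ne_top
  filter_upwards [ae_lt_top' (AEMeasurable.tsum hm) h1,
    ae_all_iff.2 fun i => D.cdc_nonneg (f i)] with ω h3 h4
  have h5 := ENNReal.summable_toReal h3.ne
  exact h5.congr fun i => ENNReal.toReal_ofReal (h4 i)

/-- Pointwise Cauchy–Schwarz dominates the double series by a product of two convergent ones; this
makes the series of `cdcK` converge almost surely. -/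
lemma ae_summable_sq_cdc {ι : Type*} [Countable ι] {f g : ι → D.dom}
    (hf : Summable fun i => D.form (f i) (f i)) (hg : Summable fun i => D.form (g i) (g i)) :
    ∀ᵐ ω ∂P, Summable fun p : ι × ι => D.cdc (f p.1) (g p.2) ω ^ 2 := by
  filter_upwards [D.ae_summable_cdc hf, D.ae_summable_cdc hg,
    ae_all_iff.2 fun i => D.cdc_nonneg (f i), ae_all_iff.2 fun i => D.cdc_nonneg (g i),
    ae_all_iff.2 fun p : ι × ι => D.sq_cdc_le_ae (f p.1) (g p.2)] with ω h1 h2 h3 h4 h5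
  exact Summable.of_nonneg_of_le (fun p => sq_nonneg _) h5 (h1.mul_of_nonneg h2 h3 h4)

variable {K : Type*} [NormedAddCommGroup K] [InnerProductSpace ℝ K] [CompleteSpace K]

lemma cdcExt_eq (f g : D.dom) : D.cdcExt (f : Lp ℝ 2 P) g = D.cdc f g := by
  rw [cdcExt, dif_pos ⟨f.2, g.2⟩]

/-- The matrix coefficients of the carré du champ operator. -/
theorem ae_inner_cdcK [TopologicalSpace.SeparableSpace K] {F G : Lp K 2 P}
    {f g : OnbIndex K → D.dom} (hf : ∀ i, coord (onb K i) F = f i)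
    (hg : ∀ i, coord (onb K i) G = g i) (hfs : Summable fun i => D.form (f i) (f i))
    (hgs : Summable fun i => D.form (g i) (g i)) :
    ∀ᵐ ω ∂P, ∀ l m, inner ℝ (onb K l) (D.cdcK F G ω (onb K m))
      = 2⁻¹ * (D.cdc (f l) (g m) ω + D.cdc (f m) (g l) ω) := by
  filter_upwards [D.ae_summable_sq_cdc hfs hgs] with ω hω l m
  simp only [cdcK, hf, hg, cdcExt_eq]
  have h1 : Summable fun p : OnbIndex K × OnbIndex K =>
      (2⁻¹ * D.cdc (f p.1) (g p.2) ω) ^ 2 := by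
    simp only [mul_pow]
    exact hω.mul_left _
  rw [inner_tsum_smul_rankOneOp_add (onb K).orthonormal h1]
  ring

variable {D} {ev : ℕ → ℝ}

lemma norm_starProjection_sq_le (U : Submodule ℝ (Lp ℝ 2 P)) [U.HasOrthogonalProjection]
    (f : Lp ℝ 2 P) : ‖U.starProjection f‖ ^ 2 ≤ ‖f‖ ^ 2 :=
  pow_le_pow_left₀ (norm_nonneg _) (U.norm_starProjection_apply_le f) 2

/-- The coordinates of an element of `𝔻` have summable energies. -/
theorem IsDiagonalizedBy.exists_coord_mem_dom (hD : D.IsDiagonalizedBy ev) {F : Lp K 2 P}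
    (hF : F ∈ D.domK K ev) :
    ∃ f : OnbIndex K → D.dom, (∀ i, coord (onb K i) F = f i) ∧
      Summable fun i => D.form (f i) (f i) := by
  obtain ⟨N, hN⟩ : ∃ N : ℕ → OnbIndex K → ℝ, ∀ p i,
      N p i = ‖(D.eigenspace (ev p)).starProjection (coord (onb K i) F)‖ ^ 2 :=
    ⟨_, fun _ _ => rfl⟩
  have hN0 : ∀ p i, 0 ≤ ev p * N p i := fun p i => by
    rw [hN]
    exact mul_nonneg (hD.ev_nonneg p) (sq_nonneg _)
  have hT : ∀ p, HasSum (N p) (‖tensorExt (D.eigenspace (ev p)).starProjection F‖ ^ 2) :=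
    fun p => by
    rw [funext (hN p)]
    exact hasSum_norm_sq_tensorExt (Summable.of_nonneg_of_le (fun i => sq_nonneg _)
      (fun i => norm_starProjection_sq_le _ _)
      (summable_norm_sq_coord (onb K).orthonormal F))
  have hT' : ∀ p, HasSum (fun i => ev p * N p i)
      (ev p * ‖tensorExt (D.eigenspace (ev p)).starProjection F‖ ^ 2) := fun p =>
    HasSum.mul_left (ev p) (hT p)
  have h2 : Summable fun p => ∑' i, ev p * N p i := by
    simp only [fun p => (hT' p).tsum_eq]
    exact hF
  -- The terms are nonnegative, so eigenvalues and coordinates may be summed in either order, and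
  -- the finite energy of F is distributed over its coordinates.
  have h1 : Summable fun q : ℕ × OnbIndex K => ev q.1 * N q.1 q.2 :=
    (summable_prod_of_nonneg fun q => hN0 q.1 q.2).2 ⟨fun p => (hT' p).summable, h2⟩
  have h3 := (summable_prod_of_nonneg (f := fun q : OnbIndex K × ℕ => ev q.2 * N q.2 q.1)
    fun q => hN0 _ _).1 h1.prod_symm
  simp only [hN] at h3
  choose hd hsum using fun i => hD.exists_mem_dom (h3.1 i)
  refine ⟨fun i => ⟨_, hd i⟩, fun i => rfl, ?_⟩
  simpa only [(hsum _).tsum_eq] using h3.2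

/-- The coordinates of `-L⁻¹ F`. -/
theorem IsDiagonalizedBy.exists_coord_neg_pseudoInvK_mem_dom [IsProbabilityMeasure P]
    (hD : D.IsDiagonalizedBy ev) {F : Lp K 2 P} (hF0 : ∫ ω, F ω ∂P = 0) :
    ∃ g : OnbIndex K → D.dom, (∀ i, coord (onb K i) (-(D.pseudoInvK ev F)) = g i) ∧
      (Summable fun i => D.form (g i) (g i)) ∧
      ∀ i (u : D.dom), D.form (g i) u = inner ℝ (coord (onb K i) F) (u : Lp ℝ 2 P) := by
  have hc := summable_norm_sq_coord (P := P) (onb K).orthonormal F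
  have hT : Summable fun i => ‖D.pseudoInv ev (coord (onb K i) F)‖ ^ 2 := by
    refine Summable.of_nonneg_of_le (fun i => sq_nonneg _) (fun i => ?_)
      (hc.mul_left ((ev 1)⁻¹ ^ 2))
    rw [← mul_pow]
    exact pow_le_pow_left₀ (norm_nonneg _) (hD.norm_pseudoInv_le _) 2
  choose hd hle hinv using fun i => hD.exists_neg_pseudoInv_mem_dom (coord (onb K i) F)
  refine ⟨fun i => ⟨_, hd i⟩, fun i => ?_, Summable.of_nonneg_of_le (fun i => D.form_nonneg _) hle
    (hc.mul_left _), fun i => hinv i ?_⟩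
  · rw [coord_neg, pseudoInvK, coord_tensorExt hT]
  · rw [integral_congr_ae (coeFn_coord _ F),
      integral_inner ((Lp.memLp F).integrable one_le_two), hF0, inner_zero_right]

end DirichletStructure

end VectorDirichlet

/-! ### Hilbert–Schmidt norms and finite orthonormal families -/

section FiniteFamilies

variable {K : Type*} [NormedAddCommGroup K] [InnerProductSpace ℝ K] {n : ℕ}

lemma sum_enorm_sq_le_hsNorm_sq [CompleteSpace K] {E : Type*} [NormedAddCommGroup E]
    [NormedSpace ℝ E] (T : K →L[ℝ] E) {e : Fin n → OnbIndex K} (he : Function.Injective e) :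
    ∑ i, ‖T (onb K (e i))‖ₑ ^ 2 ≤ hsNorm T ^ 2 := by
  have h1 : hsNorm T ^ 2 = ∑' i, ‖T (onb K i)‖ₑ ^ 2 := by
    rw [hsNorm, ← ENNReal.rpow_natCast, ← ENNReal.rpow_mul]
    norm_num
  rw [h1]
  have h2 := Finset.sum_map Finset.univ ⟨e, he⟩ fun i => ‖T (onb K i)‖ₑ ^ 2
  simp only [Function.Embedding.coeFn_mk] at h2
  rw [← h2]
  exact ENNReal.sum_le_tsum _

/-- Bessel's inequality for the Riesz representative of L. -/
lemma sum_sq_dual_le [CompleteSpace K] {b : Fin n → K} (hb : Orthonormal ℝ b) (L : StrongDual ℝ K) :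
    ∑ i, L (b i) ^ 2 ≤ ‖L‖ ^ 2 := by
  obtain ⟨v, rfl⟩ := (InnerProductSpace.toDual ℝ K).surjective L
  have h1 := hb.sum_inner_products_le (s := Finset.univ) v
  simpa [real_inner_comm] using h1

/-- The vector `∑ i, x i • b i`. -/
def synthesis (b : Fin n → K) : (Fin n → ℝ) →L[ℝ] K :=
  ∑ i, (ContinuousLinearMap.proj i : (Fin n → ℝ) →L[ℝ] ℝ).smulRight (b i)

/-- The vector of inner products with the family `b`. -/
def analysis (b : Fin n → K) : K →L[ℝ] (Fin n → ℝ) :=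
  ContinuousLinearMap.pi fun i => innerSL ℝ (b i)

lemma synthesis_apply (b : Fin n → K) (x : Fin n → ℝ) : synthesis b x = ∑ i, x i • b i := by
  simp [synthesis]

lemma synthesis_single (b : Fin n → K) (i : Fin n) : synthesis b (Pi.single i 1) = b i := by
  rw [synthesis_apply, Finset.sum_eq_single_of_mem i (Finset.mem_univ _) fun j _ hj => by
    rw [Pi.single_eq_of_ne hj, zero_smul], Pi.single_eq_same, one_smul]

lemma analysis_apply (b : Fin n → K) (x : K) (i : Fin n) : analysis b x i = inner ℝ (b i) x := rfl

lemma norm_synthesis {b : Fin n → K} (hb : Orthonormal ℝ b) (x : Fin n → ℝ) :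
    ‖synthesis b x‖ = √(∑ i, x i ^ 2) := by
  rw [← Real.sqrt_sq (norm_nonneg (synthesis b x)), ← real_inner_self_eq_norm_sq, synthesis_apply,
    hb.inner_sum]
  simp [sq]

lemma norm_synthesis_analysis_le {b : Fin n → K} (hb : Orthonormal ℝ b) (x : K) :
    ‖synthesis b (analysis b x)‖ ≤ ‖x‖ := by
  rw [norm_synthesis hb, ← Real.sqrt_sq (norm_nonneg x)]
  refine Real.sqrt_le_sqrt ?_
  have h1 := hb.sum_inner_products_le (s := Finset.univ) x
  simpa [analysis_apply] using h1

section Hessian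

variable {h : K → ℝ} {b : Fin n → K}

lemma fderiv_comp_synthesis (hh : Differentiable ℝ h) (x : Fin n → ℝ) :
    fderiv ℝ (h ∘ synthesis b) x = (fderiv ℝ h (synthesis b x)).comp (synthesis b) := by
  rw [fderiv_comp x (hh _) (synthesis b).differentiableAt, ContinuousLinearMap.fderiv]

lemma hasFDerivAt_fderiv_comp_synthesis (hh : Differentiable ℝ h)
    (hh' : Differentiable ℝ (fderiv ℝ h)) (x : Fin n → ℝ) :
    HasFDerivAt (fderiv ℝ (h ∘ synthesis b))
      (((ContinuousLinearMap.compL ℝ (Fin n → ℝ) K ℝ).flip (synthesis b)).comp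
        ((fderiv ℝ (fderiv ℝ h) (synthesis b x)).comp (synthesis b))) x := by
  have h1 : fderiv ℝ (h ∘ synthesis b) = fun x =>
      (ContinuousLinearMap.compL ℝ (Fin n → ℝ) K ℝ).flip (synthesis b)
        (fderiv ℝ h (synthesis b x)) := funext fun x => fderiv_comp_synthesis hh x
  rw [h1]
  exact (ContinuousLinearMap.hasFDerivAt _).comp x
    ((hh' _).hasFDerivAt.comp x (synthesis b).hasFDerivAt)

lemma fderiv_fderiv_comp_synthesis (hh : Differentiable ℝ h)
    (hh' : Differentiable ℝ (fderiv ℝ h)) (x : Fin n → ℝ) (i j : Fin n) :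
    fderiv ℝ (fderiv ℝ (h ∘ synthesis b)) x (Pi.single i 1) (Pi.single j 1)
      = fderiv ℝ (fderiv ℝ h) (synthesis b x) (b i) (b j) := by
  rw [(hasFDerivAt_fderiv_comp_synthesis hh hh' x).fderiv]
  simp [synthesis_single]

/-- The Hessian matrix of `h` along finitely many basis vectors has Frobenius norm at most `1`. -/
lemma sum_sum_sq_hessian_le [CompleteSpace K] {T : K →L[ℝ] K →L[ℝ] ℝ} (hT : hsNorm T ≤ 1)
    {e : Fin n → OnbIndex K} (he : Function.Injective e) :
    ∑ i, ∑ j, T (onb K (e i)) (onb K (e j)) ^ 2 ≤ 1 := by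
  have h1 : ∑ i, ‖T (onb K (e i))‖ₑ ^ 2 ≤ 1 :=
    (sum_enorm_sq_le_hsNorm_sq T he).trans (pow_le_one' hT 2)
  have h2 : ∑ i, ‖T (onb K (e i))‖ ^ 2 ≤ 1 := by
    rw [← ENNReal.ofReal_le_one, ENNReal.ofReal_sum_of_nonneg fun i _ => by positivity]
    simpa only [ENNReal.ofReal_pow (norm_nonneg _), ofReal_norm] using h1
  exact (Finset.sum_le_sum fun i _ =>
    sum_sq_dual_le ((onb K).orthonormal.comp e he) (T (onb K (e i)))).trans h2

end Hessian

end FiniteFamilies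

/-! ### Elementary bounds and approximation of test functions on ℝⁿ -/

section SmoothTestFunctions

variable {n : ℕ}

/-- The constant plays no role: mollifying a Hessian only requires it to be bounded. -/
lemma norm_le_of_abs_entries_le (T : (Fin n → ℝ) →L[ℝ] (Fin n → ℝ) →L[ℝ] ℝ)
    (hT : ∀ i j, |T (Pi.single i 1) (Pi.single j 1)| ≤ 1) : ‖T‖ ≤ (n : ℝ) * n := by
  refine T.opNorm_le_bound₂ (by positivity) fun x y => ?_
  have h1 : T x y = ∑ j, ∑ i, y j * (x i * T (Pi.single i 1) (Pi.single j 1)) := by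
    rw [apply_eq_sum_single (T x) y]
    refine Finset.sum_congr rfl fun j _ => ?_
    rw [show T x (Pi.single j 1) = T.flip (Pi.single j 1) x from rfl, apply_eq_sum_single,
      Finset.mul_sum]
    rfl
  rw [h1]
  refine (norm_sum_le _ _).trans ?_
  have h2 : ∀ j : Fin n, ‖∑ i, y j * (x i * T (Pi.single i 1) (Pi.single j 1))‖
      ≤ n * (‖x‖ * ‖y‖) := fun j => by
    refine (norm_sum_le _ _).trans ?_
    calc ∑ i, ‖y j * (x i * T (Pi.single i 1) (Pi.single j 1))‖ ≤ ∑ _i : Fin n, ‖x‖ * ‖y‖ := by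
          refine Finset.sum_le_sum fun i _ => ?_
          rw [norm_mul, norm_mul]
          have h3 := norm_le_pi_norm y j
          have h4 := norm_le_pi_norm x i
          have h5 := hT i j
          rw [← Real.norm_eq_abs] at h5
          calc _ ≤ ‖y‖ * (‖x‖ * 1) := by gcongr
            _ = _ := by ring
      _ = n * (‖x‖ * ‖y‖) := by simp
  calc _ ≤ ∑ _j : Fin n, (n : ℝ) * (‖x‖ * ‖y‖) := Finset.sum_le_sum fun j _ => h2 j
    _ = _ := by simp; ring

lemma sum_sum_mul_le_frob {A H : Fin n → Fin n → ℝ} (hH : ∑ i, ∑ j, H i j ^ 2 ≤ 1) :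
    ∑ i, ∑ j, A i j * H i j ≤ frob A := by
  refine Real.le_sqrt_of_sq_le ?_
  simp only [← Finset.sum_product' Finset.univ Finset.univ] at hH ⊢
  refine (Finset.sum_mul_sq_le_sq_mul_sq _ _ _).trans ?_
  exact mul_le_of_le_one_right (Finset.sum_nonneg fun _ _ => sq_nonneg _) hH

/-- If a bound on `|∫ h dν₁ - ∫ h dν₂|` holds for all functions uniformly close to `h`, it holds
for `h`. -/
lemma abs_integral_sub_le_of_approx {ν₁ ν₂ : Measure (Fin n → ℝ)} [IsProbabilityMeasure ν₁]
    [IsProbabilityMeasure ν₂] {h : (Fin n → ℝ) → ℝ} (h₁ : Integrable h ν₁) (h₂ : Integrable h ν₂)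
    {c : ℝ} (hc : ∀ ε > 0, ∃ k : (Fin n → ℝ) → ℝ, Continuous k ∧ (∀ x, |k x - h x| ≤ ε) ∧
      |∫ x, k x ∂ν₁ - ∫ x, k x ∂ν₂| ≤ c) :
    |∫ x, h x ∂ν₁ - ∫ x, h x ∂ν₂| ≤ c := by
  refine le_of_forall_pos_le_add fun ε hε => ?_
  obtain ⟨k, hk, hkh, hkc⟩ := hc (ε / 2) (by positivity)
  have h3 : ∀ (ν : Measure (Fin n → ℝ)) [IsProbabilityMeasure ν], Integrable h ν →
      |∫ x, h x ∂ν - ∫ x, k x ∂ν| ≤ ε / 2 := fun ν _ hi => by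
    have hki : Integrable k ν := by
      have : Integrable (fun x => k x - h x) ν := Integrable.of_bound
        (hk.aestronglyMeasurable.sub hi.1) (ε / 2) (ae_of_all _ hkh)
      exact (this.add hi).congr (ae_of_all _ fun x => by simp)
    rw [← integral_sub hi hki]
    have := abs_integral_le_of_abs_le (ν := ν) (f := fun x => h x - k x)
      (integrable_const (ε / 2)) (fun x => by rw [abs_sub_comm]; exact hkh x)
    simpa using this
  have h4 := abs_le.1 (h3 ν₁ h₁)
  have h5 := abs_le.1 (h3 ν₂ h₂)
  have h6 := abs_le.1 hkc
  exact abs_le.2 ⟨by linarith [h4.1, h5.2, h6.1], by linarith [h4.2, h5.1, h6.2]⟩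

/-- The Euclidean length is kept explicit because the norm of `Fin n → ℝ` is the sup norm;
difference quotients along t • u give the bound. -/
lemma fderiv_apply_le_of_abs_add_sub_le {k : (Fin n → ℝ) → ℝ} (hk : Differentiable ℝ k)
    (h : ∀ x u, |k (x + u) - k x| ≤ √(∑ i, u i ^ 2)) (x u : Fin n → ℝ) :
    fderiv ℝ k x u ≤ √(∑ i, u i ^ 2) := by
  have h1 : HasDerivAt (fun t : ℝ => k (x + t • u)) (fderiv ℝ k x u) 0 := by
    have h2 : HasDerivAt (fun t : ℝ => x + t • u) u 0 := by
      simpa using ((hasDerivAt_id (0 : ℝ)).smul_const u).const_add x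
    have h3 : HasFDerivAt k (fderiv ℝ k x) (x + (0 : ℝ) • u) := by
      simpa using (hk x).hasFDerivAt
    exact h3.comp_hasDerivAt 0 h2
  refine (le_abs_self _).trans (h1.le_of_lip' (Real.sqrt_nonneg _) (Eventually.of_forall
    fun t => ?_))
  have h4 := h x (t • u)
  simp only [Pi.smul_apply, smul_eq_mul, mul_pow, ← Finset.mul_sum, Real.sqrt_mul (sq_nonneg t),
    Real.sqrt_sq_eq_abs] at h4
  simpa [mul_comm] using h4

end SmoothTestFunctions

/-! ### Centered Gaussian variables and their finite-dimensional projections -/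

lemma integrable_comp_of_lipschitzWith {α E : Type*} [MeasurableSpace α] {P : Measure α}
    [IsFiniteMeasure P] [NormedAddCommGroup E] {X : α → E} (hX : Integrable X P) {g : E → ℝ}
    {C : ℝ≥0} (hg : LipschitzWith C g) : Integrable (fun ω => g (X ω)) P := by
  refine Integrable.mono' (g := fun ω => ‖g 0‖ + C * ‖X ω‖) ((integrable_const _).add
    (hX.norm.const_mul _)) (hg.continuous.comp_aestronglyMeasurable hX.1)
    (ae_of_all _ fun ω => ?_)
  have h2 := hg.dist_le_mul (X ω) 0
  rw [dist_eq_norm, dist_zero_right] at h2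
  have := norm_le_norm_add_norm_sub' (g (X ω)) (g 0)
  linarith

section CenteredGaussian

variable {Ω' K : Type*} [MeasurableSpace Ω'] [NormedAddCommGroup K] [InnerProductSpace ℝ K]
  [MeasurableSpace K] [BorelSpace K] {P' : Measure Ω'} {Z : Ω' → K}

variable {n : ℕ} (b : Fin n → K)

lemma IsCenteredNondegGaussian.isGaussian_map_analysis (hZ : IsCenteredNondegGaussian Z P') :
    IsGaussian (P'.map fun ω => analysis b (Z ω)) :=
  (hZ.gaussian.map_fun (analysis b)).isGaussian_map

lemma IsCenteredNondegGaussian.integral_map_analysis (hZ : IsCenteredNondegGaussian Z P')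
    {E : Type*} [NormedAddCommGroup E] [NormedSpace ℝ E] {h : (Fin n → ℝ) → E}
    (hh : Continuous h) :
    ∫ z, h z ∂(P'.map fun ω => analysis b (Z ω)) = ∫ ω, h (analysis b (Z ω)) ∂P' :=
  integral_map ((analysis b).continuous.measurable.comp_aemeasurable hZ.gaussian.aemeasurable)
    hh.aestronglyMeasurable

lemma IsCenteredNondegGaussian.integral_dual_map_analysis (hZ : IsCenteredNondegGaussian Z P')
    (L : StrongDual ℝ (Fin n → ℝ)) :
    ∫ z, L z ∂(P'.map fun ω => analysis b (Z ω)) = 0 := by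
  rw [hZ.integral_map_analysis b L.continuous]
  exact hZ.centered (L.comp (analysis b))

variable [CompleteSpace K] [SecondCountableTopology K]

lemma IsCenteredNondegGaussian.memLp_two (hZ : IsCenteredNondegGaussian Z P') : MemLp Z 2 P' :=
  hZ.gaussian.memLp_two

lemma IsCenteredNondegGaussian.inner_covarianceOp (hZ : IsCenteredNondegGaussian Z P')
    {S : K →L[ℝ] K} (hS : IsCovarianceOp Z P' S) (u v : K) :
    inner ℝ v (S u) = ∫ ω, inner ℝ v (Z ω) * inner ℝ u (Z ω) ∂P' := by
  have h2 := hZ.memLp_two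
  have hi : Integrable (fun ω => (inner ℝ (Z ω) u : ℝ) • Z ω) P' :=
    memLp_one_iff_integrable.1 (MemLp.smul (r := 1) h2 (h2.inner_const u))
  rw [hS u, ← integral_inner hi]
  refine integral_congr_ae (ae_of_all _ fun ω => ?_)
  simp only [real_inner_smul_right, real_inner_comm u]
  ring

lemma IsCenteredNondegGaussian.inner_covarianceOp_self_pos
    (hZ : IsCenteredNondegGaussian Z P') {S : K →L[ℝ] K} (hS : IsCovarianceOp Z P' S) {u : K}
    (hu : u ≠ 0) : 0 < inner ℝ u (S u) := by
  have h1 := hZ.nondegenerate (innerSL ℝ u) fun h => hu (by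
    simpa using congrArg (fun L : StrongDual ℝ K => L u) h)
  have h2 : MemLp (fun ω => innerSL ℝ u (Z ω)) 2 P' := hZ.memLp_two.const_inner u
  rw [variance_of_integral_eq_zero h2.1.aemeasurable (hZ.centered _)] at h1
  rw [hZ.inner_covarianceOp hS]
  simpa [sq] using h1

lemma IsCenteredNondegGaussian.integral_mul_map_analysis (hZ : IsCenteredNondegGaussian Z P')
    {S : K →L[ℝ] K} (hS : IsCovarianceOp Z P' S) (i j : Fin n) :
    ∫ z, z i * z j ∂(P'.map fun ω => analysis b (Z ω)) = inner ℝ (b i) (S (b j)) := by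
  rw [hZ.integral_map_analysis b (h := fun z => z i * z j) (by fun_prop),
    hZ.inner_covarianceOp hS]
  rfl

end CenteredGaussian

/-! ### Finite-dimensional bounds for test functions on K -/

section ProjectedTestFunctions

variable {Ω : Type*} [MeasurableSpace Ω] {P : Measure Ω} [IsProbabilityMeasure P]
  {K : Type*} [NormedAddCommGroup K] [InnerProductSpace ℝ K] {n : ℕ}
  {μ : Measure (Fin n → ℝ)} [IsGaussian μ]

lemma lipschitzWith_of_mem_cb2Ball [CompleteSpace K] {h : K → ℝ} (hh : h ∈ cb2Ball K) :
    LipschitzWith 1 h := by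
  refine lipschitzWith_of_nnnorm_fderiv_le (𝕜 := ℝ) hh.1 fun x => ?_
  have h1 : ‖fderiv ℝ h x‖ₑ ≤ 1 :=
    (le_iSup (fun x => ‖fderiv ℝ h x‖ₑ) x).trans ((le_max_left _ _).trans hh.2.2)
  simpa [enorm_eq_nnnorm] using h1

lemma hsNorm_fderiv_fderiv_le_of_mem_cb2Ball [CompleteSpace K] {h : K → ℝ} (hh : h ∈ cb2Ball K)
    (x : K) : hsNorm (fderiv ℝ (fderiv ℝ h) x) ≤ 1 :=
  (le_iSup (fun x => hsNorm (fderiv ℝ (fderiv ℝ h) x)) x).trans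
    ((le_max_right _ _).trans hh.2.2)

namespace DirichletStructure

variable (D : DirichletStructure P) {f g : Fin n → D.dom}

/-- It suffices to bound `|E h(f) - ∫ h dμ|` for smooth approximations of `h`. -/
lemma abs_integral_vec_sub_le_of_approx {h : (Fin n → ℝ) → ℝ} {C : ℝ≥0} (hh : LipschitzWith C h)
    {c : ℝ} (hc : ∀ ε > 0, ∃ k : (Fin n → ℝ) → ℝ, Continuous k ∧ (∀ x, |k x - h x| ≤ ε) ∧
      |∫ ω, k (D.vec f ω) ∂P - ∫ x, k x ∂μ| ≤ c) :
    |∫ ω, h (D.vec f ω) ∂P - ∫ x, h x ∂μ| ≤ c := by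
  have hm : AEMeasurable (D.vec f) P := (D.measurable_vec f).aemeasurable
  have : IsProbabilityMeasure (P.map (D.vec f)) := Measure.isProbabilityMeasure_map hm
  have he : ∀ k : (Fin n → ℝ) → ℝ, Continuous k →
      ∫ ω, k (D.vec f ω) ∂P = ∫ x, k x ∂(P.map (D.vec f)) := fun k hk =>
    (integral_map hm hk.aestronglyMeasurable).symm
  rw [he h hh.continuous]
  refine abs_integral_sub_le_of_approx ?_ ?_ fun ε hε => ?_
  · rw [integrable_map_measure hh.continuous.aestronglyMeasurable hm]
    exact integrable_comp_of_lipschitzWith (D.integrable_vec f) hh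
  · exact integrable_comp_of_lipschitzWith (X := id)
      ((IsGaussian.memLp_two_id (μ := μ)).integrable one_le_two) hh
  · obtain ⟨k, h1, h2, h3⟩ := hc ε hε
    exact ⟨k, h1, h2, by rwa [← he k h1]⟩

/-- The finite-dimensional bound for test functions in the unit ball of `C_b²`. -/
theorem abs_integral_synthesis_sub_le_of_mem_cb2Ball [CompleteSpace K]
    (hfg : ∀ i (u : D.dom), D.form (g i) u = inner ℝ (f i : Lp ℝ 2 P) (u : Lp ℝ 2 P))
    (hμ : ∀ L : StrongDual ℝ (Fin n → ℝ), ∫ z, L z ∂μ = 0)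
    {e : Fin n → OnbIndex K} (he : Function.Injective e) {h : K → ℝ} (hh : h ∈ cb2Ball K) :
    |∫ ω, h (synthesis (fun i => onb K (e i)) (D.vec f ω)) ∂P
        - ∫ z, h (synthesis (fun i => onb K (e i)) z) ∂μ|
      ≤ 2⁻¹ * ∫ ω, frob (D.covSubCdc μ f g ω) ∂P := by
  set b : Fin n → K := fun i => onb K (e i)
  have hlip := (lipschitzWith_of_mem_cb2Ball hh).comp (synthesis b).lipschitz
  have hH := fun x => sum_sum_sq_hessian_le (hsNorm_fderiv_fderiv_le_of_mem_cb2Ball hh x) he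
  have hd : Differentiable ℝ (h ∘ synthesis b) := hh.1.comp (synthesis b).differentiable
  have hd' : Differentiable ℝ (fderiv ℝ (h ∘ synthesis b)) := fun x =>
    (hasFDerivAt_fderiv_comp_synthesis hh.1 hh.2.1 x).differentiableAt
  refine D.abs_integral_vec_sub_le_of_approx hlip fun ε hε => ?_
  obtain ⟨k, hk, ⟨C₁, hC₁⟩, ⟨C₂, hC₂⟩, hkh, -, hkT⟩ := exists_smooth_approx hlip hε
  refine ⟨k, hk.continuous, hkh, D.abs_integral_sub_le_of_hessian hfg hμ hk hC₁ hC₂ fun x A => ?_⟩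
  -- The Hilbert–Schmidt bound is encoded as the linear bounds ⟨A, Hess⟩ ≤ `frob A` over all
  -- matrices A, a form that mollification preserves.
  let T : ((Fin n → ℝ) →L[ℝ] (Fin n → ℝ) →L[ℝ] ℝ) →L[ℝ] ℝ := ∑ i, ∑ j, A i j •
    ((ContinuousLinearMap.apply ℝ ℝ (Pi.single j 1 : Fin n → ℝ)).comp
      (ContinuousLinearMap.apply ℝ ((Fin n → ℝ) →L[ℝ] ℝ) (Pi.single i 1 : Fin n → ℝ)))
  have hT : ∀ B, T B = ∑ i, ∑ j, A i j * B (Pi.single i 1) (Pi.single j 1) := fun B => by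
    simp [T]
  rw [← hT]
  refine hkT hd hd' ⟨(n : ℝ) * n, fun y => norm_le_of_abs_entries_le _ fun i j => ?_⟩ T _
    (fun y => ?_) x
  · rw [fderiv_fderiv_comp_synthesis hh.1 hh.2.1, ← sq_le_one_iff_abs_le_one]
    refine le_trans ?_ (hH (synthesis b y))
    refine le_trans ?_ (Finset.single_le_sum (fun i _ => Finset.sum_nonneg fun j _ => sq_nonneg _)
      (Finset.mem_univ i))
    exact Finset.single_le_sum (f := fun j => fderiv ℝ (fderiv ℝ h) (synthesis b y) (b i) (b j) ^ 2)
      (fun j _ => sq_nonneg _) (Finset.mem_univ j)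
  · rw [hT]
    simp only [fderiv_fderiv_comp_synthesis hh.1 hh.2.1]
    exact sum_sum_mul_le_frob (hH (synthesis b y))

/-- The finite-dimensional bound for Lipschitz test functions. -/
theorem abs_integral_synthesis_sub_le_of_lipschitzWith
    (hfg : ∀ i (u : D.dom), D.form (g i) u = inner ℝ (f i : Lp ℝ 2 P) (u : Lp ℝ 2 P))
    (hμ : ∀ L : StrongDual ℝ (Fin n → ℝ), ∫ z, L z ∂μ = 0)
    (l : Fin n → StrongDual ℝ (Fin n → ℝ)) (hl : ∀ i, ∫ z, l i z • z ∂μ = Pi.single i 1)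
    {κ : ℝ} (hκ : ∀ a : Fin n → ℝ, ∫ z, (∑ i, a i * l i z) ^ 2 ∂μ ≤ κ * ∑ i, a i ^ 2)
    {b : Fin n → K} (hb : Orthonormal ℝ b) {h : K → ℝ} (hh : LipschitzWith 1 h) :
    |∫ ω, h (synthesis b (D.vec f ω)) ∂P - ∫ z, h (synthesis b z) ∂μ|
      ≤ √κ * ∫ ω, frob (D.covSubCdc μ f g ω) ∂P := by
  have hlip := hh.comp (synthesis b).lipschitz
  refine D.abs_integral_vec_sub_le_of_approx hlip fun ε hε => ?_
  obtain ⟨k, hk, ⟨C₁, hC₁⟩, ⟨C₂, hC₂⟩, hkh, hkL, -⟩ := exists_smooth_approx hlip hε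
  refine ⟨k, hk.continuous, hkh, D.abs_integral_sub_le_of_gradient hfg hμ l hl hκ hk hC₁ hC₂ ?_⟩
  -- `synthesis b` is isometric for the Euclidean length, so increments of h ∘ `synthesis b` in
  -- direction u are at most that of u.
  refine fderiv_apply_le_of_abs_add_sub_le (hk.differentiable (by norm_num)) fun x u =>
    hkL u _ (fun y => ?_) x
  have h1 := hh.dist_le_mul (synthesis b (y + u)) (synthesis b y)
  rw [map_add, dist_eq_norm, dist_eq_norm, add_sub_cancel_left, norm_synthesis hb,
    NNReal.coe_one, one_mul, ← map_add] at h1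
  exact h1

end DirichletStructure

end ProjectedTestFunctions

/-! ### From Frobenius norms to the norm of L²(Ω; HS) -/

section HilbertSchmidtBound

variable {Ω : Type*} [MeasurableSpace Ω] {P : Measure Ω} [IsProbabilityMeasure P]
  {K : Type*} [NormedAddCommGroup K] [InnerProductSpace ℝ K] [CompleteSpace K] {n : ℕ}

/-- A is, up to signs, a finite block of the matrix of T: each column is controlled by Bessel, and
the columns are part of the Hilbert–Schmidt sum. -/
lemma ofReal_frob_sq_le_hsNorm_sq (T : K →L[ℝ] K) {e : Fin n → OnbIndex K}
    (he : Function.Injective e) {A : Fin n → Fin n → ℝ}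
    (hA : ∀ i j, |A i j| = |inner ℝ (onb K (e i)) (T (onb K (e j)))|) :
    ENNReal.ofReal (frob A) ^ 2 ≤ hsNorm T ^ 2 := by
  refine le_trans ?_ (sum_enorm_sq_le_hsNorm_sq T he)
  rw [← ENNReal.ofReal_pow (frob_nonneg A), frob,
    Real.sq_sqrt (Finset.sum_nonneg fun i _ => Finset.sum_nonneg fun j _ => sq_nonneg _)]
  simp only [← ofReal_norm, ← ENNReal.ofReal_pow (norm_nonneg _)]
  rw [← ENNReal.ofReal_sum_of_nonneg fun i _ => by positivity, Finset.sum_comm]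
  refine ENNReal.ofReal_le_ofReal (Finset.sum_le_sum fun j _ => ?_)
  have h1 := ((onb K).orthonormal.comp e he).sum_inner_products_le (s := Finset.univ)
    (T (onb K (e j)))
  refine le_trans (le_of_eq (Finset.sum_congr rfl fun i _ => ?_)) h1
  rw [← sq_abs, hA, Real.norm_eq_abs]
  rfl

/-- On a probability space the L¹ norm is at most the L² norm. The passage to T uses only
monotonicity of the lower integral, so no measurability of T is involved. -/
lemma ofReal_integral_le_l2hsNorm {φ : Ω → ℝ} (hφ : AEStronglyMeasurable φ P) (hφ0 : ∀ ω, 0 ≤ φ ω)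
    {T : Ω → K →L[ℝ] K}
    (hT : ∀ᵐ ω ∂P, ENNReal.ofReal (φ ω) ^ 2 ≤ hsNorm (T ω) ^ 2) :
    ENNReal.ofReal (∫ ω, φ ω ∂P) ≤ l2hsNorm P T := by
  rw [integral_eq_lintegral_of_nonneg_ae (ae_of_all _ hφ0) hφ]
  refine ENNReal.ofReal_toReal_le.trans ?_
  have h1 := eLpNorm_le_eLpNorm_of_exponent_le (μ := P) (p := 1) (q := 2) (by norm_num) hφ
  rw [eLpNorm_one_eq_lintegral_enorm,
    eLpNorm_eq_lintegral_rpow_enorm_toReal (by norm_num) (by norm_num)] at h1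
  have h2 : ∀ ω, ‖φ ω‖ₑ = ENNReal.ofReal (φ ω) := fun ω => Real.enorm_of_nonneg (hφ0 ω)
  simp only [h2, ENNReal.toReal_ofNat, ENNReal.rpow_ofNat] at h1
  exact h1.trans (ENNReal.rpow_le_rpow (lintegral_mono_ae hT) (by norm_num))

end HilbertSchmidtBound

/-! ### The normal approximation bounds -/

lemma DirichletStructure.ae_vec_eq_analysis {Ω K : Type*} [MeasurableSpace Ω]
    [NormedAddCommGroup K] [InnerProductSpace ℝ K] [CompleteSpace K] {P : Measure Ω}
    (D : DirichletStructure P) {F : Lp K 2 P} {f : OnbIndex K → D.dom} {n : ℕ}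
    (hf : ∀ i, coord (onb K i) F = f i) (e : Fin n → OnbIndex K) :
    ∀ᵐ ω ∂P, D.vec (fun i => f (e i)) ω = analysis (fun i => onb K (e i)) (F ω) := by
  filter_upwards [ae_all_iff.2 fun i => coeFn_coord (P := P) (onb K (e i)) F] with ω hω
  funext i
  rw [analysis_apply, ← hω i, hf]
  rfl

/-! ### Comparison with the operator Γ(F, G) − S -/

section VectorBound

variable {Ω Ω' K : Type*} [MeasurableSpace Ω] [MeasurableSpace Ω'] [NormedAddCommGroup K]
  [InnerProductSpace ℝ K] [CompleteSpace K] [SecondCountableTopology K] [MeasurableSpace K]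
  [BorelSpace K] {P : Measure Ω} [IsProbabilityMeasure P] {P' : Measure Ω'} {Z : Ω' → K}
  {S : K →L[ℝ] K} {n : ℕ} (D : DirichletStructure P) {F G : Lp K 2 P}
  {f g : OnbIndex K → D.dom}

/-- Up to sign, the entries of `covSubCdc` are matrix coefficients of Γ(F, G) − S, so the bound is
the same for every finite set of basis vectors. -/
lemma DirichletStructure.ofReal_integral_frob_covSubCdc_le (hZ : IsCenteredNondegGaussian Z P')
    (hS : IsCovarianceOp Z P' S) (hf : ∀ i, coord (onb K i) F = f i)
    (hg : ∀ i, coord (onb K i) G = g i) (hfs : Summable fun i => D.form (f i) (f i))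
    (hgs : Summable fun i => D.form (g i) (g i)) {e : Fin n → OnbIndex K}
    (he : Function.Injective e) :
    ENNReal.ofReal (∫ ω, frob (D.covSubCdc (P'.map fun ω => analysis (fun i => onb K (e i)) (Z ω))
      (fun i => f (e i)) (fun i => g (e i)) ω) ∂P)
      ≤ l2hsNorm P fun ω => D.cdcK F G ω - S := by
  have := hZ.isGaussian_map_analysis (fun i => onb K (e i))
  refine ofReal_integral_le_l2hsNorm (D.integrable_frob_covSubCdc _ _).1
    (fun ω => frob_nonneg _) ?_
  filter_upwards [D.ae_inner_cdcK hf hg hfs hgs] with ω hω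
  refine ofReal_frob_sq_le_hsNorm_sq _ he fun i j => ?_
  rw [DirichletStructure.covSubCdc, hZ.integral_mul_map_analysis _ hS, sub_apply, inner_sub_right,
    hω, abs_sub_comm]

end VectorBound

/-! ### Exhausting K by coordinate projections -/

section FiniteProjections

variable {K : Type*} [NormedAddCommGroup K] [InnerProductSpace ℝ K]

lemma synthesis_analysis_eq_sum {ι : Type*} (b : ι → K) (s : Finset ι) (x : K) :
    synthesis (fun i => b (s.equivFin.symm i)) (analysis (fun i => b (s.equivFin.symm i)) x)
      = ∑ i ∈ s, (inner ℝ (b i) x : ℝ) • b i := by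
  rw [synthesis_apply, ← Finset.sum_coe_sort s, ← s.equivFin.symm.sum_comp]
  rfl

/-- Expectations of Lipschitz functions of the finite-dimensional projections converge. -/
lemma tendsto_integral_synthesis_analysis {Ω ι : Type*} [MeasurableSpace Ω] {P : Measure Ω}
    [IsFiniteMeasure P] [Countable ι] (b : HilbertBasis ι ℝ K) {X : Ω → K} (hX : Integrable X P)
    {h : K → ℝ} (hh : LipschitzWith 1 h) :
    Tendsto (fun s : Finset ι => ∫ ω, h (synthesis (fun i => b (s.equivFin.symm i))
      (analysis (fun i => b (s.equivFin.symm i)) (X ω))) ∂P) atTop (𝓝 (∫ ω, h (X ω) ∂P)) := by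
  -- The projections are contractions and h is 1-Lipschitz, which gives the dominating function;
  -- countability of ι makes the filter of finite sets countably generated.
  refine tendsto_integral_filter_of_dominated_convergence (fun ω => |h 0| + ‖X ω‖)
    (Eventually.of_forall fun s => ?_) (Eventually.of_forall fun s => ae_of_all _ fun ω => ?_)
    ((integrable_const _).add hX.norm) (ae_of_all _ fun ω => ?_)
  · exact (hh.continuous.comp ((synthesis _).continuous.comp
      (analysis _).continuous)).comp_aestronglyMeasurable hX.1
  · set y := synthesis (fun i => b (s.equivFin.symm i))
      (analysis (fun i => b (s.equivFin.symm i)) (X ω))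
    have h1 : ‖y‖ ≤ ‖X ω‖ := norm_synthesis_analysis_le (b.orthonormal.comp _
      (Subtype.val_injective.comp s.equivFin.symm.injective)) _
    have h2 := hh.dist_le_mul y 0
    rw [dist_eq_norm, dist_zero_right, NNReal.coe_one, one_mul] at h2
    have h3 := norm_le_norm_add_norm_sub' (h y) (h 0)
    rw [Real.norm_eq_abs (h 0)] at h3
    linarith
  · have h1 := b.hasSum_repr (X ω)
    simp only [b.repr_apply_apply] at h1
    simp only [synthesis_analysis_eq_sum]
    exact (hh.continuous.tendsto _).comp h1

lemma synthesis_analysis_of_bijective {ι : Type*} (b : HilbertBasis ι ℝ K) {n : ℕ}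
    (e : Fin n ≃ ι) (x : K) :
    synthesis (fun i => b (e i)) (analysis (fun i => b (e i)) x) = x := by
  have h1 := b.hasSum_repr x
  simp only [b.repr_apply_apply] at h1
  rw [synthesis_apply]
  exact (hasSum_fintype _).unique (e.hasSum_iff.2 h1)

end FiniteProjections

/-! ### The inverse covariance operator in finite dimension -/

section InverseCovariance

variable {Ω' K : Type*} [MeasurableSpace Ω'] [NormedAddCommGroup K] [InnerProductSpace ℝ K]
  [FiniteDimensional ℝ K] [MeasurableSpace K] [BorelSpace K] {P' : Measure Ω'} {Z : Ω' → K}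
  {S : K →L[ℝ] K}

/-- `S.inverse` is 0 by default unless S is invertible. Non-degeneracy makes ⟨u, S u⟩ positive for u
≠ 0, so S is injective, hence invertible in finite dimension. -/
lemma IsCenteredNondegGaussian.covarianceOp_inverse (hZ : IsCenteredNondegGaussian Z P')
    (hS : IsCovarianceOp Z P' S) (x : K) : S (S.inverse x) = x := by
  have : CompleteSpace K := FiniteDimensional.complete ℝ K
  have : SecondCountableTopology K := UniformSpace.secondCountable_of_separable K
  have hinj : Function.Injective (S : K →ₗ[ℝ] K) := by
    refine LinearMap.ker_eq_bot.1 (LinearMap.ker_eq_bot'.2 fun u hu => ?_)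
    by_contra h0
    have h1 := hZ.inner_covarianceOp_self_pos hS h0
    rw [show S u = 0 from hu, inner_zero_right] at h1
    exact lt_irrefl _ h1
  obtain ⟨E, rfl⟩ : ∃ E : K ≃L[ℝ] K, (E : K →L[ℝ] K) = S :=
    ⟨(LinearEquiv.ofInjectiveEndo _ hinj).toContinuousLinearEquiv, by ext; rfl⟩
  rw [ContinuousLinearMap.inverse_equiv]
  exact E.apply_symm_apply x

variable {n : ℕ} {b : Fin n → K}

/-- The functionals ⟨S⁻¹bᵢ, ·⟩ are the weights for the extra integration by parts, because E(⟨S⁻¹bᵢ,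
Z⟩ Z) = S S⁻¹ bᵢ = bᵢ. -/
lemma IsCenteredNondegGaussian.integral_dual_smul_map_analysis (hZ : IsCenteredNondegGaussian Z P')
    (hS : IsCovarianceOp Z P' S) (hb : Orthonormal ℝ b) (hb' : ∀ x, synthesis b (analysis b x) = x)
    (i : Fin n) :
    ∫ z, (innerSL ℝ (S.inverse (b i))).comp (synthesis b) z • z
      ∂(P'.map fun ω => analysis b (Z ω)) = Pi.single i 1 := by
  have : CompleteSpace K := FiniteDimensional.complete ℝ K
  have : SecondCountableTopology K := UniformSpace.secondCountable_of_separable K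
  rw [hZ.integral_map_analysis b (by fun_prop)]
  have h2 := hZ.memLp_two
  have hi : Integrable (fun ω => (inner ℝ (Z ω) (S.inverse (b i)) : ℝ) • Z ω) P' :=
    memLp_one_iff_integrable.1 (MemLp.smul (r := 1) h2 (h2.inner_const _))
  calc _ = ∫ ω, analysis b ((inner ℝ (Z ω) (S.inverse (b i)) : ℝ) • Z ω) ∂P' := by
        refine integral_congr_ae (ae_of_all _ fun ω => ?_)
        simp [hb', real_inner_comm]
    _ = analysis b (b i) := by
        rw [(analysis b).integral_comp_comm hi, ← hS, hZ.covarianceOp_inverse hS]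
    _ = Pi.single i 1 := by
        funext j
        rw [analysis_apply, orthonormal_iff_ite.1 hb, Pi.single_apply]

/-- With y = ∑ aᵢ bᵢ the second moment is ⟨S⁻¹y, S S⁻¹y⟩ = ⟨S⁻¹y, y⟩; this is the origin of κ =
‖S⁻¹‖. -/
lemma IsCenteredNondegGaussian.integral_sum_dual_sq_le (hZ : IsCenteredNondegGaussian Z P')
    (hS : IsCovarianceOp Z P' S) (hb : Orthonormal ℝ b) (hb' : ∀ x, synthesis b (analysis b x) = x)
    (a : Fin n → ℝ) :
    ∫ z, (∑ i, a i * (innerSL ℝ (S.inverse (b i))).comp (synthesis b) z) ^ 2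
      ∂(P'.map fun ω => analysis b (Z ω)) ≤ ‖S.inverse‖ * ∑ i, a i ^ 2 := by
  have : CompleteSpace K := FiniteDimensional.complete ℝ K
  have : SecondCountableTopology K := UniformSpace.secondCountable_of_separable K
  rw [hZ.integral_map_analysis b (by fun_prop)]
  set y := synthesis b a with hy
  have h1 : ∀ ω, (∑ i, a i * (innerSL ℝ (S.inverse (b i))).comp (synthesis b)
      (analysis b (Z ω))) ^ 2
      = inner ℝ (S.inverse y) (Z ω) * inner ℝ (S.inverse y) (Z ω) := fun ω => by
    rw [sq]
    simp [hy, synthesis_apply b a, hb', sum_inner, real_inner_smul_left]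
  simp only [h1]
  rw [← hZ.inner_covarianceOp hS, hZ.covarianceOp_inverse hS]
  have h2 : ∑ i, a i ^ 2 = ‖y‖ ^ 2 := by
    rw [hy, norm_synthesis hb, Real.sq_sqrt (Finset.sum_nonneg fun _ _ => sq_nonneg _)]
  rw [h2]
  calc _ ≤ ‖S.inverse y‖ * ‖y‖ := real_inner_le_norm _ _
    _ ≤ ‖S.inverse‖ * ‖y‖ * ‖y‖ := by gcongr; exact S.inverse.le_opNorm y
    _ = _ := by ring

/-- The interpolation yields √‖S⁻¹‖; the stated constant is larger because ‖S‖ ‖S⁻¹‖ ≥ 1 and d ≥ 1,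
both of which need K ≠ 0. -/
lemma IsCenteredNondegGaussian.sqrt_norm_inverse_le [Nontrivial K]
    (hZ : IsCenteredNondegGaussian Z P') (hS : IsCovarianceOp Z P' S) :
    √‖S.inverse‖ ≤ √(Module.finrank ℝ K * ‖S‖) * ‖S.inverse‖ := by
  obtain ⟨x, hx⟩ := exists_ne (0 : K)
  have h1 : 1 ≤ ‖S‖ * ‖S.inverse‖ := by
    have h2 : ‖x‖ ≤ ‖S‖ * ‖S.inverse‖ * ‖x‖ := by
      conv_lhs => rw [← hZ.covarianceOp_inverse hS x]
      rw [mul_assoc]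
      exact (S.le_opNorm _).trans (by gcongr; exact S.inverse.le_opNorm x)
    have := norm_pos_iff.2 hx
    nlinarith
  have h3 : (1 : ℝ) ≤ Module.finrank ℝ K := by exact_mod_cast Module.finrank_pos
  refine Real.sqrt_le_iff.2 ⟨by positivity, ?_⟩
  rw [mul_pow, Real.sq_sqrt (by positivity)]
  calc ‖S.inverse‖ = 1 * 1 * ‖S.inverse‖ := by ring
    _ ≤ Module.finrank ℝ K * (‖S‖ * ‖S.inverse‖) * ‖S.inverse‖ := by gcongr
    _ = _ := by ring

end InverseCovariance

theorem theorem3p2 {Ω Ω' K : Type*} [MeasurableSpace Ω] [MeasurableSpace Ω']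
    [NormedAddCommGroup K] [InnerProductSpace ℝ K] [CompleteSpace K]
    [TopologicalSpace.SeparableSpace K] [MeasurableSpace K] [BorelSpace K]
    (P : Measure Ω) [IsProbabilityMeasure P] (P' : Measure Ω') [IsProbabilityMeasure P']
    (D : DirichletStructure P) (ev : ℕ → ℝ) (hD : D.IsDiagonalizedBy ev)
    (F : Lp K 2 P) (hF : F ∈ D.domK K ev) (hF0 : ∫ ω, F ω ∂P = 0)
    (Z : Ω' → K) (hZ : IsCenteredNondegGaussian Z P')
    (S : K →L[ℝ] K) (hS : IsCovarianceOp Z P' S) :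
    d2Dist (P.map F) (P'.map Z)
        ≤ 2⁻¹ * l2hsNorm P (fun ω => D.cdcK F (-(D.pseudoInvK ev F)) ω - S) ∧
    (FiniteDimensional ℝ K →
      wassersteinDist (P.map F) (P'.map Z)
        ≤ ENNReal.ofReal (√(Module.finrank ℝ K * ‖S‖) * ‖S.inverse‖) *
          l2hsNorm P (fun ω => D.cdcK F (-(D.pseudoInvK ev F)) ω - S)) := by
  have : SecondCountableTopology K := UniformSpace.secondCountable_of_separable K
  obtain ⟨f, hf, hfs⟩ := hD.exists_coord_mem_dom hF
  obtain ⟨g, hg, hgs, hfg⟩ := hD.exists_coord_neg_pseudoInvK_mem_dom hF0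
  have hfg' : ∀ i (u : D.dom), D.form (g i) u = inner ℝ (f i : Lp ℝ 2 P) (u : Lp ℝ 2 P) :=
    fun i u => by rw [hfg, hf]
  have hFm : AEMeasurable F P := (Lp.aestronglyMeasurable F).aemeasurable
  have hmap : ∀ h : K → ℝ, LipschitzWith 1 h →
      |∫ x, h x ∂(P.map F) - ∫ x, h x ∂(P'.map Z)| = |∫ ω, h (F ω) ∂P - ∫ ω, h (Z ω) ∂P'| :=
    fun h hh => by
      rw [integral_map hFm hh.continuous.aestronglyMeasurable,
        integral_map hZ.gaussian.aemeasurable hh.continuous.aestronglyMeasurable]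
  have hvec : ∀ {n : ℕ} (e : Fin n → OnbIndex K) (h : K → ℝ),
      ∫ ω, h (synthesis (fun i => onb K (e i)) (D.vec (fun i => f (e i)) ω)) ∂P
        = ∫ ω, h (synthesis (fun i => onb K (e i)) (analysis (fun i => onb K (e i)) (F ω))) ∂P :=
    fun e h => integral_congr_ae (by
      filter_upwards [D.ae_vec_eq_analysis hf e] with ω hω
      rw [hω])
  refine ⟨iSup₂_le fun h hh => ?_, fun hfin => iSup₂_le fun h hh => ?_⟩
  · have hlip := lipschitzWith_of_mem_cb2Ball hh
    rw [hmap h hlip]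
    have hlim := ENNReal.tendsto_ofReal ((tendsto_integral_synthesis_analysis (onb K)
      ((Lp.memLp F).integrable one_le_two) hlip).sub (tendsto_integral_synthesis_analysis (onb K)
      (hZ.memLp_two.integrable one_le_two) hlip)).abs
    -- The bound does not depend on the finite set s of basis vectors, so it passes to the limit.
    refine le_of_tendsto hlim (Eventually.of_forall fun s => ?_)
    have he : Function.Injective fun i => (s.equivFin.symm i : OnbIndex K) :=
      Subtype.val_injective.comp s.equivFin.symm.injective
    have hG := hZ.isGaussian_map_analysis fun i => (onb K (s.equivFin.symm i : OnbIndex K) : K)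
    have h1 := D.abs_integral_synthesis_sub_le_of_mem_cb2Ball (fun i => hfg' (s.equivFin.symm i))
      (hZ.integral_dual_map_analysis fun i => (onb K (s.equivFin.symm i) : K)) he hh
    rw [hvec, hZ.integral_map_analysis _ (h := fun z => h (synthesis _ z))
      (hlip.continuous.comp (synthesis _).continuous)] at h1
    refine (ENNReal.ofReal_le_ofReal h1).trans ?_
    rw [ENNReal.ofReal_mul (by norm_num), ENNReal.ofReal_inv_of_pos (by norm_num),
      ENNReal.ofReal_ofNat]
    gcongr
    exact D.ofReal_integral_frob_covSubCdc_le hZ hS hf hg hfs hgs he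
  · replace hh : LipschitzWith 1 h := hh
    rw [hmap h hh]
    -- For K = 0 the constant is 0, but every test function is constant and the difference of
    -- expectations vanishes.
    rcases subsingleton_or_nontrivial K with hK | hK
    · have h1 : ∀ x, h x = h 0 := fun x => congrArg h (Subsingleton.elim _ _)
      simp [h1]
    have : Finite (OnbIndex K) := (onb K).orthonormal.linearIndependent.finite
    obtain ⟨n, ⟨e⟩⟩ := Finite.exists_equiv_fin (OnbIndex K)
    have hb : Orthonormal ℝ fun i => (onb K (e.symm i) : K) :=
      (onb K).orthonormal.comp e.symm e.symm.injective
    have hb' := synthesis_analysis_of_bijective (onb K) e.symm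
    have hG := hZ.isGaussian_map_analysis fun i => (onb K (e.symm i) : K)
    -- In finite dimension the whole basis is used at once, so no limit is needed.
    have h1 := D.abs_integral_synthesis_sub_le_of_lipschitzWith (fun i => hfg' (e.symm i))
      (hZ.integral_dual_map_analysis fun i => (onb K (e.symm i) : K)) _
      (hZ.integral_dual_smul_map_analysis hS hb hb')
      (hZ.integral_sum_dual_sq_le hS hb hb') hb hh
    have h2 := hvec e.symm h
    rw [h2, hZ.integral_map_analysis _ (h := fun z => h (synthesis _ z))
      (hh.continuous.comp (synthesis _).continuous)] at h1
    simp only [hb'] at h1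
    refine (ENNReal.ofReal_le_ofReal h1).trans ?_
    rw [ENNReal.ofReal_mul (Real.sqrt_nonneg _)]
    exact mul_le_mul' (ENNReal.ofReal_le_ofReal (hZ.sqrt_norm_inverse_le hS))
      (D.ofReal_integral_frob_covSubCdc_le hZ hS hf hg hfs hgs e.symm.injective)

end
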